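/- **Setting.** Let $(a_m)_{m\ge1}$ be real numbers and, for $|z|<1$, $|q|<1$, \[P(z,q)=1+\sum_{n\ge1}Q_n(z)q^n=\prod_{m\ge1}(1-zq^m)^{-a_m}.\] Let $0<s_0<c$ and $-1<\sigma_0<0$. For integers $h\ge0,\ k\ge1$ put $D_{h,k}(s)=\sum_{m\ge1}e^{2\pi i hm/k}a_m m^{-s}$ and assume: 1. each $D_{h,k}(s)$ converges absolutely and uniformly in the half plane $\Re s>c$; 2. each $D_{h,k}$ has a meromorphic continuation to $\Re s\ge\sigma_0$ whose only possible singularity is an at most simple pole at $s_0$, with residue $A_{h,k}$ (possibly $0$); 3. there are $C_1,C_2>0$, independent of $h,k$, with $|(s-s_0)D_{h,k}(s)|\le C_1(1+|\Im s|)^{C_2}k^{s_0+|\Re s|}$ for $\sigma_0\le\Re s\le c$. Write $D_{h,k}(0)=\sum_{j\bmod k}e^{2\pi i hj/k}b_k(j)$ and $A_{h,k}=\sum_{j\bmod k}e^{2\pi i hj/k}c_k(j)$ (discrete Fourier expansions in $h$), $\mathrm{Li}_s(z)=\sum_{l\ge1}z^l l^{-s}$, and \[\Psi_{h,k}(z,w)=\frac{\Gamma(s_0+1)}{s_0w^{s_0}}\sum_{j\bmod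 k}c_k(j)\,\mathrm{Li}_{s_0+1}(e^{2\pi i hj/k}z),\qquad \Phi_{h,k}(z)=w^{s_0}s_0\Psi_{h,k}(z,w),\] \[\omega_{h,k,n}(z)=e^{-2\pi i hn/k}\prod_{j\bmod k}(1-e^{2\pi i hj/k}z)^{-b_k(j)},\qquad L_{h,k}(z)=\Phi_{h,k}(z)^{1/(s_0+1)},\] where $\Phi_{h,k}$ does not depend on $w$ and all powers are principal ($\arg\in(-\pi,\pi]$). Pairs $(h,k)$ and $(p,q)$ always consist of relatively prime integers with $0<h\le k$, $0<p\le q$. Let $U$ be a subset of the open unit disk $\mathbb D$ (for instance a domain, or a real interval). Write $L_{h,k}\in[L_{p,q}]$ if $\Re L_{h,k}=\Re L_{p,q}$ on $U$, and let the phase be \[R(p,q)=\{z\in U:\ \Re L_{p,q}(z)>\Re L_{h,k}(z)\text{ whenever }L_{h,k}\notin[L_{p,q}]\}.\] Let $X\subset R(p,q)$ be compact and nonempty and assume: 4. $0<\inf_X\Re L_{p,q}$ and $\sup_X\Re L_{p,q}<\infty$; 5. $\Re L_{h,k}(z)\to0$ as $k\to\infty$, uniformly in $z\in X$ and in $h$.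 For $\delta>0$ and $N=\lfloor\delta n^{1/(s_0+1)}\rfloor$ let $M_{h,k}$ be the Farey arc of order $N$ about $h/k$: the half-open interval, right endpoint included, between the mediants of $h/k$ with its two neighbours among the rational numbers of denominator at most $N$. Let \[J_{h,k,n}(z)=\int_{M_{h,k}}P(z,e^{-\tau})e^{n\tau}\,d\psi,\qquad \tau=n^{-1/(s_0+1)}\Re L_{p,q}(z)-2\pi i\psi,\] be the contribution of this arc to Cauchy's integral for $Q_n(z)$. Finally put $\mu=\min\left(\frac{-\sigma_0}{s_0+1},\frac{s_0}{2s_0+2}\right)$ and \[B_{h,k,n}(z)=\sqrt{\frac{L_{h,k}(z)}{2\pi(s_0+1)\,n^{(s_0+2)/(s_0+1)}}}\;\exp\left(\frac{s_0+1}{s_0}\,n^{s_0/(s_0+1)}L_{h,k}(z)\right).\] **Theorem.** There are only finitely many pairs $(h,k)$ with $L_{h,k}\in[L_{p,q}]$, and if $U$ is open then $\Phi_{h,k}=\Phi_{p,q}$ on $U$ for each of them. For every sufficiently small $\delta>0$ there are functions $\tilde I_{h,k,n}$ (depending on $\delta$) such that: * for all sufficiently large $n$ and all $z\in X$, $\displaystyle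 Q_n(z)=\sum_{(h,k):\,L_{h,k}\in[L_{p,q}]}\omega_{h,k,n}(z)\,\tilde I_{h,k,n}(z)$; * there is $\eta>0$ such that for all sufficiently large $n$, all $z\in X$ and all $(h,k)$ with $L_{h,k}\in[L_{p,q}]$, \[\left|\omega_{h,k,n}(z)\tilde I_{h,k,n}(z)-J_{h,k,n}(z)\right|\le \exp\left(-\eta\, n^{s_0/(s_0+1)}\right)\exp\left(\tfrac{s_0+1}{s_0}n^{s_0/(s_0+1)}\Re L_{p,q}(z)\right);\] * for every $(h,k)$ with $L_{h,k}\in[L_{p,q}]$: if $\Phi_{h,k}(z)\notin(-\infty,0]$ for all $z\in X$, then, uniformly in $z\in X$ as $n\to\infty$, \[\tilde I_{h,k,n}(z)=B_{h,k,n}(z)+O\left(n^{-\mu}|B_{h,k,n}(z)|\right);\] if $\Phi_{h,k}(z)\in(-\infty,0]$ for all $z\in X$, then, uniformly in $z\in X$ as $n\to\infty$, \[\tilde I_{h,k,n}(z)=2\Re B_{h,k,n}(z)+O\left(n^{-\mu}|B_{h,k,n}(z)|\right).\] (When $U$ is open the two conditions are thus the same as for $(p,q)$.) -/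

import Mathlib

open Filter Topology

noncomputable section

namespace PolyMeinardus

/-- The additive character `e(x) = exp(2 π i x)`. -/
def e (x : ℝ) : ℂ := Complex.exp (2 * (Real.pi : ℂ) * Complex.I * (x : ℂ))

/-- The generating function `P(z,q) = ∏_{m ≥ 1} (1 - z q^m)^{-a_m}` (principal powers; for
`z, q` in the unit disk every `1 - z q^m` has positive real part). -/
def P (a : ℕ → ℝ) (z q : ℂ) : ℂ :=
  ∏' m : ℕ, (1 - z * q ^ (m + 1)) ^ (-(a (m + 1) : ℂ))

/-- `Q_n(z)`, the coefficient of `q^n` in the expansion of `P(z,q)` at `q = 0`. -/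
def Q (a : ℕ → ℝ) (n : ℕ) (z : ℂ) : ℂ :=
  iteratedDeriv n (P a z) 0 / (n.factorial : ℂ)

/-- The coefficients `e(hm/k) a_m` of the twisted Dirichlet series `D_{h,k}`. -/
def twist (a : ℕ → ℝ) (h k : ℕ) (m : ℕ) : ℂ :=
  e ((h : ℝ) * (m : ℝ) / (k : ℝ)) * (a m : ℂ)

/-- The assumptions on the twisted Dirichlet series of `a`: `D h k` is the meromorphic
continuation of `∑_{m ≥ 1} e(hm/k) a_m m^{-s}` to `Re s ≥ σ₀`, and `A h k` is its residue
at `s₀` (which may vanish, in which case the singularity is removable). -/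
structure Admissible (a : ℕ → ℝ) (s₀ σ₀ c : ℝ) (D : ℕ → ℕ → ℂ → ℂ) (A : ℕ → ℕ → ℂ) :
    Prop where
  /-- absolute convergence in the half plane `Re s > c` -/
  summable : ∀ h k : ℕ, 0 < k → ∀ s : ℂ, c < s.re → LSeriesSummable (twist a h k) s
  /-- uniform convergence in the half plane `Re s > c` -/
  uniform : ∀ h k : ℕ, 0 < k →
    TendstoUniformlyOn
      (fun (N : ℕ) (s : ℂ) => ∑ m ∈ Finset.range N, LSeries.term (twist a h k) s m)
      (fun s : ℂ => LSeries (twist a h k) s) atTop {s : ℂ | c < s.re}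
  /-- `D h k` extends the Dirichlet series -/
  eq_series : ∀ h k : ℕ, 0 < k → ∀ s : ℂ, c < s.re → D h k s = LSeries (twist a h k) s
  /-- the continuation has no singularity in `Re s ≥ σ₀` except possibly at `s₀` -/
  analytic : ∀ h k : ℕ, 0 < k →
    AnalyticOnNhd ℂ (D h k) {s : ℂ | σ₀ ≤ s.re ∧ s ≠ (s₀ : ℂ)}
  /-- at `s₀` there is at most a simple pole, with residue `A h k` -/
  residue : ∀ h k : ℕ, 0 < k →
    Tendsto (fun s : ℂ => (s - (s₀ : ℂ)) * D h k s) (𝓝[≠] (s₀ : ℂ)) (𝓝 (A h k))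
  /-- growth in the strip `σ₀ ≤ Re s ≤ c`, uniform in `h` and polynomial in `k` -/
  bound : ∃ C₁ C₂ : ℝ, 0 < C₁ ∧ 0 < C₂ ∧ ∀ h k : ℕ, 0 < k → ∀ s : ℂ, σ₀ ≤ s.re → s.re ≤ c →
    ‖(s - (s₀ : ℂ)) * D h k s‖ ≤ C₁ * (1 + |s.im|) ^ C₂ * (k : ℝ) ^ (s₀ + |s.re|)

/-- The coefficient at `j` in the discrete Fourier expansion
`F h = ∑_{j mod k} e(hj/k) (fourierCoeff k F j)` of a `k`-periodic function `F`. -/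
def fourierCoeff (k : ℕ) (F : ℕ → ℂ) (j : ℕ) : ℂ :=
  (1 / (k : ℂ)) * ∑ h ∈ Finset.range k, e (-((h : ℝ) * (j : ℝ) / (k : ℝ))) * F h

/-- The polylogarithm `Li_s(z) = ∑_{l ≥ 1} z^l / l^s` for real order `s`, `|z| < 1`. -/
def Li (s : ℝ) (z : ℂ) : ℂ :=
  ∑' l : ℕ, z ^ (l + 1) / (((l + 1 : ℕ) : ℝ) ^ s : ℝ)

/-- `Ψ_{h,k}(z,w) = Γ(s₀+1) / (s₀ w^{s₀}) ∑_j c(j) Li_{s₀+1}(e(hj/k) z)`, where `c(j)` are the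
Fourier coefficients of `h ↦ A_{h,k}`. -/
def Psi (s₀ : ℝ) (A : ℕ → ℕ → ℂ) (h k : ℕ) (z w : ℂ) : ℂ :=
  (Real.Gamma (s₀ + 1) : ℂ) / ((s₀ : ℂ) * w ^ (s₀ : ℂ)) *
    ∑ j ∈ Finset.range k, fourierCoeff k (fun h' => A h' k) j *
      Li (s₀ + 1) (e ((h : ℝ) * (j : ℝ) / (k : ℝ)) * z)

/-- `Φ_{h,k}(z) = w^{s₀} s₀ Ψ_{h,k}(z,w)`, which does not depend on `w`. -/
def Phi (s₀ : ℝ) (A : ℕ → ℕ → ℂ) (h k : ℕ) (z : ℂ) : ℂ :=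
  (Real.Gamma (s₀ + 1) : ℂ) *
    ∑ j ∈ Finset.range k, fourierCoeff k (fun h' => A h' k) j *
      Li (s₀ + 1) (e ((h : ℝ) * (j : ℝ) / (k : ℝ)) * z)

theorem Phi_eq_Psi (s₀ : ℝ) (hs₀ : 0 < s₀) (A : ℕ → ℕ → ℂ) (h k : ℕ) (z w : ℂ) (hw : 0 < w.re) :
    w ^ (s₀ : ℂ) * (s₀ : ℂ) * Psi s₀ A h k z w = Phi s₀ A h k z := by
  have hw0 : w ≠ 0 := by
    rintro rfl
    simp at hw
  have h1 : w ^ (s₀ : ℂ) ≠ 0 := by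
    rw [Ne, Complex.cpow_eq_zero_iff]
    exact fun h => hw0 h.1
  have h2 : (s₀ : ℂ) ≠ 0 := by exact_mod_cast hs₀.ne'
  have h3 : w ^ (s₀ : ℂ) * (s₀ : ℂ) *
      ((Real.Gamma (s₀ + 1) : ℂ) / ((s₀ : ℂ) * w ^ (s₀ : ℂ))) = (Real.Gamma (s₀ + 1) : ℂ) := by
    field_simp
  unfold Psi Phi
  rw [← mul_assoc, h3]

/-- `L_{h,k}(z)`, the principal `(s₀+1)`-th root of `Φ_{h,k}(z) = w^{s₀} s₀ Ψ_{h,k}(z,w)`. -/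
def L (s₀ : ℝ) (A : ℕ → ℕ → ℂ) (h k : ℕ) (z : ℂ) : ℂ :=
  (Phi s₀ A h k z) ^ ((1 / (s₀ + 1) : ℝ) : ℂ)

/-- `ω_{h,k,n}(z) = e(-hn/k) ∏_j (1 - e(hj/k) z)^{-b(j)}`, where `b(j)` are the Fourier
coefficients of `h ↦ D_{h,k}(0)`. -/
def omega (D : ℕ → ℕ → ℂ → ℂ) (h k n : ℕ) (z : ℂ) : ℂ :=
  e (-((h : ℝ) * (n : ℝ) / (k : ℝ))) *
    ∏ j ∈ Finset.range k,
      (1 - e ((h : ℝ) * (j : ℝ) / (k : ℝ)) * z) ^ (-fourierCoeff k (fun h' => D h' k 0) j)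

/-- The index pairs: relatively prime integers `0 < h ≤ k`. -/
def IsIndex (h k : ℕ) : Prop := 0 < h ∧ h ≤ k ∧ Nat.Coprime h k

/-- The pairs `(h,k)` with `L_{h,k} ∈ [L_{p,q}]`, i.e. `Re L_{h,k} = Re L_{p,q}` on `U`. -/
def phaseClass (s₀ : ℝ) (A : ℕ → ℕ → ℂ) (U : Set ℂ) (p q : ℕ) : Set (ℕ × ℕ) :=
  {x | IsIndex x.1 x.2 ∧ ∀ z ∈ U, (L s₀ A x.1 x.2 z).re = (L s₀ A p q z).re}

/-- The phase `R(p,q)` relative to the set `U`. -/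
def phase (s₀ : ℝ) (A : ℕ → ℕ → ℂ) (U : Set ℂ) (p q : ℕ) : Set ℂ :=
  {z | z ∈ U ∧ ∀ h k : ℕ, IsIndex h k → (h, k) ∉ phaseClass s₀ A U p q →
    (L s₀ A h k z).re < (L s₀ A p q z).re}

/-- The mediant of two fractions in lowest terms. -/
def mediant (r r' : ℚ) : ℝ :=
  ((r.num : ℝ) + (r'.num : ℝ)) / ((r.den : ℝ) + (r'.den : ℝ))

/-- The Farey arc of order `N` about the fraction `r`: the points between the mediants of `r` with
its two neighbours among the fractions of denominator at most `N`. (All of `ℚ` is used, so the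
arc about `1/1` is the interval from `1 - 1/(N+1)` to `1 + 1/(N+1)`.) -/
def fareyArc (N : ℕ) (r : ℚ) : Set ℝ :=
  {ψ | ∃ r₁ r₂ : ℚ, IsGreatest {x : ℚ | x < r ∧ x.den ≤ N} r₁ ∧
    IsLeast {x : ℚ | r < x ∧ x.den ≤ N} r₂ ∧ mediant r₁ r < ψ ∧ ψ ≤ mediant r r₂}

/-- The contribution of the Farey arc of order `⌊δ n^{1/(s₀+1)}⌋` about `h/k` to Cauchy's integral
`Q_n(z) = ∫_0^1 P(z, exp(-τ)) exp(n τ) dψ` with `τ = 2 π α - 2 π i ψ` and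
`2 π α = Re L_{p,q}(z) n^{-1/(s₀+1)}`. -/
def arcIntegral (a : ℕ → ℝ) (s₀ : ℝ) (A : ℕ → ℕ → ℂ) (p q : ℕ) (δ : ℝ) (h k n : ℕ) (z : ℂ) : ℂ :=
  ∫ ψ in fareyArc ⌊δ * (n : ℝ) ^ (1 / (s₀ + 1))⌋₊ ((h : ℚ) / (k : ℚ)),
    (fun τ : ℂ => P a z (Complex.exp (-τ)) * Complex.exp ((n : ℂ) * τ))
      ((((L s₀ A p q z).re / (n : ℝ) ^ (1 / (s₀ + 1)) : ℝ) : ℂ) -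
        2 * (Real.pi : ℂ) * Complex.I * (ψ : ℂ))

/-- The main term
`√(L_{h,k}(z) / (2π(s₀+1) n^{(s₀+2)/(s₀+1)})) exp(((s₀+1)/s₀) n^{s₀/(s₀+1)} L_{h,k}(z))`. -/
def mainTerm (s₀ : ℝ) (A : ℕ → ℕ → ℂ) (h k n : ℕ) (z : ℂ) : ℂ :=
  (L s₀ A h k z /
      ((2 * Real.pi * (s₀ + 1) * (n : ℝ) ^ ((s₀ + 2) / (s₀ + 1)) : ℝ) : ℂ)) ^ (1 / 2 : ℂ) *
    Complex.exp ((((s₀ + 1) / s₀ * (n : ℝ) ^ (s₀ / (s₀ + 1)) : ℝ) : ℂ) * L s₀ A h k z)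

/-- The exponent `μ = min(-σ₀/(s₀+1), s₀/(2s₀+2))` of the relative error. -/
def mu (s₀ σ₀ : ℝ) : ℝ := min (-σ₀ / (s₀ + 1)) (s₀ / (2 * s₀ + 2))

end PolyMeinardus

end

/-! ### Farey arcs: neighbours, mediants and the dissection of a period -/

noncomputable section
namespace PolyMeinardus

/-! This is the circle method with a saddle point on every major arc. Put ν = n^{1/(s₀+1)} and λ =
n^{s₀/(s₀+1)}, so that n = λν.

Local expansion. Taking logarithms, log P(z, e^{-w} e(h/k)) = Σ_l (z^l/l) Σ_m a_m e(hlm/k) e^{-lmw}.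
Each inner sum is a Mellin integral of Γ(s) D_{hl,k}(s) (lw)^{-s}. Moving the line of integration to
Re s = σ₀ picks up the pole at s₀, which sums to Φ_{h,k}(z)/(s₀ w^{s₀}), and the pole of Γ at 0,
which sums to the logarithm of ω_{h,k,0}(z). What is left is O(k^{s₀-σ₀} |w|^{-σ₀}), uniformly in
every closed sector inside the right half plane (`exists_twist_expansion`, `exists_P_expansion`).
After the scaling w = v/ν, Cauchy's integrand is ω_{h,k,n}(z) exp(λ(v + Φ_{h,k}(z)/(s₀ v^{s₀}))) up
to a factor e^E with E controlled, and a Farey arc becomes a segment of the line Re v = Re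
L_{p,q}(z) reaching to height about 1/(kδ) (`exists_cauchyIntegrand_eq`).

The inequality behind everything. If L is the principal (s+1)-th root of Φ, then Re(Φ/v^s) ≤ max(Re
L, 0)^{s+1}/(Re v)^s in the right half plane (`re_div_cpow_le`). With θ = arg v and β = arg L it
says (cos θ)^s cos((s+1)β - sθ) ≤ max(cos β, 0)^{s+1}, which follows from the weighted
arithmetic-geometric mean inequality and the concavity of the cosine. If Re L > 0, equality on the
line Re v = Re L occurs only at the saddle point v = L and, when Φ is a negative real number, also
at its conjugate (`re_div_cpow_lt`).

Minor arcs. On the compact set X the roots outside the class lie below Re L_{p,q} by a uniform gap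
(`exists_phase_gap`): compactness handles finitely many k and the decay of Re L_{h,k} the others.
The inequality turns the gap into exponential smallness, and small δ keeps log ω and E below a
fraction of it (`exists_minor_arc_bound`).

Major arcs. For small δ the saddle points lie inside the arcs, and Laplace's method with explicit
error (`exists_laplace_bound`, `exists_saddle_bound`) gives B_{h,k,n}, or B_{h,k,n} plus its
conjugate when there are two saddle points. The function Ĩ_{h,k,n} is the arc integral divided by
ω_{h,k,n}; the total of the minor arcs is put into the term of index (p,q), where it is negligible
(`majorArcTerm`).

The class is finite because Re L_{p,q} is bounded below on X while Re L_{h,k} → 0. For open U, equal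
real parts force two roots to differ by a constant, and comparing vanishing orders at the origin
shows that the constant is 0 (`eqOn_of_re_rt_eq`). -/

theorem exists_farey_succ {N : ℕ} {r : ℚ} (hr : r.den ≤ N) :
    ∃ r₂ : ℚ, IsLeast {x : ℚ | r < x ∧ x.den ≤ N} r₂ ∧
      r₂.num * r.den - r.num * r₂.den = 1 ∧ N < r.den + r₂.den := by
  have hd : (0 : ℤ) < r.den := by exact_mod_cast r.den_pos
  have hcop : IsCoprime r.num (r.den : ℤ) := by
    rw [Int.isCoprime_iff_gcd_eq_one]
    exact r.reduced
  obtain ⟨u, v, huv⟩ := hcop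
  -- The integer in (N - r.den, N] congruent to -u modulo r.den. Then r.num * y ≡ -1, so x below is
  -- an integer, and r.den + y > N.
  set y : ℤ := N - ((N + u) % r.den) with hy
  have hmod0 := Int.emod_nonneg ((N : ℤ) + u) hd.ne'
  have hmod1 := Int.emod_lt_of_pos ((N : ℤ) + u) hd
  have hNd : (r.den : ℤ) ≤ N := by exact_mod_cast hr
  have hy0 : 0 < y := by omega
  have hyN : y ≤ N := by omega
  have hyl : (N : ℤ) < r.den + y := by omega
  obtain ⟨x, hx⟩ : ∃ x : ℤ, x * r.den - r.num * y = 1 := by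
    have h1 := Int.emod_add_mul_ediv ((N : ℤ) + u) r.den
    refine ⟨v + r.num * (((N : ℤ) + u) / r.den), ?_⟩
    have h2 : y = -u + r.den * (((N : ℤ) + u) / r.den) := by rw [hy]; linarith
    rw [h2]
    linear_combination huv
  have hcop2 : Nat.Coprime x.natAbs y.natAbs := by
    refine Int.isCoprime_iff_gcd_eq_one.1 ?_
    exact ⟨r.den, -r.num, by linarith⟩
  set r₂ : ℚ := (x : ℚ) / (y : ℚ) with hr₂
  have hnum : r₂.num = x := Rat.num_div_eq_of_coprime hy0 hcop2
  have hden : (r₂.den : ℤ) = y := Rat.den_div_eq_of_coprime hy0 hcop2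
  refine ⟨r₂, ⟨⟨?_, ?_⟩, ?_⟩, ?_, ?_⟩
  · rw [Rat.lt_iff, hnum, hden]; linarith
  · have : (r₂.den : ℤ) ≤ N := by rw [hden]; exact hyN
    exact_mod_cast this
  · rintro s ⟨hs1, hs2⟩
    by_contra! hlt
    rw [Rat.lt_iff] at hs1 hlt
    rw [hnum, hden] at hlt
    have hs2' : (s.den : ℤ) ≤ N := by exact_mod_cast hs2
    -- If r < s < r₂ both brackets are positive integers, so s.den ≥ y + r.den > N.
    have e1 : (s.den : ℤ) = y * (s.num * r.den - r.num * s.den) +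
        r.den * (x * s.den - s.num * y) := by
      linear_combination (-(s.den : ℤ)) * hx
    nlinarith
  · rw [hnum, hden]; exact hx
  · have : (N : ℤ) < r.den + r₂.den := by rw [hden]; exact hyl
    exact_mod_cast this

theorem exists_farey_pred {N : ℕ} {r : ℚ} (hr : r.den ≤ N) :
    ∃ r₁ : ℚ, IsGreatest {x : ℚ | x < r ∧ x.den ≤ N} r₁ ∧
      r.num * r₁.den - r₁.num * r.den = 1 ∧ N < r₁.den + r.den := by
  obtain ⟨s, ⟨⟨hs1, hs2⟩, hs3⟩, hs4, hs5⟩ := exists_farey_succ (N := N) (r := -r) (by simpa using hr)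
  refine ⟨-s, ⟨⟨by linarith, by simpa using hs2⟩, ?_⟩, ?_, ?_⟩
  · rintro t ⟨ht1, ht2⟩
    have := hs3 (show -t ∈ _ from ⟨by linarith, by simpa using ht2⟩)
    linarith
  · simp at hs4 ⊢
    linarith
  · simp at hs5 ⊢
    omega

theorem fareyArc_eq_Ioc {N : ℕ} {r r₁ r₂ : ℚ} (h₁ : IsGreatest {x : ℚ | x < r ∧ x.den ≤ N} r₁)
    (h₂ : IsLeast {x : ℚ | r < x ∧ x.den ≤ N} r₂) :
    fareyArc N r = Set.Ioc (mediant r₁ r) (mediant r r₂) := by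
  ext ψ
  constructor
  · rintro ⟨s₁, s₂, hs₁, hs₂, h⟩
    rwa [hs₁.unique h₁, hs₂.unique h₂] at h
  · rintro h
    exact ⟨r₁, r₂, h₁, h₂, h⟩

theorem mediant_sub_left {r r' : ℚ} (h : r'.num * r.den - r.num * r'.den = 1) :
    mediant r r' - r = 1 / ((r.den : ℝ) * (r.den + r'.den)) := by
  have h' : (r'.num : ℝ) * r.den - r.num * r'.den = 1 := by exact_mod_cast h
  have h1 : (0 : ℝ) < r.den := by exact_mod_cast r.den_pos
  have h2 : (0 : ℝ) < r'.den := by exact_mod_cast r'.den_pos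
  have h3 : (r : ℝ) = r.num / r.den := by exact_mod_cast (Rat.num_div_den r).symm
  rw [mediant, h3]
  field_simp
  linarith

theorem right_sub_mediant {r r' : ℚ} (h : r'.num * r.den - r.num * r'.den = 1) :
    r' - mediant r r' = 1 / ((r'.den : ℝ) * (r.den + r'.den)) := by
  have h' : (r'.num : ℝ) * r.den - r.num * r'.den = 1 := by exact_mod_cast h
  have h1 : (0 : ℝ) < r.den := by exact_mod_cast r.den_pos
  have h2 : (0 : ℝ) < r'.den := by exact_mod_cast r'.den_pos
  have h3 : (r' : ℝ) = r'.num / r'.den := by exact_mod_cast (Rat.num_div_den r').symm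
  rw [mediant, h3]
  field_simp
  linarith

/-- The Farey arc of order `N` about `r = h/k` is an interval about `r` whose two halves have
length between `1/(2kN)` and `1/(k(N+1))`. -/
theorem exists_fareyArc_eq {N : ℕ} {r : ℚ} (hr : r.den ≤ N) :
    ∃ u v : ℝ, fareyArc N r = Set.Ioc (r - u) (r + v) ∧
      1 / (2 * r.den * N) ≤ u ∧ u ≤ 1 / ((r.den : ℝ) * (N + 1)) ∧
      1 / (2 * r.den * N) ≤ v ∧ v ≤ 1 / ((r.den : ℝ) * (N + 1)) := by
  obtain ⟨r₁, h₁, hd₁, hN₁⟩ := exists_farey_pred hr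
  obtain ⟨r₂, h₂, hd₂, hN₂⟩ := exists_farey_succ hr
  have h0 : (0 : ℝ) < r.den := by exact_mod_cast r.den_pos
  have h1 : (0 : ℝ) < r₁.den := by exact_mod_cast r₁.den_pos
  have h2 : (0 : ℝ) < r₂.den := by exact_mod_cast r₂.den_pos
  have hr' : (r.den : ℝ) ≤ N := by exact_mod_cast hr
  have h1' : (r₁.den : ℝ) ≤ N := by exact_mod_cast h₁.1.2
  have h2' : (r₂.den : ℝ) ≤ N := by exact_mod_cast h₂.1.2
  have hN₁' : (N : ℝ) + 1 ≤ r₁.den + r.den := by exact_mod_cast hN₁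
  have hN₂' : (N : ℝ) + 1 ≤ r.den + r₂.den := by exact_mod_cast hN₂
  refine ⟨1 / ((r.den : ℝ) * (r₁.den + r.den)), 1 / ((r.den : ℝ) * (r.den + r₂.den)), ?_, ?_, ?_,
    ?_, ?_⟩
  · rw [fareyArc_eq_Ioc h₁ h₂, ← mediant_sub_left hd₂, ← right_sub_mediant hd₁]
    simp
  all_goals
    apply one_div_le_one_div_of_le
    · positivity
    · nlinarith

/-- Adjacent fractions have arcs separated by their common mediant. Otherwise the successor of r
does not exceed the predecessor of r', and these two fractions separate the arcs. -/
theorem fareyArc_lt {N : ℕ} {r r' : ℚ} (hr : r.den ≤ N) (hr' : r'.den ≤ N) (hlt : r < r')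
    {ψ ψ' : ℝ} (hψ : ψ ∈ fareyArc N r) (hψ' : ψ' ∈ fareyArc N r') : ψ < ψ' := by
  obtain ⟨r₁, h₁, hd₁, hN₁⟩ := exists_farey_pred hr'
  obtain ⟨r₂, h₂, hd₂, hN₂⟩ := exists_farey_succ hr
  obtain ⟨s₁, s₂, hs₁, hs₂, hs⟩ := hψ
  obtain ⟨t₁, t₂, ht₁, ht₂, ht⟩ := hψ'
  rw [hs₂.unique h₂] at hs
  rw [ht₁.unique h₁] at ht
  have hle : r₂ ≤ r' := h₂.2 ⟨hlt, hr'⟩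
  rcases hle.eq_or_lt with heq | hlt2
  · subst heq
    have : r₁ = r := by
      refine le_antisymm ?_ (h₁.2 ⟨hlt, hr⟩)
      by_contra! hc
      have := h₂.2 ⟨hc, h₁.1.2⟩
      exact absurd h₁.1.1 (not_lt.2 this)
    rw [this] at ht
    linarith
  · have h3 : (r₂ : ℝ) ≤ r₁ := by exact_mod_cast h₁.2 ⟨hlt2, h₂.1.2⟩
    have e1 := right_sub_mediant hd₂
    have e2 := mediant_sub_left hd₁
    have h4 : (0 : ℝ) ≤ 1 / ((r₂.den : ℝ) * (r.den + r₂.den)) := by positivity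
    have h5 : (0 : ℝ) ≤ 1 / ((r₁.den : ℝ) * (r₁.den + r'.den)) := by positivity
    linarith

theorem disjoint_fareyArc {N : ℕ} {r r' : ℚ} (hr : r.den ≤ N) (hr' : r'.den ≤ N) (hne : r ≠ r') :
    Disjoint (fareyArc N r) (fareyArc N r') := by
  rw [Set.disjoint_left]
  intro ψ h1 h2
  rcases lt_or_gt_of_ne hne with h | h
  · exact lt_irrefl _ (fareyArc_lt hr hr' h h1 h2)
  · exact lt_irrefl _ (fareyArc_lt hr' hr h h2 h1)

theorem finite_setOf_den_le (N : ℕ) (a b : ℝ) :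
    {x : ℚ | a ≤ x ∧ x ≤ b ∧ x.den ≤ N}.Finite := by
  have hfin : ((Set.Icc (-(⌈(|a| + |b|) * N⌉)) ⌈(|a| + |b|) * N⌉) ×ˢ (Set.Iic N)).Finite :=
    (Set.finite_Icc _ _).prod (Set.finite_Iic N)
  refine (hfin.image (fun p : ℤ × ℕ => (p.1 : ℚ) / (p.2 : ℚ))).subset ?_
  rintro x ⟨h1, h2, h3⟩
  refine ⟨(x.num, x.den), ⟨?_, h3⟩, Rat.num_div_den x⟩
  have h0 : (0 : ℝ) < x.den := by exact_mod_cast x.den_pos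
  have h3' : (x.den : ℝ) ≤ N := by exact_mod_cast h3
  have hx : (x.num : ℝ) = x * x.den := by exact_mod_cast (Rat.mul_den_eq_num x).symm
  have habs : |(x : ℝ)| ≤ |a| + |b| := by
    rw [abs_le]
    constructor
    · have := neg_abs_le a; have := abs_nonneg b; linarith
    · have := le_abs_self b; have := abs_nonneg a; linarith
  have hnum : |(x.num : ℝ)| ≤ (|a| + |b|) * N := by
    rw [hx, abs_mul, abs_of_pos h0]
    exact mul_le_mul habs h3' h0.le (by positivity)
  have hc := Int.le_ceil ((|a| + |b|) * N)
  rw [abs_le] at hnum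
  constructor
  · have : (-(⌈(|a| + |b|) * N⌉ : ℤ) : ℝ) ≤ x.num := by linarith
    exact_mod_cast this
  · have : (x.num : ℝ) ≤ ⌈(|a| + |b|) * N⌉ := by linarith
    exact_mod_cast this

/-- Every real number lies in some Farey arc of order `N`. -/
theorem exists_mem_fareyArc {N : ℕ} (hN : 0 < N) (ψ : ℝ) :
    ∃ r : ℚ, r.den ≤ N ∧ ψ ∈ fareyArc N r := by
  have hfin := finite_setOf_den_le N (ψ - 1) ψ
  have hne : {x : ℚ | ψ - 1 ≤ x ∧ x ≤ ψ ∧ x.den ≤ N}.Nonempty := by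
    refine ⟨(⌊ψ⌋ : ℤ), ?_, ?_, ?_⟩
    · push_cast; linarith [Int.lt_floor_add_one ψ]
    · push_cast; exact Int.floor_le ψ
    · simp; omega
  -- With r the largest fraction not exceeding ψ, the point lies between r and its successor r₂, and
  -- the mediant decides which of the two arcs contains it.
  obtain ⟨r, ⟨hr1, hr2, hr3⟩, hmax⟩ := Set.exists_max_image _ id hfin hne
  obtain ⟨r₁, h₁, hd₁, hN₁⟩ := exists_farey_pred hr3
  obtain ⟨r₂, h₂, hd₂, hN₂⟩ := exists_farey_succ hr3
  have hψ2 : ψ < r₂ := by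
    by_contra! hc
    have h6 : (r : ℝ) < r₂ := by exact_mod_cast h₂.1.1
    have := hmax r₂ ⟨by linarith, hc, h₂.1.2⟩
    simp only [id] at this
    exact absurd h₂.1.1 (not_lt.2 this)
  have e1 := right_sub_mediant hd₁
  have e0 : (0 : ℝ) < 1 / ((r.den : ℝ) * (r₁.den + r.den)) := by
    have h0 : (0 : ℝ) < r.den := by exact_mod_cast r.den_pos
    positivity
  rcases le_or_gt ψ (mediant r r₂) with hle | hgt
  · exact ⟨r, hr3, r₁, r₂, h₁, h₂, by linarith, hle⟩
  · obtain ⟨r₃, h₃, hd₃, hN₃⟩ := exists_farey_succ h₂.1.2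
    have hg : IsGreatest {x : ℚ | x < r₂ ∧ x.den ≤ N} r := by
      refine ⟨⟨h₂.1.1, hr3⟩, ?_⟩
      rintro t ⟨ht1, ht2⟩
      by_contra! hc
      exact absurd ht1 (not_lt.2 (h₂.2 ⟨hc, ht2⟩))
    refine ⟨r₂, h₂.1.2, r, r₃, hg, h₃, hgt, ?_⟩
    have e2 := mediant_sub_left hd₃
    have e3 : (0 : ℝ) ≤ 1 / ((r₂.den : ℝ) * (r₂.den + r₃.den)) := by positivity
    linarith

/-- Adjacent denominators add up to more than N, so both neighbours of an integer have denominator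
exactly N. -/
theorem fareyArc_intCast {N : ℕ} (hN : 0 < N) (b : ℤ) :
    fareyArc N (b : ℚ) = Set.Ioc (b - 1 / ((N : ℝ) + 1)) (b + 1 / ((N : ℝ) + 1)) := by
  have hb : ((b : ℚ)).den ≤ N := by simp; omega
  obtain ⟨r₁, h₁, hd₁, hN₁⟩ := exists_farey_pred hb
  obtain ⟨r₂, h₂, hd₂, hN₂⟩ := exists_farey_succ hb
  have i1 : r₁.den = N := le_antisymm h₁.1.2 (by simp at hN₁; omega)
  have i2 : r₂.den = N := le_antisymm h₂.1.2 (by simp at hN₂; omega)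
  rw [fareyArc_eq_Ioc h₁ h₂]
  have e1 := right_sub_mediant hd₁
  have e2 := mediant_sub_left hd₂
  simp only [i1, i2, Rat.den_intCast, Rat.cast_intCast, Nat.cast_one, one_mul] at e1 e2
  rw [add_comm (1 : ℝ)] at e2
  rw [show mediant r₁ b = (b : ℝ) - 1 / ((N : ℝ) + 1) by linarith,
    show mediant b r₂ = (b : ℝ) + 1 / ((N : ℝ) + 1) by linarith]

theorem den_div_of_isIndex {h k : ℕ} (hi : IsIndex h k) : ((h : ℚ) / (k : ℚ)).den = k := by
  have := Rat.den_div_eq_of_coprime (a := (h : ℤ)) (b := (k : ℤ))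
    (by exact_mod_cast hi.1.trans_le hi.2.1) (by simpa using hi.2.2)
  simpa using this

theorem div_injective_of_isIndex {h k h' k' : ℕ} (hi : IsIndex h k) (hi' : IsIndex h' k')
    (heq : (h : ℚ) / (k : ℚ) = (h' : ℚ) / (k' : ℚ)) : (h, k) = (h', k') := by
  have hk : k = k' := by rw [← den_div_of_isIndex hi, ← den_div_of_isIndex hi', heq]
  subst hk
  have hk0 : (k : ℚ) ≠ 0 := by have := hi.1.trans_le hi.2.1; positivity
  have : (h : ℚ) = h' := by field_simp at heq; exact heq
  have : h = h' := by exact_mod_cast this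
  rw [this]

/-- The Farey arcs of order `N` about the fractions in `(0, 1]` lie in a period interval. -/
theorem fareyArc_subset_period {N h k : ℕ} (hi : IsIndex h k) (hk : k ≤ N) :
    fareyArc N ((h : ℚ) / (k : ℚ)) ⊆ Set.Ioc (1 / ((N : ℝ) + 1)) (1 + 1 / ((N : ℝ) + 1)) := by
  have hk0 : 0 < k := hi.1.trans_le hi.2.1
  have hN : 0 < N := hk0.trans_le hk
  have hd := den_div_of_isIndex hi
  intro ψ hψ
  have hp : (0 : ℝ) < 1 / ((N : ℝ) + 1) := by positivity
  constructor
  · refine fareyArc_lt (r := ((0 : ℤ) : ℚ)) (by simp; omega) (by rw [hd]; exact hk) ?_ ?_ hψ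
    · have : (0 : ℚ) < h := by exact_mod_cast hi.1
      have : (0 : ℚ) < k := by exact_mod_cast hk0
      push_cast
      positivity
    · rw [fareyArc_intCast hN]
      constructor <;> push_cast <;> linarith
  · rcases hi.2.1.eq_or_lt with heq | hlt
    · subst heq
      have : ((h : ℚ) / (h : ℚ)) = ((1 : ℤ) : ℚ) := by
        push_cast
        exact div_self (by positivity)
      rw [this, fareyArc_intCast hN] at hψ
      simpa using hψ.2
    · refine (fareyArc_lt (r' := ((1 : ℤ) : ℚ)) (by rw [hd]; exact hk) (by simp; omega) ?_ hψ ?_).le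
      · push_cast
        rw [div_lt_one (by exact_mod_cast hk0)]
        exact_mod_cast hlt
      · rw [fareyArc_intCast hN]
        constructor <;> push_cast <;> linarith

/-- The period begins at the right end of the arc about 0 and ends at the right end of the arc about
1. Since arcs contain their right endpoints only, exactly the arcs centred in (0, 1] are needed to
cover it. -/
theorem exists_isIndex_mem_fareyArc {N : ℕ} (hN : 0 < N) {ψ : ℝ}
    (hψ : ψ ∈ Set.Ioc (1 / ((N : ℝ) + 1)) (1 + 1 / ((N : ℝ) + 1))) :
    ∃ h k : ℕ, IsIndex h k ∧ k ≤ N ∧ ψ ∈ fareyArc N ((h : ℚ) / (k : ℚ)) := by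
  obtain ⟨r, hr, hmem⟩ := exists_mem_fareyArc hN ψ
  have hp : (0 : ℝ) < 1 / ((N : ℝ) + 1) := by positivity
  have hr0 : 0 < r := by
    by_contra! hc
    rcases hc.eq_or_lt with h0 | h0
    · rw [h0, show (0 : ℚ) = ((0 : ℤ) : ℚ) by simp, fareyArc_intCast hN] at hmem
      have h1 := hmem.2
      have h2 := hψ.1
      push_cast at h1
      linarith
    · have h0' : r < ((0 : ℤ) : ℚ) := by simpa using h0
      have := fareyArc_lt (ψ' := 1 / ((N : ℝ) + 1)) hr (by simp; omega) h0' hmem (by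
        rw [fareyArc_intCast hN]
        constructor <;> push_cast <;> linarith)
      linarith [hψ.1]
  have hr1 : r ≤ 1 := by
    by_contra! hc
    have hc' : ((1 : ℤ) : ℚ) < r := by simpa using hc
    have := fareyArc_lt (ψ := 1 + 1 / ((N : ℝ) + 1)) (by simp; omega) hr hc' (by
        rw [fareyArc_intCast hN]
        constructor <;> push_cast <;> linarith) hmem
    linarith [hψ.2]
  have hnum : 0 < r.num := Rat.num_pos.2 hr0
  have hnat : (r.num.toNat : ℤ) = r.num := Int.toNat_of_nonneg hnum.le
  have heq : (r.num.toNat : ℚ) / (r.den : ℚ) = r := by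
    have h1 : (r.num.toNat : ℚ) = (r.num : ℚ) := by exact_mod_cast congrArg (Int.cast : ℤ → ℚ) hnat
    rw [h1]
    exact Rat.num_div_den r
  refine ⟨r.num.toNat, r.den, ⟨by omega, ?_, ?_⟩, hr, by rwa [heq]⟩
  · have : (r.num : ℚ) ≤ r.den := by
      rw [← Rat.mul_den_eq_num r]
      have : (0 : ℚ) ≤ r.den := by positivity
      nlinarith
    have : r.num ≤ r.den := by exact_mod_cast this
    omega
  · have := r.reduced
    have e : r.num.natAbs = r.num.toNat := by omega
    rwa [e] at this

end PolyMeinardus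
end

/-! ### Integrals with exponential decay and Mellin inversion of the exponential -/

noncomputable section
namespace PolyMeinardus
open MeasureTheory Complex Set

theorem exists_rpow_mul_exp_neg_le (K : ℝ) {b : ℝ} (hb : 0 < b) :
    ∃ M : ℝ, 0 < M ∧ ∀ y : ℝ, 1 ≤ y → y ^ K * Real.exp (-b * y) ≤ M := by
  have h := tendsto_rpow_mul_exp_neg_mul_atTop_nhds_zero K b hb
  obtain ⟨Y, hY⟩ := eventually_atTop.1 (h.eventually (gt_mem_nhds (zero_lt_one' ℝ)))
  have hc : ContinuousOn (fun y : ℝ => y ^ K * Real.exp (-b * y)) (Icc 1 Y) := by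
    refine ContinuousOn.mul (ContinuousOn.rpow_const continuousOn_id ?_) (by fun_prop)
    intro y hy
    exact Or.inl (by have := hy.1; simp; linarith)
  obtain ⟨M, hM⟩ := isCompact_Icc.exists_bound_of_continuousOn hc
  refine ⟨max M 1, by positivity, fun y hy => ?_⟩
  rcases le_or_gt Y y with h1 | h1
  · exact (hY y h1).le.trans (le_max_right _ _)
  · exact ((Real.le_norm_self _).trans (hM y ⟨hy, h1.le⟩)).trans (le_max_left _ _)

theorem integrable_one_add_abs_rpow_mul_exp (K : ℝ) {b : ℝ} (hb : 0 < b) :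
    Integrable fun t : ℝ => (1 + |t|) ^ K * Real.exp (-b * |t|) := by
  obtain ⟨M, hM, h⟩ := exists_rpow_mul_exp_neg_le (K + 2) hb
  refine (integrable_inv_one_add_sq.const_mul (M * Real.exp b)).mono' ?_ (ae_of_all _ fun t => ?_)
  · refine Continuous.aestronglyMeasurable (Continuous.mul ?_ (by fun_prop))
    exact Continuous.rpow_const (by fun_prop) fun t => Or.inl (by positivity)
  · have h1 := h (1 + |t|) (by linarith [abs_nonneg t])
    rw [Real.norm_of_nonneg (by positivity), Real.rpow_add (by positivity)] at *
    rw [mul_add, Real.exp_add] at h1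
    have e1 : Real.exp (-b * 1) * Real.exp b = 1 := by rw [← Real.exp_add]; simp
    have h2 : 1 + t ^ 2 ≤ (1 + |t|) ^ (2 : ℝ) := by
      rw [Real.rpow_two]; nlinarith [abs_nonneg t, sq_abs t]
    rw [← div_eq_mul_inv, le_div_iff₀ (by positivity)]
    have h0 : 0 ≤ (1 + |t|) ^ K * Real.exp (-b * |t|) := by positivity
    calc (1 + |t|) ^ K * Real.exp (-b * |t|) * (1 + t ^ 2)
        ≤ (1 + |t|) ^ K * Real.exp (-b * |t|) * (1 + |t|) ^ (2 : ℝ) := by gcongr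
      _ = ((1 + |t|) ^ K * (1 + |t|) ^ (2 : ℝ) * Real.exp (-b * |t|)) *
          (Real.exp (-b * 1) * Real.exp b) := by rw [e1]; ring
      _ = ((1 + |t|) ^ K * (1 + |t|) ^ (2 : ℝ) * (Real.exp (-b * 1) * Real.exp (-b * |t|))) *
          Real.exp b := by ring
      _ ≤ M * Real.exp b := by gcongr

theorem integrable_exp_neg_mul_abs {b : ℝ} (hb : 0 < b) :
    Integrable fun t : ℝ => Real.exp (-b * |t|) := by
  simpa using integrable_one_add_abs_rpow_mul_exp 0 hb

/-! ### The Gamma function on vertical lines -/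

theorem integrableOn_rpow_mul_exp_neg_mul {σ b : ℝ} (hσ : 0 < σ) (hb : 0 < b) :
    IntegrableOn (fun t : ℝ => t ^ (σ - 1) * Real.exp (-b * t)) (Ioi 0) := by
  have := integrableOn_rpow_mul_exp_neg_mul_rpow (p := 1) (s := σ - 1) (b := b) (by linarith) one_pos hb
  simpa using this

theorem norm_cpow_mul_exp_neg {s v : ℂ} {t : ℝ} (ht : 0 < t) :
    ‖(t : ℂ) ^ (s - 1) * exp (-(v * t))‖ = t ^ (s.re - 1) * Real.exp (-v.re * t) := by
  rw [norm_mul, norm_cpow_eq_rpow_re_of_pos ht, norm_exp]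
  simp

theorem aestronglyMeasurable_cpow_mul_exp_neg (s v : ℂ) :
    AEStronglyMeasurable (fun t : ℝ => (t : ℂ) ^ (s - 1) * exp (-(v * t)))
      (volume.restrict (Ioi 0)) := by
  refine ContinuousOn.aestronglyMeasurable (ContinuousOn.mul ?_ (by fun_prop)) measurableSet_Ioi
  intro t ht
  exact (continuousAt_ofReal_cpow_const t (s - 1) (Or.inr (ne_of_gt ht))).continuousWithinAt

theorem integrableOn_cpow_mul_exp_neg {s v : ℂ} (hs : 0 < s.re) (hv : 0 < v.re) :
    IntegrableOn (fun t : ℝ => (t : ℂ) ^ (s - 1) * exp (-(v * t))) (Ioi 0) := by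
  refine (integrableOn_rpow_mul_exp_neg_mul hs hv).mono'
    (aestronglyMeasurable_cpow_mul_exp_neg s v) ?_
  filter_upwards [ae_restrict_mem measurableSet_Ioi] with t ht
  exact (norm_cpow_mul_exp_neg ht).le

/-- Differentiation under the integral sign, dominated on the half plane Re w > Re v / 2. It
supplies the analyticity in v for the identity theorem in `integral_cpow_mul_exp_neg`. -/
theorem hasDerivAt_integral_cpow_mul_exp_neg {s v : ℂ} (hs : 0 < s.re) (hv : 0 < v.re) :
    DifferentiableAt ℂ (fun v : ℂ => ∫ t in Ioi (0 : ℝ), (t : ℂ) ^ (s - 1) * exp (-(v * t))) v := by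
  have hball : {w : ℂ | v.re / 2 < w.re} ∈ 𝓝 v :=
    (isOpen_lt continuous_const continuous_re).mem_nhds (by simp; linarith)
  refine (hasDerivAt_integral_of_dominated_loc_of_deriv_le (𝕜 := ℂ)
    (F' := fun w t => (t : ℂ) ^ (s - 1) * (exp (-(w * t)) * (-t)))
    (bound := fun t => t ^ (s.re + 1 - 1) * Real.exp (-(v.re / 2) * t)) hball ?_ ?_ ?_ ?_ ?_ ?_).2.differentiableAt
  · exact Eventually.of_forall fun w => aestronglyMeasurable_cpow_mul_exp_neg s w
  · exact integrableOn_cpow_mul_exp_neg hs hv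
  · simp_rw [← mul_assoc]
    exact (aestronglyMeasurable_cpow_mul_exp_neg s v).mul (by fun_prop)
  · filter_upwards [ae_restrict_mem measurableSet_Ioi] with t ht w hw
    have ht' : (0 : ℝ) < t := ht
    rw [← mul_assoc, norm_mul, norm_cpow_mul_exp_neg ht, norm_neg, norm_real,
      Real.norm_of_nonneg ht'.le, show s.re + 1 - 1 = s.re - 1 + 1 by ring, Real.rpow_add_one ht'.ne']
    have : Real.exp (-w.re * t) ≤ Real.exp (-(v.re / 2) * t) := by
      apply Real.exp_le_exp.2
      have : v.re / 2 < w.re := hw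
      nlinarith
    calc _ ≤ t ^ (s.re - 1) * Real.exp (-(v.re / 2) * t) * t := by gcongr
      _ = _ := by ring
  · exact integrableOn_rpow_mul_exp_neg_mul (by linarith) (by linarith)
  · refine ae_of_all _ fun t w _ => ?_
    have h1 : HasDerivAt (fun w : ℂ => -(w * t)) (-t) w := by
      have := ((hasDerivAt_id w).mul_const (t : ℂ)).neg
      rw [one_mul] at this
      exact this
    exact (h1.cexp).const_mul _

/-- `∫_0^∞ t^{s-1} e^{-vt} dt = v^{-s} Γ(s)` for `v` in the right half plane. -/
theorem integral_cpow_mul_exp_neg {s v : ℂ} (hs : 0 < s.re) (hv : 0 < v.re) :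
    ∫ t in Ioi (0 : ℝ), (t : ℂ) ^ (s - 1) * exp (-(v * t)) = v ^ (-s) * Gamma s := by
  have hopen : IsOpen {w : ℂ | 0 < w.re} := isOpen_lt continuous_const continuous_re
  have hne : ∀ w : ℂ, 0 < w.re → w ≠ 0 := by rintro w hw rfl; simp at hw
  have h1 : AnalyticOnNhd ℂ
      (fun v : ℂ => ∫ t in Ioi (0 : ℝ), (t : ℂ) ^ (s - 1) * exp (-(v * t))) {w : ℂ | 0 < w.re} := by
    refine DifferentiableOn.analyticOnNhd (fun w hw => ?_) hopen
    exact (hasDerivAt_integral_cpow_mul_exp_neg hs hw).differentiableWithinAt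
  have h2 : AnalyticOnNhd ℂ (fun v : ℂ => v ^ (-s) * Gamma s) {w : ℂ | 0 < w.re} := by
    refine DifferentiableOn.analyticOnNhd (fun w hw => ?_) hopen
    have : DifferentiableAt ℂ (fun v : ℂ => v ^ (-s)) w :=
      differentiableAt_id.cpow_const (Or.inl hw)
    exact (this.mul_const _).differentiableWithinAt
  -- Both sides are analytic in v and agree at positive reals by Euler's integral; the real points
  -- to the right of 1 accumulate at 1.
  refine h1.eqOn_of_preconnected_of_frequently_eq h2 (z₀ := 1)
    (convex_halfSpace_re_gt 0).isPreconnected (by simp) ?_ hv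
  have hreal : ∀ r : ℝ, 0 < r → ∫ t in Ioi (0 : ℝ), (t : ℂ) ^ (s - 1) * exp (-((r : ℂ) * t)) =
      (r : ℂ) ^ (-s) * Gamma s := by
    intro r hr
    rw [Complex.integral_cpow_mul_exp_neg_mul_Ioi hs hr, one_div, inv_cpow, cpow_neg]
    rw [arg_ofReal_of_nonneg hr.le]
    exact Real.pi_pos.ne
  have ht : Tendsto (fun r : ℝ => (r : ℂ)) (𝓝[>] 1) (𝓝[≠] (1 : ℂ)) := by
    refine tendsto_nhdsWithin_iff.2 ⟨?_, ?_⟩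
    · have : Tendsto (fun r : ℝ => (r : ℂ)) (𝓝 1) (𝓝 ((1 : ℝ) : ℂ)) := continuous_ofReal.tendsto 1
      simpa using this.mono_left nhdsWithin_le_nhds
    · filter_upwards [self_mem_nhdsWithin] with r hr
      have hr' : (1 : ℝ) < r := hr
      simp only [mem_compl_iff, mem_singleton_iff]
      exact_mod_cast hr'.ne'
  refine ht.frequently (Eventually.frequently ?_)
  filter_upwards [self_mem_nhdsWithin] with r hr
  exact hreal r (zero_lt_one.trans hr)

theorem norm_cpow_neg {v s : ℂ} (hv : v ≠ 0) :
    ‖v ^ (-s)‖ = ‖v‖ ^ (-s.re) * Real.exp (arg v * s.im) := by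
  rw [norm_cpow_of_ne_zero hv, div_eq_mul_inv, ← Real.exp_neg]
  simp

/-- Exponential decay of the Gamma function in vertical strips. -/
theorem exists_norm_Gamma_le {σ₁ σ₂ θ : ℝ} (hσ₁ : 0 < σ₁) (hθ : 0 ≤ θ) (hθ' : θ < Real.pi / 2) :
    ∃ C : ℝ, 0 < C ∧ ∀ s : ℂ, σ₁ ≤ s.re → s.re ≤ σ₂ →
      ‖Gamma s‖ ≤ C * Real.exp (-θ * |s.im|) := by
  have hcos : 0 < Real.cos θ := Real.cos_pos_of_mem_Ioo ⟨by linarith [Real.pi_pos], hθ'⟩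
  have hcont : ContinuousOn (fun σ : ℝ => (1 / Real.cos θ) ^ σ * Real.Gamma σ) (Icc σ₁ σ₂) := by
    refine ContinuousOn.mul ?_ ?_
    · exact (Real.continuous_const_rpow (by positivity)).continuousOn
    · intro σ hσ
      refine (Real.differentiableAt_Gamma fun m => ?_).continuousAt.continuousWithinAt
      have := hσ.1
      have : (0 : ℝ) ≤ m := by positivity
      linarith
  obtain ⟨M, hM⟩ := isCompact_Icc.exists_bound_of_continuousOn hcont
  refine ⟨max M 1, by positivity, fun s h1 h2 => ?_⟩
  have hs : 0 < s.re := hσ₁.trans_le h1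
  -- Euler's integral with v = e^{iϑ}: the modulus of v^{-s} Γ(s) is ‖Γ(s)‖ e^{ϑ Im s}, and the
  -- integral of moduli is (cos θ)^{-σ} Γ(σ) with σ = Re s. In the end ϑ is given the sign of Im s.
  have key : ∀ ϑ : ℝ, |ϑ| = θ → ‖Gamma s‖ * Real.exp (ϑ * s.im) ≤ M := by
    intro ϑ hϑ
    have hϑ' := abs_lt.1 (hϑ.trans_lt hθ')
    have harg : arg (exp (ϑ * I)) = ϑ := by
      rw [arg_exp_mul_I]
      exact (toIocMod_eq_self _).2 ⟨by linarith [Real.pi_pos], by linarith [Real.pi_pos]⟩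
    have hre : (exp (ϑ * I)).re = Real.cos θ := by
      rw [exp_ofReal_mul_I_re, ← hϑ, Real.cos_abs]
    have e := integral_cpow_mul_exp_neg (v := exp (ϑ * I)) hs (by rw [hre]; exact hcos)
    have e2 := norm_integral_le_integral_norm (μ := volume.restrict (Ioi (0 : ℝ)))
      (fun t : ℝ => (t : ℂ) ^ (s - 1) * exp (-(exp (ϑ * I) * t)))
    rw [e, norm_mul, norm_cpow_neg (exp_ne_zero _), harg, norm_exp_ofReal_mul_I, Real.one_rpow,
      one_mul, setIntegral_congr_fun measurableSet_Ioi fun t ht => norm_cpow_mul_exp_neg ht, hre] at e2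
    simp only [neg_mul] at e2
    rw [Real.integral_rpow_mul_exp_neg_mul_Ioi hs hcos] at e2
    rw [mul_comm]
    exact e2.trans ((Real.le_norm_self _).trans (hM s.re ⟨h1, h2⟩))
  rw [neg_mul, Real.exp_neg, ← div_eq_mul_inv, le_div_iff₀ (Real.exp_pos _)]
  refine le_trans ?_ (le_max_left M 1)
  rcases abs_cases s.im with ⟨h, -⟩ | ⟨h, -⟩
  · rw [h]; exact key θ (abs_of_nonneg hθ)
  · rw [h]
    have := key (-θ) (by rw [abs_neg, abs_of_nonneg hθ])
    rwa [neg_mul, ← mul_neg] at this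

/-- A rate θ strictly between |arg v| and π/2 is available for Γ, and it beats the growth e^{|arg v|
|t|} of v^{-s}. -/
theorem exists_integrable_bound_Gamma_mul_cpow {σ : ℝ} (hσ : 0 < σ) {v : ℂ} (hv : 0 < v.re) :
    ∃ C b : ℝ, 0 < b ∧ ∀ t : ℝ, ‖Gamma (σ + t * I) * v ^ (-(σ + t * I : ℂ))‖ ≤
      C * Real.exp (-b * |t|) := by
  have hv0 : v ≠ 0 := by rintro rfl; simp at hv
  have harg : |arg v| < Real.pi / 2 := abs_arg_lt_pi_div_two_iff.2 (Or.inl hv)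
  obtain ⟨θ, hθ1, hθ2⟩ := exists_between harg
  obtain ⟨C, hC, h⟩ := exists_norm_Gamma_le (σ₂ := σ) hσ ((abs_nonneg _).trans hθ1.le) hθ2
  refine ⟨C * ‖v‖ ^ (-σ), θ - |arg v|, by linarith, fun t => ?_⟩
  have h1 := h (σ + t * I) (by simp) (by simp)
  rw [norm_mul, norm_cpow_neg hv0]
  simp only [add_re, ofReal_re, mul_re, I_re, mul_zero, ofReal_im, I_im, mul_one, sub_self,
    add_zero, add_im, mul_im, zero_add] at h1 ⊢
  calc _ ≤ C * Real.exp (-θ * |t|) * (‖v‖ ^ (-σ) * Real.exp (|arg v| * |t|)) := by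
        gcongr ?_ * (_ * Real.exp ?_)
        rw [← abs_mul]; exact le_abs_self _
    _ = C * ‖v‖ ^ (-σ) * (Real.exp (-θ * |t|) * Real.exp (|arg v| * |t|)) := by ring
    _ = _ := by rw [← Real.exp_add]; ring_nf

theorem continuous_Gamma_mul_cpow {σ : ℝ} (hσ : 0 < σ) {v : ℂ} (hv : 0 < v.re) :
    Continuous fun t : ℝ => Gamma (σ + t * I) * v ^ (-(σ + t * I : ℂ)) := by
  have hv0 : v ≠ 0 := by rintro rfl; simp at hv
  rw [continuous_iff_continuousAt]
  intro t
  have h1 : ContinuousAt Gamma (σ + t * I : ℂ) := by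
    refine (differentiableAt_Gamma _ fun m hm => ?_).continuousAt
    have := congrArg re hm
    simp at this
    have : (0 : ℝ) ≤ m := by positivity
    linarith
  refine ContinuousAt.mul (ContinuousAt.comp' h1 (by fun_prop)) ?_
  exact ContinuousAt.const_cpow (by fun_prop) (Or.inl hv0)

theorem integrable_Gamma_mul_cpow {σ : ℝ} (hσ : 0 < σ) {v : ℂ} (hv : 0 < v.re) :
    Integrable fun t : ℝ => Gamma (σ + t * I) * v ^ (-(σ + t * I : ℂ)) := by
  obtain ⟨C, b, hb, h⟩ := exists_integrable_bound_Gamma_mul_cpow hσ hv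
  exact ((integrable_exp_neg_mul_abs hb).const_mul C).mono'
    (continuous_Gamma_mul_cpow hσ hv).aestronglyMeasurable (ae_of_all _ h)

/-- Mellin inversion for the exponential function in the right half plane. -/
theorem integral_Gamma_mul_cpow {σ : ℝ} (hσ : 0 < σ) {v : ℂ} (hv : 0 < v.re) :
    ∫ t : ℝ, Gamma (σ + t * I) * v ^ (-(σ + t * I : ℂ)) = 2 * Real.pi * exp (-v) := by
  have hm : ∀ s : ℂ, 0 < s.re → mellin (fun y : ℝ => exp (-(v * y))) s = v ^ (-s) * Gamma s := by
    intro s hs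
    rw [mellin, ← integral_cpow_mul_exp_neg hs hv]
    simp
  have hm' : ∀ t : ℝ, mellin (fun y : ℝ => exp (-(v * y))) (σ + t * I) =
      Gamma (σ + t * I) * v ^ (-(σ + t * I : ℂ)) := by
    intro t; rw [hm _ (by simpa using hσ), mul_comm]
  have h := mellinInv_mellin_eq σ (fun y : ℝ => exp (-(v * y))) one_pos ?_ ?_ (by fun_prop)
  · rw [mellinInv] at h
    simp only [hm', ofReal_one, one_cpow, one_smul, mul_one] at h
    rw [← h, real_smul]
    push_cast
    rw [← mul_assoc, mul_one_div_cancel (by simp), one_mul]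
  · rw [MellinConvergent]
    simpa using integrableOn_cpow_mul_exp_neg (s := σ) (by simpa using hσ) hv
  · rw [VerticalIntegrable]
    simp_rw [hm']
    exact integrable_Gamma_mul_cpow hσ hv

end PolyMeinardus
end

noncomputable section
namespace PolyMeinardus
open MeasureTheory Complex Set

/-! ### Contour shifts in vertical strips -/

theorem norm_integral_horizontal_le {f : ℂ → ℂ} {a b C T : ℝ} (hab : a ≤ b)
    (hC : ∀ s : ℂ, a ≤ s.re → s.re ≤ b → 1 ≤ |s.im| → ‖f s‖ ≤ C / |s.im|) (hT : 1 ≤ |T|) :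
    ‖∫ x in a..b, f (x + T * I)‖ ≤ C / |T| * (b - a) := by
  have := intervalIntegral.norm_integral_le_of_norm_le_const (a := a) (b := b)
    (f := fun x : ℝ => f (x + T * I)) (C := C / |T|) (fun x hx => by
      rw [uIoc_of_le hab] at hx
      have := hC (x + T * I) (by simpa using hx.1.le) (by simpa using hx.2) (by simpa using hT)
      simpa using this)
  rwa [abs_of_nonneg (sub_nonneg.2 hab)] at this

/-- Cauchy's theorem on the rectangles |Im s| ≤ T; the horizontal sides contribute O(1/T). -/
theorem integral_vertical_eq {f : ℂ → ℂ} {a b C : ℝ} (hab : a ≤ b)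
    (hf : ∀ s : ℂ, a ≤ s.re → s.re ≤ b → DifferentiableAt ℂ f s)
    (hC : ∀ s : ℂ, a ≤ s.re → s.re ≤ b → 1 ≤ |s.im| → ‖f s‖ ≤ C / |s.im|)
    (ha : Integrable fun t : ℝ => f (a + t * I)) (hb : Integrable fun t : ℝ => f (b + t * I)) :
    ∫ t : ℝ, f (a + t * I) = ∫ t : ℝ, f (b + t * I) := by
  have htend : ∀ x : ℝ, Integrable (fun t : ℝ => f (x + t * I)) →
      Tendsto (fun T : ℝ => ∫ t in (-T)..T, f (x + t * I)) atTop (𝓝 (∫ t : ℝ, f (x + t * I))) :=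
    fun x hx => intervalIntegral_tendsto_integral hx tendsto_neg_atTop_atBot tendsto_id
  have hrect : ∀ T : ℝ, (∫ t in (-T)..T, f (b + t * I)) - (∫ t in (-T)..T, f (a + t * I)) =
      I * ((∫ x in a..b, f (x + (-T : ℝ) * I)) - ∫ x in a..b, f (x + T * I)) := by
    intro T
    have h := integral_boundary_rect_eq_zero_of_differentiableOn f (a + (-T : ℝ) * I) (b + T * I) ?_
    · simp only [add_re, ofReal_re, mul_re, I_re, mul_zero, ofReal_im, I_im, mul_one, sub_self,
        add_zero, add_im, mul_im, zero_add, smul_eq_mul] at h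
      linear_combination (-I) * h + (((∫ t in (-T)..T, f (b + t * I)) -
        (∫ t in (-T)..T, f (a + t * I)))) * I_sq
    · intro s hs
      simp only [add_re, ofReal_re, mul_re, I_re, mul_zero, ofReal_im, I_im, mul_one, sub_self,
        add_zero, add_im, mul_im, zero_add] at hs
      have := hs.1
      rw [mem_preimage, uIcc_of_le hab] at this
      exact (hf s this.1 this.2).differentiableWithinAt
  have hlim : Tendsto (fun T : ℝ =>
      I * ((∫ x in a..b, f (x + (-T : ℝ) * I)) - ∫ x in a..b, f (x + T * I))) atTop (𝓝 0) := by
    have h0 : Tendsto (fun T : ℝ => 2 * (C * (b - a)) / T) atTop (𝓝 0) :=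
      tendsto_const_nhds.div_atTop tendsto_id
    refine squeeze_zero_norm' ?_ h0
    filter_upwards [eventually_ge_atTop 1] with T hT
    have hT' : |T| = T := abs_of_nonneg (by linarith)
    have h1 := norm_integral_horizontal_le hab hC (T := T) (by rw [hT']; exact hT)
    have h2 := norm_integral_horizontal_le hab hC (T := -T) (by rw [abs_neg, hT']; exact hT)
    rw [abs_neg] at h2
    rw [hT'] at h1 h2
    rw [norm_mul, norm_I, one_mul]
    refine (norm_sub_le _ _).trans ?_
    calc _ ≤ C / T * (b - a) + C / T * (b - a) := add_le_add h2 h1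
      _ = _ := by ring
  have h3 := (htend b hb).sub (htend a ha)
  simp_rw [hrect] at h3
  exact (sub_eq_zero.1 (tendsto_nhds_unique h3 hlim)).symm

theorem integral_div_sq_add_sq {y : ℝ} (hy : 0 < y) :
    Integrable (fun t : ℝ => y / (y ^ 2 + t ^ 2)) ∧ ∫ t : ℝ, y / (y ^ 2 + t ^ 2) = Real.pi := by
  have he : (fun t : ℝ => y / (y ^ 2 + t ^ 2)) = fun t : ℝ => y⁻¹ * (1 + (y⁻¹ * t) ^ 2)⁻¹ := by
    funext t
    field_simp
  rw [he]
  constructor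
  · exact (integrable_inv_one_add_sq.comp_mul_left' (inv_ne_zero hy.ne')).const_mul _
  · rw [integral_const_mul, Measure.integral_comp_mul_left (fun t => (1 + t ^ 2)⁻¹) y⁻¹,
      integral_univ_inv_one_add_sq]
    simp only [inv_inv, abs_of_pos hy, smul_eq_mul]
    field_simp

/-- A kernel with a simple pole at the origin which is integrable on vertical lines. -/
def kernel (R : ℝ) (u : ℂ) : ℂ := 1 / u + u / ((R : ℂ) ^ 2 - u ^ 2)

theorem re_sq_sub_sq (R x t : ℝ) : ((R : ℂ) ^ 2 - (x + t * I) ^ 2).re = R ^ 2 - x ^ 2 + t ^ 2 := by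
  simp [pow_two]
  ring

theorem sq_sub_sq_ne_zero {R x t : ℝ} (hx : |x| < R) : (R : ℂ) ^ 2 - (x + t * I) ^ 2 ≠ 0 := by
  intro h
  have h1 := re_sq_sub_sq R x t
  rw [h, zero_re] at h1
  have := sq_lt_sq' (by linarith [(abs_lt.1 hx).1]) (abs_lt.1 hx).2
  nlinarith [sq_nonneg t]

theorem integrable_kernel {R x : ℝ} (hx : |x| < R) (hx0 : x ≠ 0) :
    Integrable fun t : ℝ => kernel R (x + t * I) := by
  have hR : 0 < R := (abs_nonneg x).trans_lt hx
  have hlt := sq_lt_sq' (by linarith [(abs_lt.1 hx).1]) (abs_lt.1 hx).2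
  have hu : ∀ t : ℝ, (x + t * I : ℂ) ≠ 0 := by
    intro t h
    apply hx0
    simpa using congrArg re h
  set c : ℝ := min 1 (R ^ 2 - x ^ 2) with hc
  have hc0 : 0 < c := lt_min one_pos (by linarith)
  refine (integrable_inv_one_add_sq.const_mul (R ^ 2 / (|x| * c))).mono' ?_ (ae_of_all _ fun t => ?_)
  · refine Continuous.aestronglyMeasurable ?_
    unfold kernel
    exact (Continuous.div (by fun_prop) (by fun_prop) hu).add
      (Continuous.div (by fun_prop) (by fun_prop) fun t => sq_sub_sq_ne_zero hx)
  -- Joined into one fraction the kernel is O(1/(1 + t²)), whereas 1/u alone is not absolutely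
  -- integrable on the line.
  · have e : kernel R (x + t * I) = R ^ 2 / ((x + t * I) * ((R : ℂ) ^ 2 - (x + t * I) ^ 2)) := by
      rw [kernel, div_add_div _ _ (hu t) (sq_sub_sq_ne_zero hx)]
      congr 1
      ring
    have h1 : |x| ≤ ‖(x + t * I : ℂ)‖ := by simpa using abs_re_le_norm (x + t * I : ℂ)
    have h2 : c * (1 + t ^ 2) ≤ ‖(R : ℂ) ^ 2 - (x + t * I) ^ 2‖ := by
      refine le_trans ?_ (re_le_norm _)
      rw [re_sq_sub_sq]
      have := min_le_left 1 (R ^ 2 - x ^ 2)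
      have := min_le_right 1 (R ^ 2 - x ^ 2)
      nlinarith [sq_nonneg t]
    have hx0' := abs_pos.2 hx0
    rw [e, norm_div, norm_mul, norm_pow, norm_real, Real.norm_of_nonneg hR.le, ← div_eq_mul_inv,
      div_div, mul_assoc]
    gcongr

/-- By partial fractions the real part is a combination of Poisson kernels of integral π with
weights 1, 1/2 and -1/2. The imaginary part vanishes because the kernel at -t is the conjugate of
the kernel at t. -/
theorem integral_kernel_of_pos {R x : ℝ} (hx : 0 < x) (hxR : x < R) :
    ∫ t : ℝ, kernel R (x + t * I) = Real.pi := by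
  have hint := integrable_kernel (R := R) (x := x) (by rwa [abs_of_pos hx]) hx.ne'
  have hconj : ∀ t : ℝ, kernel R (x + (-t : ℝ) * I) = (starRingEnd ℂ) (kernel R (x + t * I)) := by
    intro t
    simp [kernel]
  have him : (∫ t : ℝ, kernel R (x + t * I)).im = 0 := by
    have h1 : ∫ t : ℝ, kernel R (x + t * I) = (starRingEnd ℂ) (∫ t : ℝ, kernel R (x + t * I)) := by
      rw [← integral_conj, ← integral_neg_eq_self]
      simp_rw [hconj]
    exact conj_eq_iff_im.1 h1.symm
  have hre : (∫ t : ℝ, kernel R (x + t * I)).re = Real.pi := by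
    rw [← reCLM_apply, ← ContinuousLinearMap.integral_comp_comm _ hint]
    have e : ∀ t : ℝ, reCLM (kernel R (x + t * I)) = x / (x ^ 2 + t ^ 2) +
        (1 / 2 * ((R - x) / ((R - x) ^ 2 + t ^ 2)) - 1 / 2 * ((R + x) / ((R + x) ^ 2 + t ^ 2))) := by
      intro t
      have hne1 : ((R : ℂ) - (x + t * I)) ≠ 0 := by
        intro h
        have := congrArg re h
        simp at this
        linarith
      have hne2 : ((R : ℂ) + (x + t * I)) ≠ 0 := by
        intro h
        have := congrArg re h
        simp at this
        linarith
      have e1 : kernel R (x + t * I) = 1 / (x + t * I) +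
          (((1 / 2 : ℝ) : ℂ) * (1 / ((R : ℂ) - (x + t * I))) -
            ((1 / 2 : ℝ) : ℂ) * (1 / ((R : ℂ) + (x + t * I)))) := by
        rw [kernel, show (R : ℂ) ^ 2 - (x + t * I) ^ 2 =
          ((R : ℂ) - (x + t * I)) * ((R : ℂ) + (x + t * I)) by ring]
        congr 1
        push_cast
        field_simp
        ring
      rw [e1, reCLM_apply]
      simp only [one_div, add_re, sub_re, inv_re, normSq_apply, ofReal_re, mul_re,
        I_re, mul_zero, ofReal_im, I_im, mul_one, sub_self, add_zero, add_im, sub_im, mul_im,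
        zero_add, zero_sub]
      ring_nf
    simp_rw [e]
    obtain ⟨i1, v1⟩ := integral_div_sq_add_sq hx
    obtain ⟨i2, v2⟩ := integral_div_sq_add_sq (y := R - x) (by linarith)
    obtain ⟨i3, v3⟩ := integral_div_sq_add_sq (y := R + x) (by linarith)
    have i4 : Integrable fun t : ℝ => 1 / 2 * ((R - x) / ((R - x) ^ 2 + t ^ 2)) -
        1 / 2 * ((R + x) / ((R + x) ^ 2 + t ^ 2)) := (i2.const_mul _).sub (i3.const_mul _)
    rw [integral_add i1 i4,
      integral_sub (i2.const_mul _) (i3.const_mul _), integral_const_mul, integral_const_mul,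
      v1, v2, v3]
    ring
  apply Complex.ext
  · rw [hre, ofReal_re]
  · rw [him, ofReal_im]

theorem integral_kernel_of_neg {R x : ℝ} (hx : x < 0) (hxR : -R < x) :
    ∫ t : ℝ, kernel R (x + t * I) = -Real.pi := by
  have h := integral_kernel_of_pos (R := R) (x := -x) (by linarith) (by linarith)
  have hodd : ∀ t : ℝ, kernel R (x + (-t : ℝ) * I) = -kernel R ((-x : ℝ) + t * I) := by
    intro t
    have : (x + (-t : ℝ) * I : ℂ) = -((-x : ℝ) + t * I) := by push_cast; ring
    rw [this, kernel, kernel]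
    simp only [div_neg, neg_div, even_two, Even.neg_pow]
    ring
  rw [← h, ← integral_neg_eq_self, ← integral_neg]
  simp_rw [hodd]

/-- The residue theorem in a vertical strip, for a simple pole on the real axis. -/
theorem integral_vertical_sub_integral_vertical {G : ℂ → ℂ} {a b p C : ℝ} (hap : a < p) (hpb : p < b)
    (hG : ∀ s : ℂ, a ≤ s.re → s.re ≤ b → AnalyticAt ℂ G s)
    (hC : ∀ s : ℂ, a ≤ s.re → s.re ≤ b → ‖G s‖ ≤ C)
    (ha : Integrable fun t : ℝ => G (a + t * I)) (hb : Integrable fun t : ℝ => G (b + t * I)) :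
    (∫ t : ℝ, G (b + t * I) / (b + t * I - p)) - (∫ t : ℝ, G (a + t * I) / (a + t * I - p)) =
      2 * Real.pi * G p := by
  set R : ℝ := b - a with hR
  have hRp : 0 < R := by rw [hR]; linarith
  have hux : ∀ s : ℂ, a ≤ s.re → s.re ≤ b → |(s - p).re| < R := by
    intro s h1 h2
    simp only [sub_re, ofReal_re]
    rw [abs_lt, hR]; constructor <;> linarith
  have hden : ∀ s : ℂ, a ≤ s.re → s.re ≤ b → (R : ℂ) ^ 2 - (s - p) ^ 2 ≠ 0 := by
    intro s h1 h2
    have := sq_sub_sq_ne_zero (R := R) (x := (s - p).re) (t := (s - p).im) (hux s h1 h2)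
    rwa [re_add_im] at this
  -- This is G(s)/(s - p) minus G(p) times `kernel`, with the singularity at p removed. Its integral
  -- is therefore the same on both lines, and the residue comes from the kernel, whose integral
  -- jumps from -π to π across p.
  set f : ℂ → ℂ := fun s => dslope G p s - G p * ((s - p) / ((R : ℂ) ^ 2 - (s - p) ^ 2)) with hf
  have hfeq : ∀ s : ℂ, s ≠ p → f s = G s / (s - p) - G p * kernel R (s - p) := by
    intro s hs
    have hs' : s - p ≠ 0 := sub_ne_zero.2 hs
    simp only [hf, kernel]
    rw [dslope_of_ne _ hs, slope_def_field]
    ring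
  have hdiff : ∀ s : ℂ, a ≤ s.re → s.re ≤ b → DifferentiableAt ℂ f s := by
    intro s h1 h2
    have hd : DifferentiableAt ℂ (dslope G p) s := by
      rcases eq_or_ne s p with rfl | hne
      · have := (hG p (by simp [hap.le]) (by simp [hpb.le]))
        obtain ⟨q, hq⟩ := this
        exact (hq.has_fpower_series_dslope_fslope).analyticAt.differentiableAt
      · exact (differentiableAt_dslope_of_ne hne).2 (hG s h1 h2).differentiableAt
    refine hd.sub (DifferentiableAt.const_mul ?_ _)
    exact DifferentiableAt.div (by fun_prop) (by fun_prop) (hden s h1 h2)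
  have hC0 : 0 ≤ C := (norm_nonneg _).trans (hC p (by simp [hap.le]) (by simp [hpb.le]))
  have hbound : ∀ s : ℂ, a ≤ s.re → s.re ≤ b → 1 ≤ |s.im| →
      ‖f s‖ ≤ (C + C + C * (R + 1)) / |s.im| := by
    intro s h1 h2 h3
    have him : (s - p).im = s.im := by simp
    have hs0 : s ≠ p := by
      rintro rfl
      norm_num at h3
    have hn1 : |s.im| ≤ ‖s - p‖ := by rw [← him]; exact abs_im_le_norm _
    have hn2 : |s.im| ^ 2 ≤ ‖(R : ℂ) ^ 2 - (s - p) ^ 2‖ := by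
      refine le_trans ?_ (re_le_norm _)
      have e := re_sq_sub_sq R (s - p).re (s - p).im
      rw [re_add_im] at e
      rw [e, him, sq_abs]
      have := hux s h1 h2
      have := sq_lt_sq' (by linarith [(abs_lt.1 this).1]) (abs_lt.1 this).2
      linarith
    have hn3 : ‖s - p‖ ≤ (R + 1) * |s.im| := by
      refine (norm_le_abs_re_add_abs_im _).trans ?_
      rw [him]
      nlinarith [hux s h1 h2]
    have hpos : 0 < |s.im| := by linarith
    simp only [hf]
    rw [dslope_of_ne _ hs0, slope_def_field]
    calc ‖(G s - G p) / (s - p) - G p * ((s - p) / ((R : ℂ) ^ 2 - (s - p) ^ 2))‖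
        ≤ ‖(G s - G p) / (s - p)‖ + ‖G p * ((s - p) / ((R : ℂ) ^ 2 - (s - p) ^ 2))‖ :=
          norm_sub_le _ _
      _ ≤ (C + C) / |s.im| + C * ((R + 1) * |s.im| / |s.im| ^ 2) := by
          rw [norm_div, norm_mul, norm_div]
          gcongr
          · exact (norm_sub_le _ _).trans
              (add_le_add (hC s h1 h2) (hC p (by simp [hap.le]) (by simp [hpb.le])))
          · exact hC p (by simp [hap.le]) (by simp [hpb.le])
      _ = _ := by field_simp
  have hdivint : ∀ x : ℝ, x ≠ p → Integrable (fun t : ℝ => G (x + t * I)) →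
      Integrable fun t : ℝ => G (x + t * I) / (x + t * I - p) := by
    intro x hx hi
    have hne : ∀ t : ℝ, (x + t * I - p : ℂ) ≠ 0 := by
      intro t h
      apply hx
      have := congrArg re h
      simp at this
      linarith
    have hcont : Continuous fun t : ℝ => (x + t * I - p : ℂ)⁻¹ := Continuous.inv₀ (by fun_prop) hne
    simp_rw [div_eq_mul_inv]
    refine hi.mul_bdd (c := |x - p|⁻¹) hcont.aestronglyMeasurable (ae_of_all _ fun t => ?_)
    rw [norm_inv]
    have : |x - p| ≤ ‖(x + t * I - p : ℂ)‖ := by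
      simpa using abs_re_le_norm (x + t * I - p : ℂ)
    have h0 : 0 < |x - p| := abs_pos.2 (sub_ne_zero.2 hx)
    gcongr
  have hker : ∀ x : ℝ, a ≤ x → x ≤ b → x ≠ p → Integrable fun t : ℝ => kernel R (x + t * I - p) := by
    intro x h1 h2 h3
    have := integrable_kernel (R := R) (x := x - p) (by
      have := hux x (by simpa using h1) (by simpa using h2)
      simpa using this) (sub_ne_zero.2 h3)
    refine this.congr (ae_of_all _ fun t => ?_)
    simp only
    congr 1
    push_cast
    ring
  have hval : ∀ x : ℝ, a ≤ x → x ≤ b → x ≠ p → Integrable (fun t : ℝ => G (x + t * I)) →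
      Integrable (fun t : ℝ => f (x + t * I)) ∧ ∫ t : ℝ, f (x + t * I) =
      (∫ t : ℝ, G (x + t * I) / (x + t * I - p)) - G p * ∫ t : ℝ, kernel R ((x - p : ℝ) + t * I) := by
    intro x h1 h2 h3 hi
    have e : (fun t : ℝ => f (x + t * I)) = fun t : ℝ =>
        G (x + t * I) / (x + t * I - p) - G p * kernel R (x + t * I - p) := by
      funext t
      refine hfeq _ fun h => h3 ?_
      simpa using congrArg re h
    rw [e]
    refine ⟨(hdivint x h3 hi).sub ((hker x h1 h2 h3).const_mul _), ?_⟩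
    rw [integral_sub (hdivint x h3 hi) ((hker x h1 h2 h3).const_mul _), integral_const_mul]
    congr 3
    funext t
    congr 1
    push_cast
    ring
  obtain ⟨ia, va⟩ := hval a le_rfl (hap.trans hpb).le hap.ne ha
  obtain ⟨ib, vb⟩ := hval b (hap.trans hpb).le le_rfl hpb.ne' hb
  have hshift := integral_vertical_eq (hap.trans hpb).le hdiff hbound ia ib
  rw [va, vb, integral_kernel_of_neg (by linarith) (by rw [hR]; linarith),
    integral_kernel_of_pos (by linarith) (by rw [hR]; linarith)] at hshift
  linear_combination -hshift

end PolyMeinardus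
end

noncomputable section
namespace PolyMeinardus
open MeasureTheory Complex Set

/-! ### The additive character and the discrete Fourier expansion -/

theorem e_add (x y : ℝ) : e (x + y) = e x * e y := by
  rw [e, e, e, ← exp_add]
  congr 1
  push_cast
  ring

theorem e_nat_mul (n : ℕ) (x : ℝ) : e (n * x) = e x ^ n := by
  rw [e, e, ← exp_nat_mul]
  congr 1
  push_cast
  ring

theorem e_intCast (n : ℤ) : e n = 1 := by
  rw [e, exp_eq_one_iff]
  exact ⟨n, by push_cast; ring⟩

theorem e_natCast (n : ℕ) : e n = 1 := by simpa using e_intCast n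

theorem norm_e (x : ℝ) : ‖e x‖ = 1 := by
  rw [e, norm_exp]
  simp

theorem e_eq_one_iff {x : ℝ} : e x = 1 ↔ ∃ n : ℤ, x = n := by
  constructor
  · intro h
    rw [e, exp_eq_one_iff] at h
    obtain ⟨n, hn⟩ := h
    refine ⟨n, ?_⟩
    have h2 : (2 * Real.pi * I : ℂ) ≠ 0 := by simp [Real.pi_ne_zero]
    have h3 : (x : ℂ) = n := by
      apply mul_left_cancel₀ h2
      linear_combination hn
    exact_mod_cast h3
  · rintro ⟨n, rfl⟩
    exact e_intCast n

theorem sum_e_div {k : ℕ} (hk : 0 < k) {h h' : ℕ} (hh : h < k) (hh' : h' < k) :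
    ∑ j ∈ Finset.range k, e ((h : ℝ) * j / k) * e (-((h' : ℝ) * j / k)) =
      if h = h' then (k : ℂ) else 0 := by
  have hk' : (0 : ℝ) < k := by exact_mod_cast hk
  set x : ℝ := ((h : ℝ) - h') / k with hx
  have e1 : ∀ j : ℕ, e ((h : ℝ) * j / k) * e (-((h' : ℝ) * j / k)) = e x ^ j := by
    intro j
    rw [← e_add, ← e_nat_mul, hx]
    congr 1
    ring
  simp_rw [e1]
  split_ifs with heq
  · have : e x = 1 := by
      rw [hx, heq, sub_self, zero_div]
      simpa using e_intCast 0
    simp [this]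
  · have hne : e x ≠ 1 := by
      rw [Ne, e_eq_one_iff]
      rintro ⟨n, hn⟩
      rw [hx, div_eq_iff hk'.ne'] at hn
      have h3 : (h : ℤ) - h' = n * k := by exact_mod_cast hn
      have h4 : n = 0 := by
        by_contra h0
        rcases lt_or_gt_of_ne h0 with h0 | h0 <;> nlinarith
      subst h4
      omega
    have hpow : e x ^ k = 1 := by
      rw [← e_nat_mul, hx, mul_div_cancel₀ _ hk'.ne']
      simpa using e_intCast ((h : ℤ) - h')
    rw [geom_sum_eq hne, hpow, sub_self, zero_div]

theorem e_mod_mul_div {k : ℕ} (hk : 0 < k) (h j : ℕ) :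
    e (((h % k : ℕ) : ℝ) * j / k) = e ((h : ℝ) * j / k) := by
  have hk' : (k : ℝ) ≠ 0 := by positivity
  have h1 : (h : ℝ) * j / k = ((h % k : ℕ) : ℝ) * j / k + ((h / k * j : ℕ) : ℝ) := by
    have : (h : ℝ) = (h % k : ℕ) + k * (h / k : ℕ) := by exact_mod_cast (Nat.mod_add_div h k).symm
    nth_rewrite 1 [this]
    push_cast
    field_simp
  rw [h1, e_add, e_natCast, mul_one]

/-- The discrete Fourier expansion of a periodic function. -/
theorem sum_fourierCoeff {k : ℕ} (hk : 0 < k) {F : ℕ → ℂ} (hF : ∀ h, F (h % k) = F h) (h : ℕ) :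
    ∑ j ∈ Finset.range k, fourierCoeff k F j * e ((h : ℝ) * j / k) = F h := by
  have hk0 : (k : ℂ) ≠ 0 := by exact_mod_cast hk.ne'
  have hlt := Nat.mod_lt h hk
  calc ∑ j ∈ Finset.range k, fourierCoeff k F j * e ((h : ℝ) * j / k)
      = ∑ j ∈ Finset.range k, ∑ h' ∈ Finset.range k, 1 / (k : ℂ) * (F h' *
          (e (((h % k : ℕ) : ℝ) * j / k) * e (-((h' : ℝ) * j / k)))) := by
        refine Finset.sum_congr rfl fun j _ => ?_
        rw [fourierCoeff, mul_assoc, Finset.sum_mul, Finset.mul_sum, e_mod_mul_div hk]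
        refine Finset.sum_congr rfl fun h' _ => ?_
        ring
    _ = ∑ h' ∈ Finset.range k, 1 / (k : ℂ) * (F h' * if h % k = h' then (k : ℂ) else 0) := by
        rw [Finset.sum_comm]
        refine Finset.sum_congr rfl fun h' hh' => ?_
        rw [← Finset.mul_sum, ← Finset.mul_sum, sum_e_div hk hlt (Finset.mem_range.1 hh')]
    _ = F h := by
        rw [Finset.sum_eq_single_of_mem (h % k) (Finset.mem_range.2 hlt)]
        · rw [if_pos rfl, hF]; field_simp
        · intro b _ hb
          rw [if_neg hb.symm]; simp

/-! ### The continued Dirichlet series -/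

/-- The regular function `(s - s₀) D_{h,k}(s)`. -/
def regD (s₀ : ℝ) (D : ℕ → ℕ → ℂ → ℂ) (A : ℕ → ℕ → ℂ) (h k : ℕ) : ℂ → ℂ :=
  Function.update (fun s => (s - s₀) * D h k s) s₀ (A h k)

theorem regD_of_ne {s₀ : ℝ} {D : ℕ → ℕ → ℂ → ℂ} {A : ℕ → ℕ → ℂ} {h k : ℕ} {s : ℂ}
    (hs : s ≠ s₀) : regD s₀ D A h k s = (s - s₀) * D h k s := Function.update_of_ne hs _ _

theorem regD_self {s₀ : ℝ} {D : ℕ → ℕ → ℂ → ℂ} {A : ℕ → ℕ → ℂ} {h k : ℕ} :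
    regD s₀ D A h k s₀ = A h k := Function.update_self _ _ _

section
variable {a : ℕ → ℝ} {s₀ σ₀ c : ℝ} {D : ℕ → ℕ → ℂ → ℂ} {A : ℕ → ℕ → ℂ}

theorem twist_mod {k : ℕ} (hk : 0 < k) (h : ℕ) : twist a (h % k) k = twist a h k := by
  funext m
  rw [twist, twist, e_mod_mul_div hk]

theorem norm_twist (h k m : ℕ) : ‖twist a h k m‖ = |a m| := by
  rw [twist, norm_mul, norm_e, one_mul, norm_real, Real.norm_eq_abs]

theorem analyticAt_regD (hadm : Admissible a s₀ σ₀ c D A) (hσs : σ₀ < s₀) {h k : ℕ} (hk : 0 < k)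
    {s : ℂ} (hs : σ₀ ≤ s.re) : AnalyticAt ℂ (regD s₀ D A h k) s := by
  have hne : ∀ s : ℂ, σ₀ ≤ s.re → s ≠ s₀ → AnalyticAt ℂ (regD s₀ D A h k) s := by
    intro s hs hs0
    have h1 : AnalyticAt ℂ (fun s => (s - s₀) * D h k s) s :=
      (analyticAt_id.sub analyticAt_const).mul (hadm.analytic h k hk s ⟨hs, hs0⟩)
    refine h1.congr ?_
    filter_upwards [isOpen_ne.mem_nhds hs0] with z hz
    exact (regD_of_ne hz).symm
  rcases eq_or_ne s s₀ with rfl | hs0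
  · refine analyticAt_of_differentiable_on_punctured_nhds_of_continuousAt ?_ ?_
    · have : {z : ℂ | σ₀ < z.re} ∈ 𝓝 (s₀ : ℂ) :=
        (isOpen_lt continuous_const continuous_re).mem_nhds (by simpa using hσs)
      filter_upwards [self_mem_nhdsWithin, mem_nhdsWithin_of_mem_nhds this] with z hz hz'
      exact (hne z (le_of_lt hz') hz).differentiableAt
    · exact continuousAt_update_same.2 (hadm.residue h k hk)
  · exact hne s hs hs0

/-- For Re s > c the Dirichlet series depends only on h modulo k, and the identity theorem carries
this to the continuation. Periodicity of the residues and of the values at 0 follows, as the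
discrete Fourier expansion requires. -/
theorem regD_mod (hadm : Admissible a s₀ σ₀ c D A) (hσs : σ₀ < s₀) (hs₀c : s₀ < c) {k : ℕ}
    (hk : 0 < k) (h : ℕ) {s : ℂ} (hs : σ₀ ≤ s.re) :
    regD s₀ D A (h % k) k s = regD s₀ D A h k s := by
  have hset : IsPreconnected {s : ℂ | σ₀ ≤ s.re} := (convex_halfSpace_re_ge σ₀).isPreconnected
  refine AnalyticOnNhd.eqOn_of_preconnected_of_eventuallyEq (𝕜 := ℂ) (U := {s : ℂ | σ₀ ≤ s.re})
    (fun s hs => analyticAt_regD hadm hσs hk hs) (fun s hs => analyticAt_regD hadm hσs hk hs)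
    hset (z₀ := ((c + 1 : ℝ) : ℂ)) (by simp; linarith) ?_ hs
  have : {z : ℂ | c < z.re} ∈ 𝓝 ((c + 1 : ℝ) : ℂ) :=
    (isOpen_lt continuous_const continuous_re).mem_nhds (by simp)
  filter_upwards [this] with z hz
  have hz' : c < z.re := hz
  have hzs : z ≠ s₀ := by
    rintro rfl
    simp at hz'
    linarith
  rw [regD_of_ne hzs, regD_of_ne hzs, hadm.eq_series _ k hk z hz', hadm.eq_series _ k hk z hz',
    twist_mod hk]

theorem A_mod (hadm : Admissible a s₀ σ₀ c D A) (hσs : σ₀ < s₀) (hs₀c : s₀ < c) {k : ℕ}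
    (hk : 0 < k) (h : ℕ) : A (h % k) k = A h k := by
  have := regD_mod hadm hσs hs₀c hk h (s := s₀) (by simpa using hσs.le)
  rwa [regD_self, regD_self] at this

theorem D_zero_mod (hadm : Admissible a s₀ σ₀ c D A) (hs₀ : 0 < s₀) (hσ₀ : σ₀ < 0) (hs₀c : s₀ < c)
    {k : ℕ} (hk : 0 < k) (h : ℕ) : D (h % k) k 0 = D h k 0 := by
  have h0 : (0 : ℂ) ≠ s₀ := by exact_mod_cast hs₀.ne
  have := regD_mod hadm (hσ₀.trans hs₀) hs₀c hk h (s := 0) (by simpa using hσ₀.le)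
  rw [regD_of_ne h0, regD_of_ne h0] at this
  exact mul_left_cancel₀ (sub_ne_zero.2 h0) this

theorem exists_norm_D_zero_le (hadm : Admissible a s₀ σ₀ c D A) (hs₀ : 0 < s₀) (hσ₀ : σ₀ < 0)
    (hs₀c : s₀ < c) :
    ∃ C : ℝ, 0 < C ∧ ∀ h k : ℕ, 0 < k → ‖D h k 0‖ ≤ C * (k : ℝ) ^ s₀ := by
  obtain ⟨C₁, C₂, h1, h2, hb⟩ := hadm.bound
  refine ⟨C₁ / s₀, by positivity, fun h k hk => ?_⟩
  have := hb h k hk 0 (by simpa using hσ₀.le) (by simp; linarith)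
  simp only [zero_sub, norm_mul, norm_neg, norm_real, Real.norm_of_nonneg hs₀.le, zero_im, abs_zero,
    add_zero, Real.one_rpow, mul_one, zero_re] at this
  rw [div_mul_eq_mul_div, le_div_iff₀ hs₀]
  linarith

/-- By uniform convergence one partial sum is within 1 of the series on the whole half plane, and
its terms are largest in modulus at the boundary Re s = c. -/
theorem exists_norm_LSeries_le (hadm : Admissible a s₀ σ₀ c D A) {h k : ℕ} (hk : 0 < k) :
    ∃ B : ℝ, ∀ s : ℂ, c < s.re → ‖LSeries (twist a h k) s‖ ≤ B := by
  have hu := Metric.tendstoUniformlyOn_iff.1 (hadm.uniform h k hk) 1 one_pos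
  obtain ⟨N, hN⟩ := hu.exists
  refine ⟨1 + ∑ m ∈ Finset.range N, ‖LSeries.term (twist a h k) c m‖, fun s hs => ?_⟩
  have h1 := hN s hs
  rw [dist_eq_norm] at h1
  calc ‖LSeries (twist a h k) s‖
      ≤ ‖LSeries (twist a h k) s - ∑ m ∈ Finset.range N, LSeries.term (twist a h k) s m‖ +
        ‖∑ m ∈ Finset.range N, LSeries.term (twist a h k) s m‖ := norm_le_norm_sub_add _ _
    _ ≤ 1 + ∑ m ∈ Finset.range N, ‖LSeries.term (twist a h k) c m‖ := by
        refine add_le_add h1.le ((norm_sum_le _ _).trans (Finset.sum_le_sum fun m _ => ?_))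
        exact LSeries.norm_term_le_of_re_le_re _ (by simpa using hs.le) m

/-- This serves only to justify moving the line of integration, which starts to the right of c, so
the constants may depend on h and k. Uniformity comes later from `hadm.bound` on the line Re s = σ₀.
-/
theorem exists_norm_regD_le (hadm : Admissible a s₀ σ₀ c D A) (hs₀ : 0 < s₀) {h k : ℕ} (hk : 0 < k)
    (c₁ : ℝ) :
    ∃ C K : ℝ, 0 < C ∧ ∀ s : ℂ, σ₀ ≤ s.re → s.re ≤ c₁ →
      ‖regD s₀ D A h k s‖ ≤ C * (1 + |s.im|) ^ K := by
  obtain ⟨C₁, C₂, h1, h2, hb⟩ := hadm.bound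
  obtain ⟨B, hB⟩ := exists_norm_LSeries_le hadm (h := h) hk
  set X : ℝ := C₁ * (k : ℝ) ^ (s₀ + max |σ₀| |c|) with hX
  have hX0 : 0 ≤ X := by positivity
  set Y : ℝ := (|c| + |c₁| + s₀ + 1) * |B| with hY
  have hY0 : 0 ≤ Y := by positivity
  refine ⟨1 + X + Y + ‖A h k‖, max C₂ 1, by positivity, fun s hs1 hs2 => ?_⟩
  have hbase : 1 ≤ 1 + |s.im| := by linarith [abs_nonneg s.im]
  have hpow1 : 1 ≤ (1 + |s.im|) ^ max C₂ 1 := Real.one_le_rpow hbase (by positivity)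
  have hA0 := norm_nonneg (A h k)
  rcases eq_or_ne s s₀ with rfl | hs0
  · rw [regD_self]
    nlinarith
  · rw [regD_of_ne hs0]
    rcases le_or_gt s.re c with hsc | hsc
    · refine (hb h k hk s hs1 hsc).trans ?_
      have e1 : (1 + |s.im|) ^ C₂ ≤ (1 + |s.im|) ^ max C₂ 1 :=
        Real.rpow_le_rpow_of_exponent_le hbase (le_max_left _ _)
      have e2 : (k : ℝ) ^ (s₀ + |s.re|) ≤ (k : ℝ) ^ (s₀ + max |σ₀| |c|) := by
        apply Real.rpow_le_rpow_of_exponent_le (by exact_mod_cast hk)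
        have := abs_le_max_abs_abs hs1 hsc
        linarith
      calc C₁ * (1 + |s.im|) ^ C₂ * (k : ℝ) ^ (s₀ + |s.re|)
          ≤ C₁ * (1 + |s.im|) ^ max C₂ 1 * (k : ℝ) ^ (s₀ + max |σ₀| |c|) := by gcongr
        _ = X * (1 + |s.im|) ^ max C₂ 1 := by rw [hX]; ring
        _ ≤ _ := by
          apply mul_le_mul_of_nonneg_right _ (by positivity)
          linarith
    · rw [hadm.eq_series h k hk s hsc, norm_mul]
      have e1 : ‖s - s₀‖ ≤ (|c| + |c₁| + s₀ + 1) * (1 + |s.im|) := by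
        refine (norm_le_abs_re_add_abs_im _).trans ?_
        simp only [sub_re, ofReal_re, sub_im, ofReal_im, sub_zero]
        have : |s.re - s₀| ≤ |c| + |c₁| + s₀ := by
          rw [abs_le]
          constructor <;> linarith [neg_abs_le c, le_abs_self c₁, abs_nonneg c, abs_nonneg c₁]
        nlinarith [abs_nonneg s.im, abs_nonneg c, abs_nonneg c₁]
      have e2 : (1 + |s.im|) ≤ (1 + |s.im|) ^ max C₂ 1 := by
        nth_rewrite 1 [← Real.rpow_one (1 + |s.im|)]
        exact Real.rpow_le_rpow_of_exponent_le hbase (le_max_right _ _)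
      calc ‖s - s₀‖ * ‖LSeries (twist a h k) s‖
          ≤ (|c| + |c₁| + s₀ + 1) * (1 + |s.im|) * |B| :=
            mul_le_mul e1 ((hB s hsc).trans (le_abs_self B)) (norm_nonneg _) (by positivity)
        _ = Y * (1 + |s.im|) := by rw [hY]; ring
        _ ≤ Y * (1 + |s.im|) ^ max C₂ 1 := by gcongr
        _ ≤ _ := by
          apply mul_le_mul_of_nonneg_right _ (by positivity)
          linarith

/-! ### Mellin inversion -/

theorem ofReal_mul_cpow {r : ℝ} (hr : 0 < r) {v : ℂ} (hv : v ≠ 0) (s : ℂ) :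
    ((r : ℂ) * v) ^ s = (r : ℂ) ^ s * v ^ s := by
  have hr0 : (r : ℂ) ≠ 0 := by exact_mod_cast hr.ne'
  rw [cpow_def_of_ne_zero (mul_ne_zero hr0 hv), cpow_def_of_ne_zero hr0, cpow_def_of_ne_zero hv,
    log_ofReal_mul hr hv, ← ofReal_log hr.le, ← exp_add, add_mul]

/-- Mellin inversion of e^{-mv} for each m. On the line Re s = c₁ the moduli of the terms of the
Dirichlet series do not depend on t, so absolute convergence permits exchanging sum and integral. -/
theorem hasSum_twist_mul_exp (hadm : Admissible a s₀ σ₀ c D A) {h k : ℕ} (hk : 0 < k) {c₁ : ℝ}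
    (hc₁ : c < c₁) (hc₁0 : 0 < c₁) {v : ℂ} (hv : 0 < v.re) :
    HasSum (fun m : ℕ => 2 * Real.pi * (twist a h k (m + 1) * exp (-(((m + 1 : ℕ) : ℂ) * v))))
      (∫ t : ℝ, D h k (c₁ + t * I) * (Gamma (c₁ + t * I) * v ^ (-(c₁ + t * I : ℂ)))) := by
  have hv0 : v ≠ 0 := by rintro rfl; simp at hv
  set F : ℕ → ℝ → ℂ := fun m t => LSeries.term (twist a h k) (c₁ + t * I) m *
    (Gamma (c₁ + t * I) * v ^ (-(c₁ + t * I : ℂ))) with hF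
  have hFm : ∀ m : ℕ, 0 < m → ∀ t : ℝ, F m t = twist a h k m *
      (Gamma (c₁ + t * I) * ((m : ℂ) * v) ^ (-(c₁ + t * I : ℂ))) := by
    intro m hm t
    simp only [hF]
    have : ((m : ℂ) * v) ^ (-(c₁ + t * I : ℂ)) = (m : ℂ) ^ (-(c₁ + t * I : ℂ)) *
        v ^ (-(c₁ + t * I : ℂ)) := by
      have h1 : (m : ℂ) = ((m : ℝ) : ℂ) := by simp
      rw [h1, ofReal_mul_cpow (by exact_mod_cast hm) hv0]
    rw [LSeries.term_of_ne_zero hm.ne', this, cpow_neg (m : ℂ)]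
    ring
  have hmv : ∀ m : ℕ, 0 < m → 0 < ((m : ℂ) * v).re := by
    intro m hm
    have : (0 : ℝ) < m := by exact_mod_cast hm
    simp
    positivity
  have hnorm : ∀ m t, ‖F m t‖ = ‖LSeries.term (twist a h k) c₁ m‖ *
      ‖Gamma (c₁ + t * I) * v ^ (-(c₁ + t * I : ℂ))‖ := by
    intro m t
    simp only [hF]
    rw [norm_mul]
    congr 1
    rw [LSeries.norm_term_eq, LSeries.norm_term_eq]
    simp
  have hFint : ∀ m, Integrable (F m) := by
    intro m
    rcases Nat.eq_zero_or_pos m with rfl | hm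
    · simp [hF]
    · have := (integrable_Gamma_mul_cpow hc₁0 (hmv m hm)).const_mul (twist a h k m)
      exact this.congr (ae_of_all _ fun t => (hFm m hm t).symm)
  have hsum : Summable fun m => ∫ t, ‖F m t‖ := by
    simp_rw [hnorm, integral_const_mul]
    exact ((hadm.summable h k hk c₁ (by simpa using hc₁)).norm).mul_right _
  have hs := hasSum_integral_of_summable_integral_norm hFint hsum
  have hval : ∀ t : ℝ, ∑' m, F m t = D h k (c₁ + t * I) *
      (Gamma (c₁ + t * I) * v ^ (-(c₁ + t * I : ℂ))) := by
    intro t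
    simp only [hF]
    rw [tsum_mul_right, hadm.eq_series h k hk _ (by simpa using hc₁)]
    rfl
  simp_rw [hval] at hs
  -- The term of an `LSeries` at index 0 is zero, so the sum may start at 1.
  rw [← hasSum_nat_add_iff' 1] at hs
  have h0 : ∫ t, F 0 t = 0 := by simp [hF]
  simp only [Finset.sum_range_one, h0, sub_zero] at hs
  convert! hs using 2 with m
  simp_rw [hFm (m + 1) m.succ_pos]
  rw [integral_const_mul, integral_Gamma_mul_cpow hc₁0 (hmv _ m.succ_pos)]
  ring

end
end PolyMeinardus
end

/-! ### Moving the line of integration: the expansion of the twisted exponential series -/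

noncomputable section
namespace PolyMeinardus
open MeasureTheory Complex Set

section
variable {a : ℕ → ℝ} {s₀ σ₀ c : ℝ} {D : ℕ → ℕ → ℂ → ℂ} {A : ℕ → ℕ → ℂ}

/-- The Mellin integrand `Γ(s) D_{h,k}(s) v^{-s}`, multiplied by `s (s - s₀)`. -/
def mellinG (s₀ : ℝ) (D : ℕ → ℕ → ℂ → ℂ) (A : ℕ → ℕ → ℂ) (h k : ℕ) (v s : ℂ) : ℂ :=
  Gamma (s + 1) * regD s₀ D A h k s * v ^ (-s)

theorem analyticAt_Gamma {s : ℂ} (hs : 0 < s.re) : AnalyticAt ℂ Gamma s := by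
  have hd : DifferentiableOn ℂ Gamma {s : ℂ | 0 < s.re} := by
    intro z hz
    refine (differentiableAt_Gamma _ fun m hm => ?_).differentiableWithinAt
    have h1 : 0 < z.re := hz
    rw [hm] at h1
    simp at h1
    have : (0 : ℝ) ≤ m := by positivity
    linarith
  exact hd.analyticAt ((isOpen_lt continuous_const continuous_re).mem_nhds hs)

/-- The condition σ₀ > -1 keeps Γ(s + 1) free of poles, so that 0 is the only pole of Γ crossed by
the shift. -/
theorem analyticAt_mellinG (hadm : Admissible a s₀ σ₀ c D A) (hσ₀ : -1 < σ₀) (hσs : σ₀ < s₀)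
    {h k : ℕ} (hk : 0 < k) {v : ℂ} (hv : v ≠ 0) {s : ℂ} (hs : σ₀ ≤ s.re) :
    AnalyticAt ℂ (mellinG s₀ D A h k v) s := by
  have h1 : AnalyticAt ℂ (fun s : ℂ => Gamma (s + 1)) s := by
    refine AnalyticAt.fun_comp (g := Gamma) (f := fun s : ℂ => s + 1) (analyticAt_Gamma ?_)
      (by fun_prop)
    simp; linarith
  have h2 : AnalyticAt ℂ (fun s : ℂ => v ^ (-s)) s := by
    have : (fun s : ℂ => v ^ (-s)) = fun s => exp (log v * (-s)) := by
      funext s; rw [cpow_def_of_ne_zero hv]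
    rw [this]
    fun_prop
  exact (h1.mul (analyticAt_regD hadm hσs hk hs)).mul h2

theorem norm_mellinG_le {CΓ θ CD K : ℝ} {h k : ℕ} {v s : ℂ} (hv : v ≠ 0) (hCΓ : 0 ≤ CΓ)
    (hCD : 0 ≤ CD) (hΓ : ‖Gamma (s + 1)‖ ≤ CΓ * Real.exp (-θ * |(s + 1).im|))
    (hD : ‖regD s₀ D A h k s‖ ≤ CD * (1 + |s.im|) ^ K) {θ₀ : ℝ} (hθ : |arg v| ≤ θ₀) :
    ‖mellinG s₀ D A h k v s‖ ≤
      CΓ * CD * ‖v‖ ^ (-s.re) * ((1 + |s.im|) ^ K * Real.exp (-(θ - θ₀) * |s.im|)) := by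
  rw [mellinG, norm_mul, norm_mul, norm_cpow_neg hv]
  rw [add_im, one_im, add_zero] at hΓ
  have h1 : arg v * s.im ≤ θ₀ * |s.im| := by
    calc arg v * s.im ≤ |arg v * s.im| := le_abs_self _
      _ = |arg v| * |s.im| := abs_mul _ _
      _ ≤ _ := by gcongr
  calc _ ≤ (CΓ * Real.exp (-θ * |s.im|)) * (CD * (1 + |s.im|) ^ K) *
        (‖v‖ ^ (-s.re) * Real.exp (θ₀ * |s.im|)) := by gcongr
    _ = CΓ * CD * ‖v‖ ^ (-s.re) * ((1 + |s.im|) ^ K *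
          (Real.exp (-θ * |s.im|) * Real.exp (θ₀ * |s.im|))) := by ring
    _ = _ := by rw [← Real.exp_add]; ring_nf

theorem integrable_mellinG (hadm : Admissible a s₀ σ₀ c D A) (hσ₀ : -1 < σ₀)
    (hs₀ : 0 < s₀) (hσs : σ₀ < s₀) {h k : ℕ} (hk : 0 < k) {v : ℂ} (hv : 0 < v.re) (c₁ : ℝ) :
    (∃ C : ℝ, ∀ s : ℂ, σ₀ ≤ s.re → s.re ≤ c₁ → ‖mellinG s₀ D A h k v s‖ ≤ C) ∧
    ∀ x : ℝ, σ₀ ≤ x → x ≤ c₁ → Integrable fun t : ℝ => mellinG s₀ D A h k v (x + t * I) := by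
  have hv0 : v ≠ 0 := by rintro rfl; simp at hv
  have harg : |arg v| < Real.pi / 2 := abs_arg_lt_pi_div_two_iff.2 (Or.inl hv)
  obtain ⟨θ, hθ1, hθ2⟩ := exists_between harg
  obtain ⟨CΓ, hCΓ, hΓ⟩ := exists_norm_Gamma_le (σ₁ := 1 + σ₀) (σ₂ := c₁ + 1) (by linarith)
    ((abs_nonneg _).trans hθ1.le) hθ2
  obtain ⟨CD, K, hCD, hD⟩ := exists_norm_regD_le hadm hs₀ (h := h) hk c₁
  have hb : 0 < θ - |arg v| := by linarith
  have key : ∀ s : ℂ, σ₀ ≤ s.re → s.re ≤ c₁ → ‖mellinG s₀ D A h k v s‖ ≤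
      CΓ * CD * ‖v‖ ^ (-s.re) * ((1 + |s.im|) ^ K * Real.exp (-(θ - |arg v|) * |s.im|)) :=
    fun s h1 h2 => norm_mellinG_le hv0 hCΓ.le hCD.le
      (hΓ _ (by simp; linarith) (by simp; linarith)) (hD s h1 h2) le_rfl
  constructor
  · obtain ⟨M, hM, hMb⟩ := exists_rpow_mul_exp_neg_le K hb
    have hc : ContinuousOn (fun x : ℝ => ‖v‖ ^ (-x)) (Icc σ₀ c₁) := by
      have : (0 : ℝ) < ‖v‖ := norm_pos_iff.2 hv0
      exact ((Real.continuous_const_rpow this.ne').comp continuous_neg).continuousOn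
    obtain ⟨V, hV⟩ := isCompact_Icc.exists_bound_of_continuousOn hc
    refine ⟨CΓ * CD * V * (M * Real.exp (θ - |arg v|)), fun s h1 h2 => (key s h1 h2).trans ?_⟩
    have e1 := (Real.le_norm_self _).trans (hV s.re ⟨h1, h2⟩)
    have e2 : (1 + |s.im|) ^ K * Real.exp (-(θ - |arg v|) * |s.im|) ≤
        M * Real.exp (θ - |arg v|) := by
      have := hMb (1 + |s.im|) (by linarith [abs_nonneg s.im])
      calc _ = (1 + |s.im|) ^ K * Real.exp (-(θ - |arg v|) * (1 + |s.im|)) *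
            Real.exp (θ - |arg v|) := by rw [mul_assoc, ← Real.exp_add]; ring_nf
        _ ≤ _ := by gcongr
    have hV0 : 0 ≤ V := (norm_nonneg _).trans (hV s.re ⟨h1, h2⟩)
    gcongr
  · intro x h1 h2
    refine ((integrable_one_add_abs_rpow_mul_exp K hb).const_mul (CΓ * CD * ‖v‖ ^ (-x))).mono' ?_
      (ae_of_all _ fun t => ?_)
    · refine Continuous.aestronglyMeasurable (continuous_iff_continuousAt.2 fun t => ?_)
      exact ContinuousAt.comp' (analyticAt_mellinG hadm hσ₀ hσs hk hv0
        (by simpa using h1)).continuousAt (by fun_prop)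
    · simpa using key (x + t * I) (by simpa using h1) (by simpa using h2)

/-- Writing 1/(s(s - s₀)) = (1/s₀)(1/(s - s₀) - 1/s) splits the Mellin integrand into two quotients
of `mellinG` with one simple pole each. The residue theorem from Re s = c + 1 to Re s = σ₀ yields
the term in v^{-s₀} and D_{h,k}(0). -/
theorem hasSum_twist_mul_exp_eq (hadm : Admissible a s₀ σ₀ c D A) (hs₀ : 0 < s₀) (hs₀c : s₀ < c)
    (hσ₀ : -1 < σ₀) (hσ₀' : σ₀ < 0) {h k : ℕ} (hk : 0 < k) {v : ℂ} (hv : 0 < v.re) :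
    HasSum (fun m : ℕ => twist a h k (m + 1) * exp (-(((m + 1 : ℕ) : ℂ) * v)))
      (Gamma (s₀ + 1) / s₀ * A h k * v ^ (-(s₀ : ℂ)) + D h k 0 + 1 / (2 * Real.pi * s₀) *
        ((∫ t : ℝ, mellinG s₀ D A h k v (σ₀ + t * I) / (σ₀ + t * I - (s₀ : ℝ))) -
          ∫ t : ℝ, mellinG s₀ D A h k v (σ₀ + t * I) / (σ₀ + t * I - (0 : ℝ)))) := by
  have hv0 : v ≠ 0 := by rintro rfl; simp at hv
  have hσs : σ₀ < s₀ := hσ₀'.trans hs₀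
  have hc1 : c < c + 1 := by linarith
  obtain ⟨⟨C, hC⟩, hi⟩ := integrable_mellinG hadm hσ₀ hs₀ hσs (h := h) hk hv (c + 1)
  have han : ∀ s : ℂ, σ₀ ≤ s.re → s.re ≤ c + 1 → AnalyticAt ℂ (mellinG s₀ D A h k v) s :=
    fun s hs _ => analyticAt_mellinG hadm hσ₀ hσs hk hv0 hs
  have r1 := integral_vertical_sub_integral_vertical (p := s₀) (b := c + 1) hσs (by linarith) han hC
    (hi _ le_rfl (by linarith)) (hi _ (by linarith) le_rfl)
  have r2 := integral_vertical_sub_integral_vertical (p := 0) (b := c + 1) hσ₀' (by linarith) han hC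
    (hi _ le_rfl (by linarith)) (hi _ (by linarith) le_rfl)
  have hs := hasSum_twist_mul_exp hadm (h := h) hk hc1 (by linarith) hv
  have hs0 : (s₀ : ℂ) ≠ 0 := by exact_mod_cast hs₀.ne'
  have hdivint : ∀ p : ℝ, p < c + 1 → Integrable fun t : ℝ =>
      mellinG s₀ D A h k v ((c + 1 : ℝ) + t * I) / ((c + 1 : ℝ) + t * I - p) := by
    intro p hp
    have hne : ∀ t : ℝ, ((c + 1 : ℝ) + t * I - p : ℂ) ≠ 0 := by
      intro t h
      have := congrArg re h
      simp at this
      linarith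
    have hcont : Continuous fun t : ℝ => ((c + 1 : ℝ) + t * I - p : ℂ)⁻¹ :=
      Continuous.inv₀ (by fun_prop) hne
    simp_rw [div_eq_mul_inv]
    refine (hi _ (by linarith) le_rfl).mul_bdd (c := |c + 1 - p|⁻¹) hcont.aestronglyMeasurable
      (ae_of_all _ fun t => ?_)
    rw [norm_inv]
    have : |c + 1 - p| ≤ ‖((c + 1 : ℝ) + t * I - p : ℂ)‖ := by
      simpa using abs_re_le_norm ((c + 1 : ℝ) + t * I - p : ℂ)
    have h0 : 0 < |c + 1 - p| := abs_pos.2 (by linarith)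
    gcongr
  have hint : ∫ t : ℝ, D h k ((c + 1 : ℝ) + t * I) * (Gamma ((c + 1 : ℝ) + t * I) *
      v ^ (-((c + 1 : ℝ) + t * I : ℂ))) = 1 / s₀ *
      ((∫ t : ℝ, mellinG s₀ D A h k v ((c + 1 : ℝ) + t * I) / ((c + 1 : ℝ) + t * I - (s₀ : ℝ))) -
      ∫ t : ℝ, mellinG s₀ D A h k v ((c + 1 : ℝ) + t * I) / ((c + 1 : ℝ) + t * I - (0 : ℝ))) := by
    rw [← integral_sub (hdivint s₀ (by linarith)) (hdivint 0 (by linarith)), ← integral_const_mul]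
    congr 1
    funext t
    set s : ℂ := (c + 1 : ℝ) + t * I with hsdef
    have hre : s.re = c + 1 := by simp [hsdef]
    have n1 : s ≠ 0 := by
      intro h0; rw [h0, zero_re] at hre; linarith
    have n2 : s - s₀ ≠ 0 := by
      intro h0
      have := congrArg re h0
      simp [hre] at this
      linarith
    rw [mellinG, regD_of_ne (sub_ne_zero.1 n2), Gamma_add_one s n1]
    push_cast
    field_simp
    ring
  rw [hint] at hs
  have hpi : (2 * Real.pi : ℂ) ≠ 0 := by simp [Real.pi_ne_zero]
  have h2 := hs.mul_left (1 / (2 * Real.pi : ℂ))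
  have e1 : ∀ m : ℕ, 1 / (2 * Real.pi : ℂ) * (2 * Real.pi * (twist a h k (m + 1) *
      exp (-(((m + 1 : ℕ) : ℂ) * v)))) = twist a h k (m + 1) * exp (-(((m + 1 : ℕ) : ℂ) * v)) := by
    intro m
    rw [← mul_assoc, one_div_mul_cancel hpi, one_mul]
  simp_rw [e1] at h2
  convert! h2 using 1
  have g1 : mellinG s₀ D A h k v s₀ = Gamma (s₀ + 1) * A h k * v ^ (-(s₀ : ℂ)) := by
    rw [mellinG, regD_self]
  have g2 : mellinG s₀ D A h k v (0 : ℝ) = -s₀ * D h k 0 := by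
    rw [mellinG, regD_of_ne (by simpa using hs0.symm)]
    simp
  rw [g1] at r1
  rw [g2] at r2
  rw [sub_eq_iff_eq_add.1 r1, sub_eq_iff_eq_add.1 r2]
  generalize (∫ t : ℝ, mellinG s₀ D A h k v (σ₀ + t * I) / (σ₀ + t * I - (s₀ : ℝ))) = J₁
  generalize (∫ t : ℝ, mellinG s₀ D A h k v (σ₀ + t * I) / (σ₀ + t * I - (0 : ℝ))) = J₂
  field_simp
  ring

/-- The expansion of the exponential generating function of the twisted coefficients at the
origin, with an error term which is uniform in sectors and polynomial in `k`. -/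
theorem exists_twist_expansion (hadm : Admissible a s₀ σ₀ c D A) (hs₀ : 0 < s₀) (hs₀c : s₀ < c)
    (hσ₀ : -1 < σ₀) (hσ₀' : σ₀ < 0) {θ₀ : ℝ} (hθ0 : 0 ≤ θ₀) (hθ₀ : θ₀ < Real.pi / 2) :
    ∃ C : ℝ, 0 < C ∧ ∀ h k : ℕ, 0 < k → ∀ v : ℂ, 0 < v.re → |arg v| ≤ θ₀ → ∃ E : ℂ,
      HasSum (fun m : ℕ => twist a h k (m + 1) * exp (-(((m + 1 : ℕ) : ℂ) * v)))
        (Gamma (s₀ + 1) / s₀ * A h k * v ^ (-(s₀ : ℂ)) + D h k 0 + E) ∧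
      ‖E‖ ≤ C * (k : ℝ) ^ (s₀ - σ₀) * ‖v‖ ^ (-σ₀) := by
  -- The margin θ - θ₀ gives a decay on the line Re s = σ₀ that is the same for all v of the sector.
  obtain ⟨θ, hθ1, hθ2⟩ := exists_between hθ₀
  obtain ⟨CΓ, hCΓ, hΓ⟩ := exists_norm_Gamma_le (σ₁ := 1 + σ₀) (σ₂ := 1 + σ₀) (by linarith)
    (hθ0.trans hθ1.le) hθ2
  obtain ⟨C₁, C₂, h1, h2, hb⟩ := hadm.bound
  have hσs : σ₀ < s₀ := hσ₀'.trans hs₀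
  have hbθ : 0 < θ - θ₀ := by linarith
  set T : ℝ := ∫ t : ℝ, (1 + |t|) ^ C₂ * Real.exp (-(θ - θ₀) * |t|) with hT
  have hT0 : 0 ≤ T := integral_nonneg fun t => by positivity
  have hTi := integrable_one_add_abs_rpow_mul_exp C₂ hbθ
  set Z : ℝ := 1 / (2 * Real.pi * s₀) * (|σ₀ - s₀|⁻¹ + |σ₀ - 0|⁻¹) * (CΓ * C₁ * T) with hZ
  have hZ0 : 0 ≤ Z := by positivity
  refine ⟨Z + 1, by positivity, fun h k hk v hv harg => ⟨_, hasSum_twist_mul_exp_eq hadm hs₀ hs₀c hσ₀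
    hσ₀' hk hv, ?_⟩⟩
  have hv0 : v ≠ 0 := by rintro rfl; simp at hv
  have hk' : (0 : ℝ) < k := by exact_mod_cast hk
  have hG : ∀ t : ℝ, ‖mellinG s₀ D A h k v (σ₀ + t * I)‖ ≤
      CΓ * (C₁ * (k : ℝ) ^ (s₀ - σ₀)) * ‖v‖ ^ (-σ₀) *
        ((1 + |t|) ^ C₂ * Real.exp (-(θ - θ₀) * |t|)) := by
    intro t
    have hne : (σ₀ + t * I : ℂ) ≠ s₀ := by
      intro h0
      have := congrArg re h0
      simp at this
      linarith
    have hDb : ‖regD s₀ D A h k (σ₀ + t * I)‖ ≤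
        C₁ * (k : ℝ) ^ (s₀ - σ₀) * (1 + |(σ₀ + t * I : ℂ).im|) ^ C₂ := by
      rw [regD_of_ne hne]
      refine (hb h k hk _ (by simp) (by simp; linarith)).trans (le_of_eq ?_)
      simp only [add_re, ofReal_re, mul_re, I_re, mul_zero, ofReal_im, I_im, mul_one, sub_self,
        add_zero, abs_of_neg hσ₀']
      ring_nf
    have := norm_mellinG_le (s₀ := s₀) (D := D) (A := A) (h := h) (k := k) hv0 hCΓ.le
      (by positivity) (hΓ (σ₀ + t * I + 1) (by simp; linarith) (by simp; linarith)) hDb harg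
    simpa using this
  have hI : ∀ p : ℝ, σ₀ < p → ‖∫ t : ℝ, mellinG s₀ D A h k v (σ₀ + t * I) / (σ₀ + t * I - p)‖ ≤
      |σ₀ - p|⁻¹ * (CΓ * C₁ * T) * ((k : ℝ) ^ (s₀ - σ₀) * ‖v‖ ^ (-σ₀)) := by
    intro p hp
    have h0 : 0 < |σ₀ - p| := abs_pos.2 (by linarith)
    refine (norm_integral_le_of_norm_le (hTi.const_mul
      (|σ₀ - p|⁻¹ * (CΓ * (C₁ * (k : ℝ) ^ (s₀ - σ₀)) * ‖v‖ ^ (-σ₀))))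
      (ae_of_all _ fun t => ?_)).trans (le_of_eq ?_)
    · have : |σ₀ - p| ≤ ‖(σ₀ + t * I - p : ℂ)‖ := by
        simpa using abs_re_le_norm (σ₀ + t * I - p : ℂ)
      rw [norm_div, div_eq_mul_inv, mul_comm, mul_assoc]
      gcongr
      exact hG t
    · rw [integral_const_mul, ← hT]
      ring
  have hkv : 0 ≤ (k : ℝ) ^ (s₀ - σ₀) * ‖v‖ ^ (-σ₀) := by positivity
  rw [norm_mul]
  have e1 : ‖(1 / (2 * Real.pi * s₀) : ℂ)‖ = 1 / (2 * Real.pi * s₀) := by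
    have : (1 / (2 * Real.pi * s₀) : ℂ) = ((1 / (2 * Real.pi * s₀) : ℝ) : ℂ) := by push_cast; ring
    rw [this, norm_real, Real.norm_of_nonneg (by positivity)]
  rw [e1]
  calc _ ≤ 1 / (2 * Real.pi * s₀) * (|σ₀ - s₀|⁻¹ * (CΓ * C₁ * T) *
        ((k : ℝ) ^ (s₀ - σ₀) * ‖v‖ ^ (-σ₀)) + |σ₀ - 0|⁻¹ * (CΓ * C₁ * T) *
        ((k : ℝ) ^ (s₀ - σ₀) * ‖v‖ ^ (-σ₀))) := by
        gcongr
        exact (norm_sub_le _ _).trans (add_le_add (hI s₀ hσs) (hI 0 hσ₀'))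
    _ = Z * ((k : ℝ) ^ (s₀ - σ₀) * ‖v‖ ^ (-σ₀)) := by rw [hZ]; ring
    _ ≤ (Z + 1) * ((k : ℝ) ^ (s₀ - σ₀) * ‖v‖ ^ (-σ₀)) := by gcongr; linarith
    _ = _ := by ring

end
end PolyMeinardus
end

noncomputable section
namespace PolyMeinardus
open MeasureTheory Complex Set

section
variable {a : ℕ → ℝ} {s₀ σ₀ c : ℝ} {D : ℕ → ℕ → ℂ → ℂ} {A : ℕ → ℕ → ℂ}

/-! ### The logarithm of the generating function -/

theorem hasSum_of_forall_eq {f g : ℕ → ℂ} {s : ℂ} (h : ∀ n, f n = g n) (hg : HasSum g s) :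
    HasSum f s := by rwa [funext h]

/-- Convergence of the Dirichlet series at c + 1 makes a_m of polynomial growth. -/
theorem summable_abs_mul_pow (hadm : Admissible a s₀ σ₀ c D A) {ρ : ℝ} (hρ0 : 0 ≤ ρ) (hρ : ρ < 1) :
    Summable fun m : ℕ => |a (m + 1)| * ρ ^ (m + 1) := by
  obtain ⟨C, hC⟩ := (hadm.summable 0 1 one_pos ((c + 1 : ℝ) : ℂ) (by simp)).le_const_mul_rpow
  set K : ℕ := ⌈c + 1⌉₊ with hK
  have hsum : Summable fun n : ℕ => C * ((n : ℝ) ^ K * ρ ^ n) :=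
    (summable_pow_mul_geometric_of_norm_lt_one K
      (by rwa [Real.norm_of_nonneg hρ0])).mul_left C
  refine Summable.of_nonneg_of_le (fun m => by positivity) (fun m => ?_)
    ((summable_nat_add_iff 1).2 hsum)
  have h1 := hC (m + 1) m.succ_ne_zero
  rw [norm_twist, ofReal_re] at h1
  have hC0 : 0 ≤ C := by
    by_contra! hneg
    have : C * ((m + 1 : ℕ) : ℝ) ^ (c + 1) < 0 := mul_neg_of_neg_of_pos hneg (by positivity)
    linarith [abs_nonneg (a (m + 1))]
  have h2 : ((m + 1 : ℕ) : ℝ) ^ (c + 1) ≤ ((m + 1 : ℕ) : ℝ) ^ K := by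
    rw [← Real.rpow_natCast]
    exact Real.rpow_le_rpow_of_exponent_le (by push_cast; linarith [(m.cast_nonneg : (0 : ℝ) ≤ m)])
      (Nat.le_ceil _)
  calc |a (m + 1)| * ρ ^ (m + 1) ≤ C * ((m + 1 : ℕ) : ℝ) ^ K * ρ ^ (m + 1) := by
        gcongr
        exact h1.trans (by gcongr)
    _ = _ := by ring

theorem summable_log_terms (hadm : Admissible a s₀ σ₀ c D A) {z q : ℂ} (hz : ‖z‖ < 1)
    (hq : ‖q‖ < 1) : Summable fun p : ℕ × ℕ =>
      (a (p.1 + 1) : ℂ) * ((z * q ^ (p.1 + 1)) ^ (p.2 + 1) / ((p.2 : ℂ) + 1)) := by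
  have h1 := summable_abs_mul_pow hadm (norm_nonneg q) hq
  have h2 : Summable fun l : ℕ => ‖z‖ ^ l := summable_geometric_of_lt_one (norm_nonneg z) hz
  refine Summable.of_norm_bounded (h1.mul_of_nonneg h2 (fun m => by positivity)
    (fun l => by positivity)) fun p => ?_
  have e1 : (1 : ℝ) ≤ ‖((p.2 : ℂ) + 1)‖ := by
    have : ((p.2 : ℂ) + 1) = ((p.2 + 1 : ℕ) : ℂ) := by push_cast; ring
    rw [this, Complex.norm_natCast]
    exact_mod_cast Nat.le_add_left 1 p.2
  rw [norm_mul, norm_real, Real.norm_eq_abs, norm_div, norm_pow, norm_mul, norm_pow, mul_assoc]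
  apply mul_le_mul_of_nonneg_left _ (abs_nonneg _)
  refine (div_le_self (by positivity) e1).trans ?_
  rw [mul_pow, mul_comm]
  have e2 : (‖q‖ ^ (p.1 + 1)) ^ (p.2 + 1) ≤ ‖q‖ ^ (p.1 + 1) :=
    pow_le_of_le_one (by positivity) (pow_le_one₀ (norm_nonneg _) hq.le) p.2.succ_ne_zero
  have e3 : ‖z‖ ^ (p.2 + 1) ≤ ‖z‖ ^ p.2 := pow_le_pow_of_le_one (norm_nonneg _) hz.le (Nat.le_succ _)
  gcongr

theorem one_sub_ne_zero_of_norm_lt {x : ℂ} (hx : ‖x‖ < 1) : 1 - x ≠ 0 := by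
  intro h
  rw [← sub_eq_zero.1 h, norm_one] at hx
  exact lt_irrefl _ hx

theorem P_eq_exp (hadm : Admissible a s₀ σ₀ c D A) {z q : ℂ} (hz : ‖z‖ < 1) (hq : ‖q‖ < 1) :
    P a z q = exp (∑' p : ℕ × ℕ,
      (a (p.1 + 1) : ℂ) * ((z * q ^ (p.1 + 1)) ^ (p.2 + 1) / ((p.2 : ℂ) + 1))) := by
  have hs := (summable_log_terms hadm hz hq).hasSum
  have hx : ∀ m : ℕ, ‖z * q ^ (m + 1)‖ < 1 := by
    intro m
    rw [norm_mul, norm_pow]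
    have : ‖q‖ ^ (m + 1) ≤ 1 := pow_le_one₀ (norm_nonneg _) hq.le
    nlinarith [norm_nonneg z]
  have hrow : ∀ m : ℕ, HasSum (fun l : ℕ =>
      (a (m + 1) : ℂ) * ((z * q ^ (m + 1)) ^ (l + 1) / ((l : ℂ) + 1)))
      (log (1 - z * q ^ (m + 1)) * (-(a (m + 1) : ℂ))) := by
    intro m
    have := (hasSum_taylorSeries_neg_log' (hx m)).mul_left (a (m + 1) : ℂ)
    convert! this using 1
    ring
  have hsum := hs.prod_fiberwise hrow
  have hprod : HasProd (fun m : ℕ => (1 - z * q ^ (m + 1)) ^ (-(a (m + 1) : ℂ))) (exp (∑' p : ℕ × ℕ,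
      (a (p.1 + 1) : ℂ) * ((z * q ^ (p.1 + 1)) ^ (p.2 + 1) / ((p.2 : ℂ) + 1)))) := by
    have h1 := (continuous_exp.tendsto _).comp hsum
    refine h1.congr fun s => ?_
    rw [Function.comp, exp_sum]
    refine Finset.prod_congr rfl fun m _ => ?_
    simp only [cpow_def_of_ne_zero (one_sub_ne_zero_of_norm_lt (hx m))]
  exact hprod.tprod_eq

theorem summable_Li (s : ℝ) (hs : 0 ≤ s) {z : ℂ} (hz : ‖z‖ < 1) :
    Summable fun l : ℕ => z ^ (l + 1) / ((((l + 1 : ℕ) : ℝ) ^ s : ℝ) : ℂ) := by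
  refine Summable.of_norm_bounded ((summable_nat_add_iff 1).2
    (summable_geometric_of_lt_one (norm_nonneg z) hz)) fun l => ?_
  rw [norm_div, norm_pow, norm_real]
  refine div_le_self (by positivity) ?_
  rw [Real.norm_of_nonneg (by positivity)]
  exact Real.one_le_rpow (by push_cast; linarith [(l.cast_nonneg : (0 : ℝ) ≤ l)]) hs

theorem norm_e_mul_lt {x : ℝ} {z : ℂ} (hz : ‖z‖ < 1) : ‖e x * z‖ < 1 := by
  rwa [norm_mul, norm_e, one_mul]

theorem e_mul_div_pow (h j k l : ℕ) : e ((h : ℝ) * j / k) ^ l = e (((h * l : ℕ) : ℝ) * j / k) := by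
  rw [← e_nat_mul]
  congr 1
  push_cast
  ring

/-- Expanding the polylogarithms and exchanging the sums over j and l undoes the Fourier expansion:
the coefficient of z^l contains the residue of index hl. This is the form in which the residues at
s₀ appear in log P. -/
theorem hasSum_Phi (hadm : Admissible a s₀ σ₀ c D A) (hs₀ : 0 < s₀) (hs₀c : s₀ < c)
    (hσ₀' : σ₀ < 0) {h k : ℕ} (hk : 0 < k) {z : ℂ} (hz : ‖z‖ < 1) :
    HasSum (fun l : ℕ => Gamma (s₀ + 1) * (A (h * (l + 1)) k *
      (z ^ (l + 1) / ((((l + 1 : ℕ) : ℝ) ^ (s₀ + 1) : ℝ) : ℂ)))) (Phi s₀ A h k z) := by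
  have h1 : HasSum (fun l : ℕ => ∑ j ∈ Finset.range k, fourierCoeff k (fun h' => A h' k) j *
      ((e ((h : ℝ) * j / k) * z) ^ (l + 1) / ((((l + 1 : ℕ) : ℝ) ^ (s₀ + 1) : ℝ) : ℂ)))
      (∑ j ∈ Finset.range k, fourierCoeff k (fun h' => A h' k) j *
        Li (s₀ + 1) (e ((h : ℝ) * (j : ℝ) / (k : ℝ)) * z)) :=
    hasSum_sum fun j _ => ((summable_Li (s₀ + 1) (by linarith) (norm_e_mul_lt hz)).hasSum).mul_left _
  have h2 := h1.mul_left (Real.Gamma (s₀ + 1) : ℂ)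
  have e0 : (Real.Gamma (s₀ + 1) : ℂ) = Gamma (s₀ + 1) := by
    rw [← Gamma_ofReal]; push_cast; rfl
  rw [Phi]
  refine hasSum_of_forall_eq (fun l => ?_) h2
  rw [e0]
  congr 1
  rw [← sum_fourierCoeff hk (F := fun h' => A h' k)
    (fun h' => A_mod hadm (hσ₀'.trans hs₀) hs₀c hk h'), Finset.sum_mul]
  refine Finset.sum_congr rfl fun j _ => ?_
  rw [mul_pow, e_mul_div_pow]
  ring

theorem hasSum_log_omega (hadm : Admissible a s₀ σ₀ c D A) (hs₀ : 0 < s₀) (hs₀c : s₀ < c)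
    (hσ₀' : σ₀ < 0) {h k : ℕ} (hk : 0 < k) {z : ℂ} (hz : ‖z‖ < 1) :
    HasSum (fun l : ℕ => D (h * (l + 1)) k 0 * (z ^ (l + 1) / ((l : ℂ) + 1)))
      (∑ j ∈ Finset.range k, fourierCoeff k (fun h' => D h' k 0) j *
        (-log (1 - e ((h : ℝ) * (j : ℝ) / (k : ℝ)) * z))) := by
  have h1 : HasSum (fun l : ℕ => ∑ j ∈ Finset.range k, fourierCoeff k (fun h' => D h' k 0) j *
      ((e ((h : ℝ) * j / k) * z) ^ (l + 1) / ((l : ℂ) + 1)))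
      (∑ j ∈ Finset.range k, fourierCoeff k (fun h' => D h' k 0) j *
        (-log (1 - e ((h : ℝ) * (j : ℝ) / (k : ℝ)) * z))) :=
    hasSum_sum fun j _ => (hasSum_taylorSeries_neg_log' (norm_e_mul_lt hz)).mul_left _
  convert! h1 using 2 with l
  rw [← sum_fourierCoeff hk (F := fun h' => D h' k 0)
    (fun h' => D_zero_mod hadm hs₀ hσ₀' hs₀c hk h'), Finset.sum_mul]
  refine Finset.sum_congr rfl fun j _ => ?_
  rw [mul_pow, e_mul_div_pow]
  ring

theorem omega_eq (D : ℕ → ℕ → ℂ → ℂ) (h k n : ℕ) (z : ℂ) :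
    omega D h k n z = e (-((h : ℝ) * n / k)) * omega D h k 0 z := by
  have : e (-((h : ℝ) * ((0 : ℕ) : ℝ) / k)) = 1 := by
    simpa using e_intCast 0
  rw [omega, omega, this, one_mul]

theorem omega_zero_eq_exp {h k : ℕ} {z : ℂ} (hz : ‖z‖ < 1) :
    omega D h k 0 z = exp (∑ j ∈ Finset.range k, fourierCoeff k (fun h' => D h' k 0) j *
        (-log (1 - e ((h : ℝ) * (j : ℝ) / (k : ℝ)) * z))) := by
  have : e (-((h : ℝ) * ((0 : ℕ) : ℝ) / k)) = 1 := by
    simpa using e_intCast 0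
  rw [omega, this, one_mul, exp_sum]
  refine Finset.prod_congr rfl fun j _ => ?_
  rw [cpow_def_of_ne_zero (one_sub_ne_zero_of_norm_lt (norm_e_mul_lt hz))]
  congr 1
  ring

theorem norm_pow_div_le {r : ℝ} {z : ℂ} (hz : ‖z‖ ≤ r) (hr : r ≤ 1) (l : ℕ) :
    ‖z ^ (l + 1) / ((l : ℂ) + 1)‖ ≤ r ^ l / (l + 1) := by
  have : ((l : ℂ) + 1) = ((l + 1 : ℕ) : ℂ) := by push_cast; ring
  have hr0 : 0 ≤ r := (norm_nonneg z).trans hz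
  rw [norm_div, norm_pow, this, Complex.norm_natCast]
  push_cast
  gcongr
  calc ‖z‖ ^ (l + 1) ≤ r ^ (l + 1) := by gcongr
    _ ≤ r ^ l := pow_le_pow_of_le_one hr0 hr (Nat.le_succ _)

/-- The multiplier `ω_{h,k,0}` is the exponential of a quantity of size `k^{s₀}`. -/
theorem exists_norm_log_omega_le (hadm : Admissible a s₀ σ₀ c D A) (hs₀ : 0 < s₀) (hs₀c : s₀ < c)
    (hσ₀' : σ₀ < 0) {r : ℝ} (hr : r < 1) :
    ∃ C : ℝ, 0 < C ∧ ∀ h k : ℕ, 0 < k → ∀ z : ℂ, ‖z‖ ≤ r →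
      ∃ W : ℂ, omega D h k 0 z = exp W ∧ ‖W‖ ≤ C * (k : ℝ) ^ s₀ := by
  obtain ⟨C, hC, hD⟩ := exists_norm_D_zero_le hadm hs₀ hσ₀' hs₀c
  refine ⟨C * (1 - r)⁻¹, mul_pos hC (inv_pos.2 (by linarith)), fun h k hk z hz => ?_⟩
  have hz1 : ‖z‖ < 1 := hz.trans_lt hr
  have hr0 : 0 ≤ r := (norm_nonneg z).trans hz
  refine ⟨_, omega_zero_eq_exp hz1, ?_⟩
  refine ((hasSum_log_omega hadm hs₀ hs₀c hσ₀' hk hz1).norm_le_of_bounded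
    ((hasSum_geometric_of_lt_one hr0 hr).mul_left (C * (k : ℝ) ^ s₀)) fun l => ?_).trans (le_of_eq (by ring))
  rw [norm_mul]
  have h1 := norm_pow_div_le hz hr.le l
  have h2 : r ^ l / ((l : ℝ) + 1) ≤ r ^ l :=
    div_le_self (by positivity) (by linarith [(l.cast_nonneg : (0 : ℝ) ≤ l)])
  exact mul_le_mul (hD _ k hk) (h1.trans h2) (norm_nonneg _) (by positivity)

theorem natCast_add_one_mul_cpow {w : ℂ} (hw : w ≠ 0) (l : ℕ) (s : ℝ) :
    (((l : ℂ) + 1) * w) ^ (-(s : ℂ)) = ((((l + 1 : ℕ) : ℝ) ^ s : ℝ) : ℂ)⁻¹ * (w ^ (s : ℂ))⁻¹ := by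
  have h1 : ((l : ℂ) + 1) = (((l + 1 : ℕ) : ℝ) : ℂ) := by push_cast; ring
  rw [h1, ofReal_mul_cpow (by positivity) hw, cpow_neg, cpow_neg, ofReal_cpow (by positivity)]

/-- The expansion of `P(z, e^{-τ})` near the root of unity `e(h/k)`. -/
theorem exists_P_expansion (hadm : Admissible a s₀ σ₀ c D A) (hs₀ : 0 < s₀) (hs₀c : s₀ < c)
    (hσ₀ : -1 < σ₀) (hσ₀' : σ₀ < 0) {r θ₀ : ℝ} (hr : r < 1) (hθ0 : 0 ≤ θ₀)
    (hθ₀ : θ₀ < Real.pi / 2) :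
    ∃ C : ℝ, 0 < C ∧ ∀ h k : ℕ, 0 < k → ∀ z : ℂ, ‖z‖ ≤ r → ∀ w : ℂ, 0 < w.re → |arg w| ≤ θ₀ →
      ∃ E : ℂ, P a z (exp (-w) * e ((h : ℝ) / k)) =
        exp (Phi s₀ A h k z / (s₀ * w ^ (s₀ : ℂ))) * omega D h k 0 z * exp E ∧
        ‖E‖ ≤ C * (k : ℝ) ^ (s₀ - σ₀) * ‖w‖ ^ (-σ₀) := by
  obtain ⟨C, hC, hT⟩ := exists_twist_expansion hadm hs₀ hs₀c hσ₀ hσ₀' hθ0 hθ₀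
  refine ⟨C * (1 - r)⁻¹, mul_pos hC (inv_pos.2 (by linarith)), fun h k hk z hz w hw harg => ?_⟩
  have hz1 : ‖z‖ < 1 := hz.trans_lt hr
  have hr0 : 0 ≤ r := (norm_nonneg z).trans hz
  have hw0 : w ≠ 0 := by rintro rfl; simp at hw
  set q : ℂ := exp (-w) * e ((h : ℝ) / k) with hq
  have hq1 : ‖q‖ < 1 := by
    rw [hq, norm_mul, norm_e, mul_one, norm_exp, Real.exp_lt_one_iff]
    simpa using hw
  have hl : ∀ l : ℕ, 0 < (((l : ℂ) + 1) * w).re ∧ |arg (((l : ℂ) + 1) * w)| ≤ θ₀ := by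
    intro l
    have h1 : ((l : ℂ) + 1) = (((l + 1 : ℕ) : ℝ) : ℂ) := by push_cast; ring
    rw [h1, arg_real_mul _ (by positivity), re_ofReal_mul]
    exact ⟨by positivity, harg⟩
  -- The l-th power of z comes with the twist hl and the point v = lw, which has the same argument
  -- as w. The denominator k stays the same for all l.
  choose E hE hEn using fun l : ℕ => hT (h * (l + 1)) k hk _ (hl l).1 (hl l).2
  have hsum := ((Equiv.prodComm ℕ ℕ).hasSum_iff.2 (summable_log_terms hadm hz1 hq1).hasSum)
  have hcol : HasSum (fun l : ℕ => z ^ (l + 1) / ((l : ℂ) + 1) *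
      (Gamma (s₀ + 1) / s₀ * A (h * (l + 1)) k * (((l : ℂ) + 1) * w) ^ (-(s₀ : ℂ)) +
        D (h * (l + 1)) k 0 + E l)) (∑' p : ℕ × ℕ,
      (a (p.1 + 1) : ℂ) * ((z * q ^ (p.1 + 1)) ^ (p.2 + 1) / ((p.2 : ℂ) + 1))) := by
    refine HasSum.prod_fiberwise hsum fun l => ?_
    refine hasSum_of_forall_eq (fun m => ?_) ((hE l).mul_left (z ^ (l + 1) / ((l : ℂ) + 1)))
    have hqpow : (q ^ (m + 1)) ^ (l + 1) = e (((h * (l + 1) : ℕ) : ℝ) * ((m + 1 : ℕ) : ℝ) / k) *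
        exp (-(((m + 1 : ℕ) : ℂ) * (((l : ℂ) + 1) * w))) := by
      rw [hq, ← pow_mul, mul_pow, ← exp_nat_mul, ← e_nat_mul, mul_comm]
      congr 2
      · push_cast; ring
      · push_cast; ring
    simp only [Function.comp, Equiv.prodComm_apply, Prod.swap]
    rw [mul_pow, hqpow, twist]
    ring
  have h1 : HasSum (fun l : ℕ => z ^ (l + 1) / ((l : ℂ) + 1) *
      (Gamma (s₀ + 1) / s₀ * A (h * (l + 1)) k * (((l : ℂ) + 1) * w) ^ (-(s₀ : ℂ))))
      (Phi s₀ A h k z / (s₀ * w ^ (s₀ : ℂ))) := by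
    have := (hasSum_Phi hadm hs₀ hs₀c hσ₀' (h := h) hk hz1).div_const (s₀ * w ^ (s₀ : ℂ))
    refine hasSum_of_forall_eq (fun l => ?_) this
    have e1 : ((((l + 1 : ℕ) : ℝ) ^ (s₀ + 1) : ℝ) : ℂ) =
        ((((l + 1 : ℕ) : ℝ) ^ s₀ : ℝ) : ℂ) * ((l : ℂ) + 1) := by
      rw [Real.rpow_add_one (by positivity)]
      push_cast
      ring
    rw [natCast_add_one_mul_cpow hw0, e1]
    have hs0 : (s₀ : ℂ) ≠ 0 := by exact_mod_cast hs₀.ne'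
    field_simp
  have h2 := hasSum_log_omega hadm hs₀ hs₀c hσ₀' (h := h) hk hz1
  have h3 := (hcol.sub h1).sub h2
  refine ⟨_, ?_, h3.norm_le_of_bounded ((hasSum_geometric_of_lt_one hr0 hr).mul_left
    (C * (k : ℝ) ^ (s₀ - σ₀) * ‖w‖ ^ (-σ₀))) (fun l => ?_) |>.trans (le_of_eq (by ring))⟩
  · rw [P_eq_exp hadm hz1 hq1, omega_zero_eq_exp hz1, ← exp_add, ← exp_add]
    congr 1
    ring
  · have e1 : z ^ (l + 1) / ((l : ℂ) + 1) * (Gamma (s₀ + 1) / s₀ * A (h * (l + 1)) k *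
          (((l : ℂ) + 1) * w) ^ (-(s₀ : ℂ)) + D (h * (l + 1)) k 0 + E l) -
        z ^ (l + 1) / ((l : ℂ) + 1) * (Gamma (s₀ + 1) / s₀ * A (h * (l + 1)) k *
          (((l : ℂ) + 1) * w) ^ (-(s₀ : ℂ))) - D (h * (l + 1)) k 0 * (z ^ (l + 1) / ((l : ℂ) + 1)) =
        z ^ (l + 1) / ((l : ℂ) + 1) * E l := by ring
    rw [e1, norm_mul]
    -- Since -σ₀ < 1, the factor (l + 1)^{-σ₀} is absorbed by the denominator of z^{l+1}/(l + 1),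
    -- and a geometric series remains.
    have e2 : ‖((l : ℂ) + 1) * w‖ ^ (-σ₀) ≤ ((l : ℝ) + 1) * ‖w‖ ^ (-σ₀) := by
      have : ((l : ℂ) + 1) = ((l + 1 : ℕ) : ℂ) := by push_cast; ring
      rw [norm_mul, this, Complex.norm_natCast, Real.mul_rpow (by positivity) (by positivity)]
      push_cast
      gcongr
      nth_rewrite 2 [← Real.rpow_one ((l : ℝ) + 1)]
      exact Real.rpow_le_rpow_of_exponent_le (by linarith [(l.cast_nonneg : (0 : ℝ) ≤ l)])
        (by linarith)
    calc _ ≤ r ^ l / ((l : ℝ) + 1) * (C * (k : ℝ) ^ (s₀ - σ₀) * (((l : ℝ) + 1) * ‖w‖ ^ (-σ₀))) := by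
          gcongr
          · exact norm_pow_div_le hz hr.le l
          · exact (hEn l).trans (by gcongr)
      _ = _ := by field_simp

end
end PolyMeinardus
end

noncomputable section
namespace PolyMeinardus
open MeasureTheory Complex Set

/-! ### An inequality for the saddle point -/

/-- The weighted geometric mean of the two cosines is at most their arithmetic mean, which by
concavity is at most the cosine of the weighted mean angle. Strict concavity gives strictness. -/
theorem cos_rpow_mul_cos_le {s θ y : ℝ} (hs : 0 < s) (hθ : |θ| < Real.pi / 2)
    (hy : |y| < Real.pi / 2) :
    Real.cos θ ^ s * Real.cos y ≤ Real.cos ((s * θ + y) / (s + 1)) ^ (s + 1) ∧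
    (θ ≠ y → Real.cos θ ^ s * Real.cos y < Real.cos ((s * θ + y) / (s + 1)) ^ (s + 1)) := by
  rw [abs_lt] at hθ hy
  have h1 : 0 < s + 1 := by linarith
  have cθ : 0 < Real.cos θ := Real.cos_pos_of_mem_Ioo hθ
  have cy : 0 < Real.cos y := Real.cos_pos_of_mem_Ioo hy
  have hw1 : 0 < s / (s + 1) := by positivity
  have hw2 : 0 < 1 / (s + 1) := by positivity
  have hw : s / (s + 1) + 1 / (s + 1) = 1 := by field_simp
  have hamgm := Real.geom_mean_le_arith_mean2_weighted hw1.le hw2.le cθ.le cy.le hw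
  have hmid : (s * θ + y) / (s + 1) = (s / (s + 1)) • θ + (1 / (s + 1)) • y := by
    simp only [smul_eq_mul]; field_simp
  have hconc := strictConcaveOn_cos_Icc.concaveOn.2 ⟨hθ.1.le, hθ.2.le⟩ ⟨hy.1.le, hy.2.le⟩ hw1.le
    hw2.le hw
  have hpow : Real.cos θ ^ s * Real.cos y =
      (Real.cos θ ^ (s / (s + 1)) * Real.cos y ^ (1 / (s + 1))) ^ (s + 1) := by
    rw [Real.mul_rpow (by positivity) (by positivity), ← Real.rpow_mul cθ.le, ← Real.rpow_mul cy.le,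
      div_mul_cancel₀ _ h1.ne', div_mul_cancel₀ _ h1.ne', Real.rpow_one]
  have hpos : 0 < Real.cos θ ^ (s / (s + 1)) * Real.cos y ^ (1 / (s + 1)) := by positivity
  rw [hpow, hmid]
  simp only [smul_eq_mul] at hconc ⊢
  refine ⟨Real.rpow_le_rpow hpos.le (hamgm.trans hconc) h1.le, fun hne => ?_⟩
  have hst := strictConcaveOn_cos_Icc.2 ⟨hθ.1.le, hθ.2.le⟩ ⟨hy.1.le, hy.2.le⟩ hne hw1 hw2 hw
  exact Real.rpow_lt_rpow hpos.le (hamgm.trans_lt hst) h1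

theorem exists_cos_eq_of_cos_pos {x : ℝ} (hx : 0 < Real.cos x) :
    ∃ (y : ℝ) (m : ℤ), |y| < Real.pi / 2 ∧ Real.cos y = Real.cos x ∧ y = x - m * (2 * Real.pi) := by
  set y := toIocMod Real.two_pi_pos (-Real.pi) x with hy
  have hmem := toIocMod_mem_Ioc Real.two_pi_pos (-Real.pi) x
  have hyx : y = x - toIocDiv Real.two_pi_pos (-Real.pi) x * (2 * Real.pi) := by
    rw [hy, toIocMod, zsmul_eq_mul]
  have hcos : Real.cos y = Real.cos x := by rw [hyx, Real.cos_sub_int_mul_two_pi]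
  refine ⟨y, _, ?_, hcos, hyx⟩
  by_contra! hc
  have h1 : |y| ≤ Real.pi := abs_le.2 ⟨hmem.1.le, by have := hmem.2; linarith⟩
  have := Real.cos_nonpos_of_pi_div_two_le_of_le hc (by linarith [Real.pi_pos])
  rw [Real.cos_abs, hcos] at this
  linarith

/-- Here θ is the argument of the variable and β that of the principal root. If y is the reduction
of (s+1)β - sθ modulo 2π, the weighted mean of θ and y is β - 2πm/(s+1), the argument of some root,
and the principal root has the smallest argument in modulus. Besides θ = β, equality may occur at θ
= -β when |β| = π/(s+1), where two roots are equally close to the positive axis. -/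
theorem cos_rpow_mul_cos_sub_le {s θ β : ℝ} (hs : 0 < s) (hθ : |θ| < Real.pi / 2)
    (hβ : |β| ≤ Real.pi / (s + 1)) :
    Real.cos θ ^ s * Real.cos ((s + 1) * β - s * θ) ≤ max (Real.cos β) 0 ^ (s + 1) ∧
    (0 < Real.cos β → θ ≠ β → (θ = -β → |β| < Real.pi / (s + 1)) →
      Real.cos θ ^ s * Real.cos ((s + 1) * β - s * θ) < Real.cos β ^ (s + 1)) := by
  have h1 : 0 < s + 1 := by linarith
  have cθ : 0 < Real.cos θ := Real.cos_pos_of_mem_Ioo (abs_lt.1 hθ)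
  rcases le_or_gt (Real.cos ((s + 1) * β - s * θ)) 0 with hneg | hpos
  · have h2 : Real.cos θ ^ s * Real.cos ((s + 1) * β - s * θ) ≤ 0 :=
      mul_nonpos_of_nonneg_of_nonpos (by positivity) hneg
    exact ⟨h2.trans (by positivity), fun h3 _ _ => h2.trans_lt (by positivity)⟩
  · obtain ⟨y, m, hy, hcos, hym⟩ := exists_cos_eq_of_cos_pos hpos
    rw [← hcos]
    obtain ⟨k1, k2⟩ := cos_rpow_mul_cos_le hs hθ hy
    set β' := (s * θ + y) / (s + 1) with hβ'
    have e1 : β' = β - m * (2 * Real.pi / (s + 1)) := by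
      rw [hβ', hym]; field_simp; ring
    have hβ'2 : |β'| < Real.pi / 2 := by
      rw [abs_lt] at hθ hy ⊢
      rw [hβ', lt_div_iff₀ h1, div_lt_iff₀ h1]
      constructor <;> nlinarith
    have hδ : 0 < Real.pi / (s + 1) := by positivity
    have hle : |β| ≤ |β'| ∧ (m ≠ 0 → |β| = |β'| → |β| = Real.pi / (s + 1)) := by
      rcases eq_or_ne m 0 with hm | hm
      · rw [e1, hm]; simp
      -- A nonzero m shifts by at least 2π/(s+1), while |β| is at most half of that.
      · have : Real.pi / (s + 1) ≤ |β'| := by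
          have h3 : (1 : ℝ) ≤ |(m : ℝ)| := by exact_mod_cast Int.one_le_abs hm
          have h4 : |(m : ℝ) * (2 * Real.pi / (s + 1))| ≤ |β| + |β'| := by
            have : (m : ℝ) * (2 * Real.pi / (s + 1)) = β - β' := by rw [e1]; ring
            rw [this]; exact abs_sub _ _
          rw [abs_mul, abs_of_pos (show 0 < 2 * Real.pi / (s + 1) by positivity), mul_div_assoc] at h4
          nlinarith
        exact ⟨hβ.trans this, fun _ he => le_antisymm hβ (he ▸ this)⟩
    have hcosle : Real.cos β' ≤ Real.cos β := by
      rw [← Real.cos_abs β', ← Real.cos_abs β]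
      exact Real.cos_le_cos_of_nonneg_of_le_pi (abs_nonneg _) (by linarith [Real.pi_pos]) hle.1
    have hcos'pos : 0 < Real.cos β' := Real.cos_pos_of_mem_Ioo (abs_lt.1 hβ'2)
    constructor
    · exact k1.trans (Real.rpow_le_rpow hcos'pos.le (hcosle.trans (le_max_left _ _)) h1.le)
    · intro _ hne hneg
      rcases eq_or_ne θ y with heq | hney
      · have hθβ' : θ = β' := by rw [hβ', ← heq]; field_simp
        have hm : m ≠ 0 := by
          rintro rfl
          apply hne
          rw [hθβ', e1]; simp
        have hlt : |β| < |β'| := by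
          refine lt_of_le_of_ne hle.1 fun he => ?_
          have h5 := hle.2 hm he
          rw [← hθβ'] at he
          rcases abs_eq_abs.1 he with h6 | h6
          · exact hne h6.symm
          · exact absurd h5 (hneg (by linarith)).ne
        refine k1.trans_lt (Real.rpow_lt_rpow hcos'pos.le ?_ h1)
        rw [← Real.cos_abs β', ← Real.cos_abs β]
        exact Real.cos_lt_cos_of_nonneg_of_le_pi (abs_nonneg _) (by linarith [Real.pi_pos]) hlt
      · exact (k2 hney).trans_le (Real.rpow_le_rpow hcos'pos.le hcosle h1.le)

/-! ### The principal root -/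

/-- The principal `(s+1)`-th root. -/
def rt (s : ℝ) (Φ : ℂ) : ℂ := Φ ^ ((1 / (s + 1) : ℝ) : ℂ)

theorem L_eq_rt (s₀ : ℝ) (A : ℕ → ℕ → ℂ) (h k : ℕ) (z : ℂ) :
    L s₀ A h k z = rt s₀ (Phi s₀ A h k z) := rfl

theorem cpow_ofReal_eq {w : ℂ} (hw : w ≠ 0) (s : ℝ) :
    w ^ (s : ℂ) = ((‖w‖ ^ s : ℝ) : ℂ) * exp ((s * arg w : ℝ) * I) := by
  have h0 : 0 < ‖w‖ := norm_pos_iff.2 hw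
  rw [cpow_def_of_ne_zero hw, log, Real.rpow_def_of_pos h0, ofReal_exp, ← exp_add]
  congr 1
  push_cast
  ring

theorem rt_zero {s : ℝ} (hs : 0 < s) : rt s 0 = 0 := by
  rw [rt, zero_cpow]
  have : (1 / (s + 1) : ℝ) ≠ 0 := by positivity
  exact_mod_cast this

theorem norm_rt {s : ℝ} (hs : 0 < s) (Φ : ℂ) : ‖rt s Φ‖ = ‖Φ‖ ^ (1 / (s + 1)) := by
  rcases eq_or_ne Φ 0 with rfl | h
  · rw [rt_zero hs, norm_zero, Real.zero_rpow (by positivity)]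
  · rw [rt, cpow_ofReal_eq h, norm_mul, norm_exp_ofReal_mul_I, mul_one, norm_real,
      Real.norm_of_nonneg (by positivity)]

theorem re_rt {s : ℝ} (hs : 0 < s) (Φ : ℂ) :
    (rt s Φ).re = ‖Φ‖ ^ (1 / (s + 1)) * Real.cos (arg Φ / (s + 1)) := by
  rcases eq_or_ne Φ 0 with rfl | h
  · rw [rt_zero hs, norm_zero, Real.zero_rpow (by positivity)]; simp
  · rw [rt, cpow_ofReal_eq h, re_ofReal_mul, exp_ofReal_mul_I_re]
    congr 2
    ring

theorem im_rt {s : ℝ} (hs : 0 < s) (Φ : ℂ) :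
    (rt s Φ).im = ‖Φ‖ ^ (1 / (s + 1)) * Real.sin (arg Φ / (s + 1)) := by
  rcases eq_or_ne Φ 0 with rfl | h
  · rw [rt_zero hs, norm_zero, Real.zero_rpow (by positivity)]; simp
  · rw [rt, cpow_ofReal_eq h, im_ofReal_mul, exp_ofReal_mul_I_im]
    congr 2
    ring

theorem abs_arg_div_le {s : ℝ} (hs : 0 < s) (Φ : ℂ) : |arg Φ / (s + 1)| ≤ Real.pi / (s + 1) := by
  rw [abs_div, abs_of_pos (show 0 < s + 1 by linarith)]
  have := abs_arg_le_pi Φ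
  gcongr

theorem arg_rt {s : ℝ} (hs : 0 < s) {Φ : ℂ} (hΦ : Φ ≠ 0) : arg (rt s Φ) = arg Φ / (s + 1) := by
  have h0 : 0 < ‖Φ‖ := norm_pos_iff.2 hΦ
  rw [rt, cpow_ofReal_eq hΦ, arg_real_mul _ (by positivity), arg_exp_mul_I,
    (toIocMod_eq_self _).2]
  · ring
  · have h1 := abs_le.1 (abs_arg_div_le hs Φ)
    have h2 : Real.pi / (s + 1) < Real.pi := div_lt_self Real.pi_pos (by linarith)
    rw [one_div, inv_mul_eq_div]
    constructor <;> linarith [Real.pi_pos]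

theorem rt_ne_zero {s : ℝ} {Φ : ℂ} (hΦ : Φ ≠ 0) : rt s Φ ≠ 0 := by
  rw [rt, Ne, cpow_eq_zero_iff]
  exact fun h => hΦ h.1

theorem rt_cpow {s : ℝ} (hs : 0 < s) {Φ : ℂ} (hΦ : Φ ≠ 0) : rt s Φ ^ ((s + 1 : ℝ) : ℂ) = Φ := by
  have h1 : 0 < s + 1 := by linarith
  rw [cpow_ofReal_eq (rt_ne_zero hΦ), norm_rt hs, arg_rt hs hΦ, ← Real.rpow_mul (norm_nonneg _),
    one_div_mul_cancel h1.ne', Real.rpow_one, mul_div_cancel₀ _ h1.ne']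
  exact norm_mul_exp_arg_mul_I Φ

theorem re_div_cpow {w : ℂ} (hw : w ≠ 0) (Φ : ℂ) (s : ℝ) :
    (Φ / w ^ (s : ℂ)).re = ‖Φ‖ / ‖w‖ ^ s * Real.cos (arg Φ - s * arg w) := by
  have h0 : 0 < ‖w‖ := norm_pos_iff.2 hw
  have h1 : ((‖w‖ ^ s : ℝ) : ℂ) ≠ 0 := by
    have : ‖w‖ ^ s ≠ 0 := by positivity
    exact_mod_cast this
  have : Φ / w ^ (s : ℂ) = ((‖Φ‖ / ‖w‖ ^ s : ℝ) : ℂ) * exp ((arg Φ - s * arg w : ℝ) * I) := by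
    rw [cpow_ofReal_eq hw, div_eq_iff (mul_ne_zero h1 (exp_ne_zero _))]
    nth_rewrite 1 [← norm_mul_exp_arg_mul_I Φ]
    have e : exp (arg Φ * I) = exp ((arg Φ - s * arg w : ℝ) * I) * exp ((s * arg w : ℝ) * I) := by
      rw [← exp_add]
      congr 1
      push_cast
      ring
    rw [e]
    push_cast at h1 ⊢
    field_simp
  rw [this, re_ofReal_mul, exp_ofReal_mul_I_re]

theorem re_div_cpow_eq {s : ℝ} (hs : 0 < s) {w : ℂ} (hw : 0 < w.re) (Φ : ℂ) :
    (Φ / w ^ (s : ℂ)).re = ‖Φ‖ * (Real.cos (arg w) ^ s *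
      Real.cos ((s + 1) * (arg Φ / (s + 1)) - s * arg w)) / w.re ^ s := by
  have hw0 : w ≠ 0 := by rintro rfl; simp at hw
  have h0 : 0 < ‖w‖ := norm_pos_iff.2 hw0
  have h1 : s + 1 ≠ 0 := by linarith
  have hc : 0 < Real.cos (arg w) := by rw [cos_arg hw0]; positivity
  have e1 : w.re = ‖w‖ * Real.cos (arg w) := (norm_mul_cos_arg w).symm
  rw [re_div_cpow hw0, mul_div_cancel₀ _ h1]
  rw [e1]
  rw [Real.mul_rpow h0.le hc.le]
  field_simp

theorem max_re_rt_rpow {s : ℝ} (hs : 0 < s) (Φ : ℂ) :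
    max (rt s Φ).re 0 ^ (s + 1) = ‖Φ‖ * max (Real.cos (arg Φ / (s + 1))) 0 ^ (s + 1) := by
  have h1 : s + 1 ≠ 0 := by linarith
  rw [re_rt hs]
  have : max (‖Φ‖ ^ (1 / (s + 1)) * Real.cos (arg Φ / (s + 1))) 0 =
      ‖Φ‖ ^ (1 / (s + 1)) * max (Real.cos (arg Φ / (s + 1))) 0 := by
    rw [mul_max_of_nonneg _ _ (by positivity), mul_zero]
  rw [this, Real.mul_rpow (by positivity) (by positivity), ← Real.rpow_mul (norm_nonneg _),
    one_div_mul_cancel h1, Real.rpow_one]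

/-- The trigonometric inequality with θ = arg w and β = arg Φ / (s+1), using |w| = Re w / cos(arg
w). The bound depends on w only through its real part, hence is constant along the path of
integration. -/
theorem re_div_cpow_le {s : ℝ} (hs : 0 < s) {w : ℂ} (hw : 0 < w.re) (Φ : ℂ) :
    (Φ / w ^ (s : ℂ)).re ≤ max (rt s Φ).re 0 ^ (s + 1) / w.re ^ s := by
  rw [re_div_cpow_eq hs hw, max_re_rt_rpow hs]
  have := (cos_rpow_mul_cos_sub_le hs (abs_arg_lt_pi_div_two_iff.2 (Or.inl hw))
    (abs_arg_div_le hs Φ)).1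
  gcongr

theorem eq_of_re_eq_of_arg_eq {w w' : ℂ} (hw : 0 < w.re) (hre : w.re = w'.re)
    (harg : arg w = arg w') : w = w' := by
  have hw0 : w ≠ 0 := by rintro rfl; simp at hw
  have hc : 0 < Real.cos (arg w) := by
    have := norm_pos_iff.2 hw0
    rw [cos_arg hw0]; positivity
  have h1 := norm_mul_cos_arg w
  have h2 := norm_mul_cos_arg w'
  rw [← harg, ← hre, ← h1] at h2
  have h3 : ‖w'‖ = ‖w‖ := mul_right_cancel₀ hc.ne' h2
  rw [← norm_mul_exp_arg_mul_I w, ← norm_mul_exp_arg_mul_I w', h3, harg]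

/-- Away from the saddle points the real part is strictly smaller than at the saddle points. -/
theorem re_div_cpow_lt {s : ℝ} (hs : 0 < s) {w Φ : ℂ} (hΦ : 0 < (rt s Φ).re)
    (hre : w.re = (rt s Φ).re) (hne : w ≠ rt s Φ)
    (hne' : w ≠ (starRingEnd ℂ) (rt s Φ) ∨ Φ ∈ slitPlane) :
    (Φ / w ^ (s : ℂ)).re < (rt s Φ).re := by
  have hw : 0 < w.re := by rwa [hre]
  have hΦ0 : Φ ≠ 0 := by
    rintro rfl
    rw [rt_zero hs] at hΦ
    simp at hΦ
  have h0 : 0 < ‖Φ‖ := norm_pos_iff.2 hΦ0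
  have hcos : 0 < Real.cos (arg Φ / (s + 1)) := by
    rw [re_rt hs] at hΦ
    exact pos_of_mul_pos_right hΦ (by positivity)
  have hpi : arg (rt s Φ) ≠ Real.pi := by
    have := abs_lt.1 (abs_arg_lt_pi_div_two_iff.2 (Or.inl hΦ))
    intro h
    linarith [Real.pi_pos]
  have key := (cos_rpow_mul_cos_sub_le hs (abs_arg_lt_pi_div_two_iff.2 (Or.inl hw))
    (abs_arg_div_le hs Φ)).2 hcos ?_ ?_
  · rw [re_div_cpow_eq hs hw, div_lt_iff₀ (by positivity), hre]
    have e := max_re_rt_rpow hs Φ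
    rw [max_eq_left hΦ.le, max_eq_left hcos.le] at e
    calc _ < ‖Φ‖ * Real.cos (arg Φ / (s + 1)) ^ (s + 1) := by gcongr
      _ = _ := by rw [← e, Real.rpow_add_one hΦ.ne']; ring
  · intro h
    refine hne (eq_of_re_eq_of_arg_eq hw hre ?_)
    rw [arg_rt hs hΦ0, h]
  · intro h
    rcases hne' with h' | h'
    · refine absurd (eq_of_re_eq_of_arg_eq hw (by rw [conj_re, hre]) ?_) h'
      rw [arg_conj, if_neg hpi, arg_rt hs hΦ0, h]
    · rw [abs_div, abs_of_pos (show 0 < s + 1 by linarith)]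
      have h2 := abs_le.1 (abs_arg_le_pi Φ)
      have h3 := (mem_slitPlane_iff_arg.1 h').1
      have : |arg Φ| < Real.pi := by
        rw [abs_lt]
        exact ⟨neg_pi_lt_arg Φ, lt_of_le_of_ne h2.2 h3⟩
      gcongr

/-- The root jumps to its conjugate across the cut, but its real part depends only on |arg Φ| =
arccos(Re Φ / |Φ|), which is continuous away from 0. -/
theorem continuous_re_rt {s : ℝ} (hs : 0 < s) : Continuous fun Φ : ℂ => (rt s Φ).re := by
  have hpow : Continuous fun Φ : ℂ => ‖Φ‖ ^ (1 / (s + 1)) :=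
    continuous_norm.rpow_const fun _ => Or.inr (by positivity)
  rw [continuous_iff_continuousAt]
  intro Φ
  rcases eq_or_ne Φ 0 with rfl | hΦ
  · have h0 := hpow.tendsto 0
    rw [norm_zero, Real.zero_rpow (by positivity)] at h0
    rw [ContinuousAt, rt_zero hs, zero_re]
    refine squeeze_zero_norm (fun Ψ => ?_) h0
    rw [← norm_rt hs]
    exact abs_re_le_norm _
  · have e : (fun Φ : ℂ => (rt s Φ).re) =ᶠ[𝓝 Φ] fun Φ =>
        ‖Φ‖ ^ (1 / (s + 1)) * Real.cos (Real.arccos (Φ.re / ‖Φ‖) / (s + 1)) := by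
      filter_upwards [isOpen_ne.mem_nhds hΦ] with Ψ hΨ
      rw [re_rt hs, ← cos_arg hΨ, ← Real.cos_abs (arg Ψ),
        Real.arccos_cos (abs_nonneg _) (abs_arg_le_pi _), ← Real.cos_abs (arg Ψ / (s + 1)), abs_div,
        abs_of_pos (show 0 < s + 1 by linarith)]
    refine ContinuousAt.congr ?_ e.symm
    refine hpow.continuousAt.mul ?_
    have : ContinuousAt (fun Φ : ℂ => Φ.re / ‖Φ‖) Φ :=
      ContinuousAt.div (by fun_prop) (by fun_prop) (norm_ne_zero_iff.2 hΦ)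
    exact Real.continuous_cos.continuousAt.comp'
      ((Real.continuous_arccos.continuousAt.comp' this).div_const _)

end PolyMeinardus
end

noncomputable section
namespace PolyMeinardus
open MeasureTheory Complex Set

/-! ### Laplace's method -/

theorem exists_cube_mul_exp_neg_sq_le {b : ℝ} (hb : 0 < b) :
    ∃ C : ℝ, 0 < C ∧ ∀ u : ℝ, 0 ≤ u → u ^ 3 * Real.exp (-b * u ^ 2) ≤ C := by
  obtain ⟨M, hM, h⟩ := exists_rpow_mul_exp_neg_le (2 : ℝ) hb
  refine ⟨max M 1, by positivity, fun u hu => ?_⟩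
  rcases le_or_gt u 1 with h1 | h1
  · refine le_trans ?_ (le_max_right _ _)
    have e1 : u ^ 3 ≤ 1 := pow_le_one₀ hu h1
    have e2 : Real.exp (-b * u ^ 2) ≤ 1 := Real.exp_le_one_iff.2 (by nlinarith [sq_nonneg u])
    exact mul_le_one₀ e1 (Real.exp_pos _).le e2
  · refine le_trans ?_ (le_max_left _ _)
    have := h (u ^ 2) (by nlinarith)
    rw [Real.rpow_two] at this
    refine le_trans ?_ this
    gcongr
    nlinarith [sq_nonneg (u ^ 2), mul_pos (zero_lt_one.trans h1) (zero_lt_one.trans h1),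
      pow_pos (zero_lt_one.trans h1) 3]

theorem exp_neg_le_rpow_neg_half {x : ℝ} (hx : 0 < x) : Real.exp (-x) ≤ x ^ (-(1 / 2) : ℝ) := by
  rw [Real.exp_neg, Real.rpow_neg hx.le, ← Real.sqrt_eq_rpow]
  apply inv_anti₀ (Real.sqrt_pos.2 hx)
  rw [Real.sqrt_le_left (Real.exp_pos _).le]
  have := Real.add_one_le_exp x
  nlinarith

theorem norm_exp_mul_sub_one_le {G H : ℂ} {ε : ℝ} (hH : ‖H - 1‖ ≤ ε) (hε : ε ≤ 1) :
    ‖exp G * H - 1‖ ≤ 2 * (‖G‖ * Real.exp ‖G‖) + ε := by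
  have e1 : exp G * H - 1 = (exp G - 1) * H + (H - 1) := by ring
  have e2 : ‖H‖ ≤ 2 := by
    have : H = (H - 1) + 1 := by ring
    rw [this]
    refine (norm_add_le _ _).trans ?_
    rw [norm_one]; linarith
  have e3 : ‖exp G - 1‖ ≤ ‖G‖ * Real.exp ‖G‖ := by
    simpa using norm_exp_sub_sum_le_norm_mul_exp G 1
  rw [e1]
  refine (norm_add_le _ _).trans (add_le_add ?_ hH)
  rw [norm_mul]
  calc _ ≤ (‖G‖ * Real.exp ‖G‖) * 2 := by gcongr
    _ = _ := by ring

/-- Laplace's method for a complex phase with a nondegenerate critical point, with an error term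
which depends only on bounds for the phase. -/
theorem exists_laplace_bound {κ₀ M r : ℝ} (hκ₀ : 0 < κ₀) (hM : 0 ≤ M) (hr : 0 < r)
    (hMr : M * r ≤ κ₀ / 8) :
    ∃ C : ℝ, 0 < C ∧ ∀ (κ : ℂ) (F H : ℝ → ℂ) (lam ε : ℝ), κ₀ ≤ κ.re → 0 < lam → ε ≤ 1 →
      (∀ t, |t| ≤ r → ‖F t + κ * t ^ 2 / 2‖ ≤ M * |t| ^ 3) → (∀ t, |t| ≤ r → ‖H t - 1‖ ≤ ε) →
      IntegrableOn (fun t => exp (lam * F t) * H t) (Icc (-r) r) →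
      ‖(∫ t in Icc (-r) r, exp (lam * F t) * H t) - (Real.pi / (lam * κ / 2)) ^ (1 / 2 : ℂ)‖ ≤
        C * ((lam ^ (-(1 / 2) : ℝ) + ε) * lam ^ (-(1 / 2) : ℝ)) := by
  obtain ⟨C₁, hC₁, hcube⟩ := exists_cube_mul_exp_neg_sq_le (b := κ₀ / 8) (by positivity)
  set C₂ : ℝ := (κ₀ * r ^ 2 / 4) ^ (-(1 / 2) : ℝ) with hC₂
  have hC₂0 : 0 < C₂ := by positivity
  set C₃ : ℝ := Real.sqrt (Real.pi / (κ₀ / 4)) with hC₃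
  have hC₃0 : 0 < C₃ := Real.sqrt_pos.2 (by positivity)
  refine ⟨(2 * M * C₁ + C₂ + 1) * C₃, by positivity, ?_⟩
  intro κ F H lam ε hκ hlam hε1 hF hH hint
  have hε0 : 0 ≤ ε := (norm_nonneg _).trans (hH 0 (by simpa using hr.le))
  have hl2 : 0 < lam ^ (-(1 / 2) : ℝ) := by positivity
  set b : ℂ := lam * κ / 2 with hb
  have hbre : b.re = lam * κ.re / 2 := by
    rw [hb, show (lam * κ / 2 : ℂ) = ((lam / 2 : ℝ) : ℂ) * κ by push_cast; ring, re_ofReal_mul]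
    ring
  have hb0 : 0 < b.re := by
    rw [hbre]
    have : 0 < κ.re := hκ₀.trans_le hκ
    positivity
  rw [← integral_gaussian_complex hb0, ← integral_indicator measurableSet_Icc,
    ← integral_sub (hint.integrable_indicator measurableSet_Icc)
      (integrable_cexp_neg_mul_sq hb0)]
  have hβ : 0 < lam * κ₀ / 4 := by positivity
  have hg : ∫ t : ℝ, (2 * M * C₁ * lam ^ (-(1 / 2) : ℝ) + C₂ * lam ^ (-(1 / 2) : ℝ) + ε) *
      Real.exp (-(lam * κ₀ / 4) * t ^ 2) = (2 * M * C₁ * lam ^ (-(1 / 2) : ℝ) +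
      C₂ * lam ^ (-(1 / 2) : ℝ) + ε) * (C₃ * lam ^ (-(1 / 2) : ℝ)) := by
    rw [integral_const_mul, integral_gaussian]
    congr 1
    rw [hC₃, Real.rpow_neg hlam.le, ← Real.sqrt_eq_rpow, ← Real.sqrt_inv,
      ← Real.sqrt_mul (by positivity)]
    congr 1
    field_simp
  refine (norm_integral_le_of_norm_le ((integrable_exp_neg_mul_sq hβ).const_mul _)
    (ae_of_all _ fun t => ?_)).trans (hg.le.trans ?_)
  · have hgauss : ‖exp (-b * t ^ 2)‖ ≤ Real.exp (-(lam * κ₀ / 2) * t ^ 2) := by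
      rw [norm_exp]
      apply Real.exp_le_exp.2
      have : (-b * (t : ℂ) ^ 2).re = -(b.re) * t ^ 2 := by
        rw [← ofReal_pow, re_mul_ofReal]; simp
      rw [this, hbre]
      have h3 : lam * κ₀ / 2 ≤ lam * κ.re / 2 := by gcongr
      nlinarith [sq_nonneg t]
    by_cases ht : |t| ≤ r
    · rw [indicator_of_mem (by rw [mem_Icc]; exact abs_le.1 ht)]
      set G : ℂ := lam * (F t + κ * t ^ 2 / 2) with hG
      have hGn : ‖G‖ ≤ lam * (M * |t| ^ 3) := by
        rw [hG, norm_mul, norm_real, Real.norm_of_nonneg hlam.le]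
        exact mul_le_mul_of_nonneg_left (hF t ht) hlam.le
      -- Since M r ≤ κ₀/8, the cubic remainder uses up only a quarter of the Gaussian exponent
      -- λκ₀t²/2. Of the remaining 3/8, a part 1/8 absorbs the factor |t|³ and 1/4 is kept as the
      -- integrable majorant.
      have hGn2 : ‖G‖ ≤ lam * κ₀ / 8 * t ^ 2 := by
        refine hGn.trans ?_
        have h4 : M * |t| ≤ κ₀ / 8 := (mul_le_mul_of_nonneg_left ht hM).trans hMr
        calc lam * (M * |t| ^ 3) = lam * ((M * |t|) * |t| ^ 2) := by ring
          _ ≤ lam * (κ₀ / 8 * |t| ^ 2) := by gcongr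
          _ = _ := by rw [sq_abs]; ring
      have e1 : exp (lam * F t) * H t - exp (-b * t ^ 2) =
          exp (-b * t ^ 2) * (exp G * H t - 1) := by
        rw [mul_sub, ← mul_assoc, ← exp_add, hG, hb]
        ring_nf
      rw [e1, norm_mul]
      have hu : lam * |t| ^ 3 * Real.exp (-(lam * κ₀ / 8) * t ^ 2) ≤ lam ^ (-(1 / 2) : ℝ) * C₁ := by
        have h5 := hcube (Real.sqrt lam * |t|) (by positivity)
        have h6 : Real.sqrt lam ^ 2 = lam := Real.sq_sqrt hlam.le
        have h7 : lam ^ (-(1 / 2) : ℝ) * Real.sqrt lam ^ 3 = lam := by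
          rw [Real.rpow_neg hlam.le, ← Real.sqrt_eq_rpow]
          have : Real.sqrt lam ≠ 0 := (Real.sqrt_pos.2 hlam).ne'
          field_simp
          exact h6
        rw [mul_pow, mul_pow, h6, sq_abs] at h5
        calc _ = lam ^ (-(1 / 2) : ℝ) *
            (Real.sqrt lam ^ 3 * |t| ^ 3 * Real.exp (-(κ₀ / 8) * (lam * t ^ 2))) := by
              nth_rewrite 1 [← h7]
              ring_nf
          _ ≤ _ := by gcongr
      have hE : 0 ≤ Real.exp (-(lam * κ₀ / 4) * t ^ 2) := (Real.exp_pos _).le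
      calc ‖exp (-b * t ^ 2)‖ * ‖exp G * H t - 1‖
          ≤ Real.exp (-(lam * κ₀ / 2) * t ^ 2) *
            (2 * (lam * (M * |t| ^ 3) * Real.exp (lam * κ₀ / 8 * t ^ 2)) + ε) := by
            gcongr
            refine (norm_exp_mul_sub_one_le (hH t ht) hε1).trans ?_
            gcongr
        _ = 2 * M * (lam * |t| ^ 3 * (Real.exp (-(lam * κ₀ / 2) * t ^ 2) *
            Real.exp (lam * κ₀ / 8 * t ^ 2))) + ε * Real.exp (-(lam * κ₀ / 2) * t ^ 2) := by ring
        _ = 2 * M * (lam * |t| ^ 3 * Real.exp (-(lam * κ₀ / 8) * t ^ 2)) *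
            Real.exp (-(lam * κ₀ / 4) * t ^ 2) + ε * Real.exp (-(lam * κ₀ / 2) * t ^ 2) := by
            have : Real.exp (-(lam * κ₀ / 2) * t ^ 2) * Real.exp (lam * κ₀ / 8 * t ^ 2) =
              Real.exp (-(lam * κ₀ / 8) * t ^ 2) * Real.exp (-(lam * κ₀ / 4) * t ^ 2) := by
              rw [← Real.exp_add, ← Real.exp_add]; ring_nf
            rw [this]; ring
        _ ≤ 2 * M * (lam ^ (-(1 / 2) : ℝ) * C₁) * Real.exp (-(lam * κ₀ / 4) * t ^ 2) +
            ε * Real.exp (-(lam * κ₀ / 4) * t ^ 2) := by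
            gcongr
            norm_num
        _ ≤ _ := by
            have : 0 ≤ C₂ * lam ^ (-(1 / 2) : ℝ) * Real.exp (-(lam * κ₀ / 4) * t ^ 2) := by positivity
            nlinarith
    · rw [indicator_of_notMem (by rw [mem_Icc, ← abs_le]; exact ht), zero_sub, norm_neg]
      push Not at ht
      have h8 : r ^ 2 ≤ t ^ 2 := by rw [← sq_abs t]; gcongr
      -- Outside the window only the complete Gaussian remains; half of its decay is spent on a
      -- factor λ^{-1/2}.
      have h9 : Real.exp (-(lam * κ₀ / 4) * t ^ 2) ≤ C₂ * lam ^ (-(1 / 2) : ℝ) := by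
        rw [hC₂, ← Real.mul_rpow (by positivity) hlam.le]
        refine le_trans ?_ (exp_neg_le_rpow_neg_half (by positivity))
        apply Real.exp_le_exp.2
        nlinarith
      calc _ ≤ Real.exp (-(lam * κ₀ / 2) * t ^ 2) := hgauss
        _ = Real.exp (-(lam * κ₀ / 4) * t ^ 2) * Real.exp (-(lam * κ₀ / 4) * t ^ 2) := by
          rw [← Real.exp_add]; ring_nf
        _ ≤ (2 * M * C₁ * lam ^ (-(1 / 2) : ℝ) + C₂ * lam ^ (-(1 / 2) : ℝ) + ε) *
            Real.exp (-(lam * κ₀ / 4) * t ^ 2) := by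
          gcongr
          have : 0 ≤ 2 * M * C₁ * lam ^ (-(1 / 2) : ℝ) := by positivity
          linarith
  · have : 2 * M * C₁ * lam ^ (-(1 / 2) : ℝ) + C₂ * lam ^ (-(1 / 2) : ℝ) + ε ≤
        (2 * M * C₁ + C₂ + 1) * (lam ^ (-(1 / 2) : ℝ) + ε) := by
      have : 0 ≤ 2 * M * C₁ := by positivity
      nlinarith
    calc _ ≤ (2 * M * C₁ + C₂ + 1) * (lam ^ (-(1 / 2) : ℝ) + ε) * (C₃ * lam ^ (-(1 / 2) : ℝ)) := by
          gcongr
      _ = _ := by ring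

/-! ### The phase function -/

/-- Mean value inequality on the segment from 0 to t. Iterated three times, it replaces Taylor's
theorem for the phase. -/
theorem norm_le_of_norm_deriv_le_pow {g g' : ℝ → ℂ} {C : ℝ} {n : ℕ}
    (hg : ∀ t, HasDerivAt g (g' t) t) (h0 : g 0 = 0) (hC : 0 ≤ C)
    (hb : ∀ t, ‖g' t‖ ≤ C * |t| ^ n) (t : ℝ) : ‖g t‖ ≤ C * |t| ^ (n + 1) := by
  have hle : ∀ x ∈ uIcc 0 t, |x| ≤ |t| := by
    intro x hx
    have := abs_sub_left_of_mem_uIcc hx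
    simpa using this
  have := (convex_uIcc (0 : ℝ) t).norm_image_sub_le_of_norm_hasDerivWithin_le (f := g) (f' := g')
    (C := C * |t| ^ n) (fun x _ => (hg x).hasDerivWithinAt) (fun x hx => (hb x).trans
      (mul_le_mul_of_nonneg_left (pow_le_pow_left₀ (abs_nonneg x) (hle x hx) n) hC)) left_mem_uIcc right_mem_uIcc
  rw [h0, sub_zero, sub_zero, Real.norm_eq_abs] at this
  rw [pow_succ, ← mul_assoc]
  exact this

/-- The phase function `v + Φ / (s v^s)`. -/
def phaseFun (s : ℝ) (Φ v : ℂ) : ℂ := v + Φ / (s * v ^ (s : ℂ))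

theorem norm_cpow_ofReal {v : ℂ} (hv : v ≠ 0) (x : ℝ) : ‖v ^ (x : ℂ)‖ = ‖v‖ ^ x := by
  rw [cpow_ofReal_eq hv, norm_mul, norm_exp_ofReal_mul_I, mul_one, norm_real,
    Real.norm_of_nonneg (by positivity)]

theorem hasDerivAt_line_cpow {L : ℂ} (hL : 0 < L.re) (x t : ℝ) :
    HasDerivAt (fun t : ℝ => (L + t * I) ^ (x : ℂ)) (x * (L + t * I) ^ ((x - 1 : ℝ) : ℂ) * I) t := by
  have h1 : HasDerivAt (fun t : ℝ => L + t * I) I t := by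
    have := ((hasDerivAt_id t).ofReal_comp.mul_const I).const_add L
    simpa using this
  have h2 := (Complex.hasStrictDerivAt_cpow_const (x := L + t * I) (c := (x : ℂ))
    (Or.inl (by simpa using hL))).hasDerivAt
  have h3 := h2.comp t h1
  push_cast
  exact h3

/-- The saddle equation L^{s+1} = Φ makes the first derivative along the line vanish and the second
equal to -(s+1)/L. The third is bounded on the whole line because |L + it| ≥ Re L. -/
theorem norm_phaseFun_taylor_le {s : ℝ} (hs : 0 < s) {L Φ : ℂ} (hL : 0 < L.re)
    (hΦ : L ^ ((s + 1 : ℝ) : ℂ) = Φ) (t : ℝ) :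
    ‖(phaseFun s Φ (L + t * I) - phaseFun s Φ L) + (s + 1) / L * t ^ 2 / 2‖ ≤
      ((s + 1) * (s + 2) * ‖Φ‖ * L.re ^ (-(s + 3))) * |t| ^ 3 := by
  have hL0 : L ≠ 0 := by rintro rfl; simp at hL
  have hs0 : (s : ℂ) ≠ 0 := by exact_mod_cast hs.ne'
  set M := (s + 1) * (s + 2) * ‖Φ‖ * L.re ^ (-(s + 3)) with hM
  have hM0 : 0 ≤ M := by positivity
  set p : ℝ → ℝ → ℂ := fun x t => (L + t * I) ^ (x : ℂ) with hp
  have hd : ∀ x t, HasDerivAt (p x) (x * p (x - 1) t * I) t := fun x t => hasDerivAt_line_cpow hL x t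
  have hne : ∀ t : ℝ, (L + t * I) ≠ 0 := by
    intro t h
    have := congrArg re h
    simp at this
    linarith
  have hΦp : Φ * p (-(s + 1)) 0 = 1 := by
    simp only [hp, ofReal_zero, zero_mul, add_zero]
    rw [← hΦ, ofReal_neg, ← cpow_add _ _ hL0]
    simp
  have hΦp2 : Φ * p (-(s + 2)) 0 = 1 / L := by
    have : p (-(s + 2)) 0 = p (-(s + 1)) 0 / L := by
      simp only [hp, ofReal_zero, zero_mul, add_zero]
      rw [eq_div_iff hL0]
      nth_rewrite 2 [← cpow_one L]
      rw [← cpow_add _ _ hL0]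
      congr 1
      push_cast
      ring
    rw [this, ← mul_div_assoc, hΦp]
  set g₂ : ℝ → ℂ := fun t => -((s + 1) * (Φ * p (-(s + 2)) t)) + (s + 1) / L with hg₂
  set g₁ : ℝ → ℂ := fun t => I * (1 - Φ * p (-(s + 1)) t) + (s + 1) / L * t with hg₁
  set g₀ : ℝ → ℂ := fun t => (phaseFun s Φ (L + t * I) - phaseFun s Φ L) +
    (s + 1) / L * t ^ 2 / 2 with hg₀
  have d2 : ∀ t, HasDerivAt g₂ ((s + 1) * (s + 2) * (Φ * p (-(s + 3)) t) * I) t := by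
    intro t
    have := ((((hd (-(s + 2)) t).const_mul Φ).const_mul ((s : ℂ) + 1)).neg).add_const ((s + 1) / L)
    convert! this using 1
    rw [show -(s + 2) - 1 = -(s + 3) by ring]
    push_cast
    ring
  have d1 : ∀ t, HasDerivAt g₁ (g₂ t) t := by
    intro t
    have h1 := (((hd (-(s + 1)) t).const_mul Φ).const_sub 1).const_mul I
    have h2 := ((hasDerivAt_id t).ofReal_comp).const_mul ((s + 1) / L : ℂ)
    convert! h1.add h2 using 1
    simp only [hg₂]
    rw [show -(s + 1) - 1 = -(s + 2) by ring]
    push_cast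
    linear_combination (-(s : ℂ) - 1) * Φ * p (-(s + 2)) t * I_sq
  have d0 : ∀ t, HasDerivAt g₀ (g₁ t) t := by
    intro t
    have h1 : HasDerivAt (fun t : ℝ => phaseFun s Φ (L + t * I)) (I * (1 - Φ * p (-(s + 1)) t)) t := by
      have e : (fun t : ℝ => phaseFun s Φ (L + t * I)) = fun t : ℝ => (L + t * I) +
          Φ / s * p (-s) t := by
        funext t
        simp only [phaseFun, hp]
        rw [ofReal_neg, cpow_neg]
        field_simp
      rw [e]
      have h3 : HasDerivAt (fun t : ℝ => L + t * I) I t := by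
        have := ((hasDerivAt_id t).ofReal_comp.mul_const I).const_add L
        simpa using this
      convert! h3.add ((hd (-s) t).const_mul (Φ / s)) using 1
      rw [show -s - 1 = -(s + 1) by ring]
      push_cast
      field_simp
      ring
    have h2 : HasDerivAt (fun t : ℝ => ((s + 1) / L * t ^ 2 / 2 : ℂ)) ((s + 1) / L * t) t := by
      have := ((((hasDerivAt_id t).ofReal_comp).pow 2).const_mul ((s + 1) / L : ℂ)).div_const 2
      convert! this using 1
      simp
      ring
    exact (h1.sub_const _).add h2
  have b3 : ∀ t, ‖(s + 1) * (s + 2) * (Φ * p (-(s + 3)) t) * I‖ ≤ M * |t| ^ 0 := by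
    intro t
    have e1 : ‖p (-(s + 3)) t‖ ≤ L.re ^ (-(s + 3)) := by
      simp only [hp]
      rw [norm_cpow_ofReal (hne t)]
      apply Real.rpow_le_rpow_of_nonpos hL _ (by linarith)
      simpa using re_le_norm (L + t * I)
    have e2 : ‖((s : ℂ) + 1)‖ = s + 1 := by
      rw [show ((s : ℂ) + 1) = ((s + 1 : ℝ) : ℂ) by push_cast; ring, norm_real,
        Real.norm_of_nonneg (by linarith)]
    have e3 : ‖((s : ℂ) + 2)‖ = s + 2 := by
      rw [show ((s : ℂ) + 2) = ((s + 2 : ℝ) : ℂ) by push_cast; ring, norm_real,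
        Real.norm_of_nonneg (by linarith)]
    rw [norm_mul, norm_mul, norm_mul, norm_mul, norm_I, e2, e3, hM]
    simp only [pow_zero, mul_one]
    rw [← mul_assoc]
    gcongr
  have b2 := norm_le_of_norm_deriv_le_pow d2 (by
    simp only [hg₂]; rw [hΦp2]; ring) hM0 b3
  have b1 := norm_le_of_norm_deriv_le_pow d1 (by
    simp only [hg₁]; rw [hΦp]; simp) hM0 b2
  exact norm_le_of_norm_deriv_le_pow d0 (by simp [hg₀]) hM0 b1 t

theorem phaseFun_saddle {s : ℝ} (hs : 0 < s) {L Φ : ℂ} (hL : L ≠ 0)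
    (hΦ : L ^ ((s + 1 : ℝ) : ℂ) = Φ) : phaseFun s Φ L = ((s + 1) / s : ℝ) * L := by
  have hs0 : (s : ℂ) ≠ 0 := by exact_mod_cast hs.ne'
  have h1 : L ^ (s : ℂ) ≠ 0 := by
    rw [Ne, cpow_eq_zero_iff]; exact fun h => hL h.1
  rw [phaseFun, ← hΦ, ofReal_add, cpow_add _ _ hL]
  simp only [ofReal_one, cpow_one]
  push_cast
  field_simp

end PolyMeinardus
end

noncomputable section
namespace PolyMeinardus
open MeasureTheory Complex Set

/-! ### Analyticity of `Φ` -/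

theorem Li_zero (s : ℝ) : Li s 0 = 0 := by simp [Li]

theorem analyticOnNhd_Li {s : ℝ} (hs : 0 ≤ s) : AnalyticOnNhd ℂ (Li s) (Metric.ball 0 1) := by
  refine DifferentiableOn.analyticOnNhd (fun z hz => ?_) Metric.isOpen_ball
  rw [mem_ball_zero_iff] at hz
  obtain ⟨r, hr1, hr2⟩ := exists_between hz
  have hr0 : 0 ≤ r := (norm_nonneg z).trans hr1.le
  have hd : DifferentiableOn ℂ (Li s) (Metric.ball 0 r) := by
    refine differentiableOn_tsum_of_summable_norm (summable_geometric_of_lt_one hr0 hr2)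
      (fun l => by fun_prop) Metric.isOpen_ball fun l w hw => ?_
    rw [mem_ball_zero_iff] at hw
    rw [norm_div, norm_pow, norm_real, Real.norm_of_nonneg (by positivity)]
    have h1 : (1 : ℝ) ≤ ((l + 1 : ℕ) : ℝ) ^ s :=
      Real.one_le_rpow (by push_cast; linarith [(l.cast_nonneg : (0 : ℝ) ≤ l)]) hs
    refine (div_le_self (by positivity) h1).trans ?_
    exact (pow_le_pow_left₀ (norm_nonneg _) hw.le _).trans
      (pow_le_pow_of_le_one hr0 hr2.le (Nat.le_succ l))
  exact (hd.differentiableAt (Metric.isOpen_ball.mem_nhds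
    (mem_ball_zero_iff.2 hr1))).differentiableWithinAt

theorem analyticOnNhd_Phi {s₀ : ℝ} (hs₀ : 0 < s₀) (A : ℕ → ℕ → ℂ) (h k : ℕ) :
    AnalyticOnNhd ℂ (Phi s₀ A h k) (Metric.ball 0 1) := by
  intro z hz
  unfold Phi
  refine analyticAt_const.mul ?_
  refine Finset.analyticAt_fun_sum _ fun j _ => analyticAt_const.mul ?_
  refine AnalyticAt.fun_comp (g := Li (s₀ + 1))
    (f := fun z => e ((h : ℝ) * (j : ℝ) / (k : ℝ)) * z) (analyticOnNhd_Li (by linarith) _ ?_)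
    (by fun_prop)
  rw [mem_ball_zero_iff] at hz ⊢
  exact norm_e_mul_lt hz

theorem Phi_zero (s₀ : ℝ) (A : ℕ → ℕ → ℂ) (h k : ℕ) : Phi s₀ A h k 0 = 0 := by
  simp [Phi, Li_zero]

theorem continuousOn_Phi {s₀ : ℝ} (hs₀ : 0 < s₀) (A : ℕ → ℕ → ℂ) (h k : ℕ) :
    ContinuousOn (Phi s₀ A h k) (Metric.ball 0 1) :=
  (analyticOnNhd_Phi hs₀ A h k).continuousOn

/-! ### Roots of analytic functions with equal real parts -/

theorem IsOpen.exists_mem_slitPlane {V : Set ℂ} (hV : IsOpen V) (hne : V.Nonempty) :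
    ∃ w ∈ V, w ∈ slitPlane := by
  obtain ⟨w, hw⟩ := hne
  by_cases him : w.im = 0
  · have hc : Tendsto (fun t : ℝ => w + t * I) (𝓝[>] 0) (𝓝 w) := by
      have : Tendsto (fun t : ℝ => w + t * I) (𝓝 0) (𝓝 (w + (0 : ℝ) * I)) :=
        Continuous.tendsto (by fun_prop) 0
      simpa using this.mono_left nhdsWithin_le_nhds
    obtain ⟨t, ht1, ht2⟩ := ((hc.eventually (hV.mem_nhds hw)).and self_mem_nhdsWithin).exists
    refine ⟨_, ht1, Or.inr ?_⟩
    have : (0 : ℝ) < t := ht2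
    simp [him, this.ne']
  · exact ⟨w, hw, Or.inr him⟩

/-- By the open mapping theorem F(V) is open, so it cannot lie inside the half-line (-∞, 0]. -/
theorem exists_isOpen_slitPlane {F : ℂ → ℂ} {B V : Set ℂ} (hF : AnalyticOnNhd ℂ F B)
    (hB : IsPreconnected B) (hV : IsOpen V) (hVB : V ⊆ B) (hne : V.Nonempty)
    (hnc : ¬ ∃ w, ∀ z ∈ B, F z = w) :
    ∃ V' ⊆ V, IsOpen V' ∧ V'.Nonempty ∧ ∀ z ∈ V', F z ∈ slitPlane := by
  have ho := (hF.is_constant_or_isOpen hB).resolve_left hnc V hVB hV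
  obtain ⟨w, ⟨z, hz, hzw⟩, hw⟩ := IsOpen.exists_mem_slitPlane ho (hne.image F)
  refine ⟨V ∩ F ⁻¹' slitPlane, inter_subset_left, ?_, ⟨z, hz, by rw [mem_preimage, hzw]; exact hw⟩,
    fun z hz => hz.2⟩
  exact (hF.continuousOn.mono hVB).isOpen_inter_preimage hV isOpen_slitPlane

/-- The number n is the vanishing order at 0, read off from φ = z^n u with u(0) ≠ 0. -/
theorem tendsto_mul_deriv_div {φ : ℂ → ℂ} (hφ : AnalyticAt ℂ φ 0)
    (hne : ¬ ∀ᶠ z in 𝓝 0, φ z = 0) :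
    ∃ n : ℕ, (φ 0 = 0 → 0 < n) ∧ (∃ u : ℂ → ℂ, ContinuousAt u 0 ∧ u 0 ≠ 0 ∧
        ∀ᶠ z in 𝓝 0, φ z = z ^ n * u z) ∧
      Tendsto (fun z => z * deriv φ z / φ z) (𝓝[≠] 0) (𝓝 n) := by
  obtain ⟨n, u, hu, hu0, he⟩ := hφ.exists_eventuallyEq_pow_smul_nonzero_iff.2 hne
  simp only [sub_zero, smul_eq_mul] at he
  refine ⟨n, fun h0 => ?_, ⟨u, hu.continuousAt, hu0, he⟩, ?_⟩
  · by_contra! hn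
    have := he.self_of_nhds
    rw [h0, Nat.le_zero.1 hn, pow_zero, one_mul] at this
    exact hu0 this.symm
  · have hlim : Tendsto (fun z => n + z * deriv u z / u z) (𝓝[≠] 0) (𝓝 (n : ℂ)) := by
      have hc : ContinuousAt (fun z => (n : ℂ) + z * deriv u z / u z) 0 :=
        continuousAt_const.add ((continuousAt_id.mul hu.deriv.continuousAt).div hu.continuousAt hu0)
      have := hc.tendsto.mono_left (nhdsWithin_le_nhds (s := {0}ᶜ))
      simpa using this
    refine hlim.congr' ?_
    have h1 : ∀ᶠ z in 𝓝 (0 : ℂ), deriv φ z = deriv (fun z => z ^ n * u z) z :=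
      Filter.EventuallyEq.deriv he
    filter_upwards [nhdsWithin_le_nhds he, nhdsWithin_le_nhds h1,
      nhdsWithin_le_nhds hu.eventually_analyticAt,
      nhdsWithin_le_nhds (hu.continuousAt.eventually_ne hu0), self_mem_nhdsWithin]
      with z e1 e2 e3 e4 e5
    have hz : z ≠ 0 := e5
    have hd : deriv (fun z => z ^ n * u z) z = n * z ^ (n - 1) * u z + z ^ n * deriv u z := by
      have := ((hasDerivAt_pow n z).mul e3.differentiableAt.hasDerivAt).deriv
      exact this
    rw [e1, e2, hd]
    rcases Nat.eq_zero_or_pos n with rfl | hn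
    · simp
    · have : z ^ n = z ^ (n - 1) * z := by rw [← pow_succ, Nat.sub_add_cancel hn]
      rw [this]
      have hz1 : z ^ (n - 1) ≠ 0 := pow_ne_zero _ hz
      field_simp

theorem deriv_rt_mul {F : ℂ → ℂ} {s : ℝ} {z : ℂ} (hF : AnalyticAt ℂ F z) (hz : F z ∈ slitPlane) :
    deriv (fun z => rt s (F z)) z * F z = ((1 / (s + 1) : ℝ) : ℂ) * rt s (F z) * deriv F z := by
  have h0 := slitPlane_ne_zero hz
  have : HasDerivAt (fun z => rt s (F z)) _ z :=
    hF.differentiableAt.hasDerivAt.cpow_const (c := ((1 / (s + 1) : ℝ) : ℂ)) hz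
  rw [this.deriv, cpow_sub _ _ h0, cpow_one, rt]
  field_simp

theorem not_eventually_zero_of_mem {φ : ℂ → ℂ} (hφ : AnalyticOnNhd ℂ φ (Metric.ball 0 1))
    (hne : ∃ z ∈ Metric.ball (0 : ℂ) 1, φ z ≠ 0) : ¬ ∀ᶠ z in 𝓝 0, φ z = 0 := by
  intro h
  obtain ⟨z, hz, hz0⟩ := hne
  exact hz0 (hφ.eqOn_zero_of_preconnected_of_eventuallyEq_zero
    (convex_ball 0 1).isPreconnected (Metric.mem_ball_self one_pos) h hz)

theorem not_const_of_zero {F : ℂ → ℂ} {z₀ : ℂ} (hz₀ : z₀ ∈ Metric.ball (0 : ℂ) 1) (hF0 : F 0 = 0)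
    (hFz : F z₀ ≠ 0) : ¬ ∃ w, ∀ z ∈ Metric.ball (0 : ℂ) 1, F z = w := by
  rintro ⟨w, hw⟩
  apply hFz
  rw [hw z₀ hz₀, ← hw 0 (Metric.mem_ball_self one_pos), hF0]

/-- If principal roots of two analytic functions vanishing at the origin have the same real part
on an open set, then the functions coincide. -/
theorem eqOn_of_re_rt_eq {F G : ℂ → ℂ} {s : ℝ} (hs : 0 < s)
    (hF : AnalyticOnNhd ℂ F (Metric.ball 0 1)) (hG : AnalyticOnNhd ℂ G (Metric.ball 0 1))
    (hF0 : F 0 = 0) (hG0 : G 0 = 0) {U : Set ℂ} (hU : IsOpen U) (hUB : U ⊆ Metric.ball 0 1)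
    {z₀ : ℂ} (hz₀ : z₀ ∈ U) (hFz : F z₀ ≠ 0) (hGz : G z₀ ≠ 0)
    (hre : ∀ z ∈ U, (rt s (F z)).re = (rt s (G z)).re) : EqOn F G (Metric.ball 0 1) := by
  have hB : IsPreconnected (Metric.ball (0 : ℂ) 1) := (convex_ball 0 1).isPreconnected
  have hFnc := not_const_of_zero (hUB hz₀) hF0 hFz
  have hGnc := not_const_of_zero (hUB hz₀) hG0 hGz
  obtain ⟨V₁, hV₁U, hV₁o, hV₁n, hV₁⟩ := exists_isOpen_slitPlane hF hB hU hUB ⟨z₀, hz₀⟩ hFnc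
  obtain ⟨V₂, hV₂V, hV₂o, ⟨z₁, hz₁⟩, hV₂⟩ :=
    exists_isOpen_slitPlane hG hB hV₁o (hV₁U.trans hUB) hV₁n hGnc
  obtain ⟨ρ, hρ, hball⟩ := Metric.isOpen_iff.1 hV₂o z₁ hz₁
  set B := Metric.ball z₁ ρ with hBdef
  have hBo : IsOpen B := Metric.isOpen_ball
  have hz₁B : z₁ ∈ B := Metric.mem_ball_self hρ
  have hBF : ∀ z ∈ B, F z ∈ slitPlane := fun z hz => hV₁ z (hV₂V (hball hz))
  have hBG : ∀ z ∈ B, G z ∈ slitPlane := fun z hz => hV₂ z (hball hz)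
  have hBU : B ⊆ U := fun z hz => hV₁U (hV₂V (hball hz))
  have hBD : B ⊆ Metric.ball 0 1 := hBU.trans hUB
  set f : ℂ → ℂ := fun z => rt s (F z) with hf
  set g : ℂ → ℂ := fun z => rt s (G z) with hg
  have hfd : ∀ z ∈ B, DifferentiableAt ℂ f z := fun z hz =>
    (hF z (hBD hz)).differentiableAt.cpow_const (hBF z hz)
  have hgd : ∀ z ∈ B, DifferentiableAt ℂ g z := fun z hz =>
    (hG z (hBD hz)).differentiableAt.cpow_const (hBG z hz)
  -- The difference has zero real part on B, so its image is not open and it must be constant.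
  obtain ⟨κ, hκ⟩ : ∃ κ, ∀ z ∈ B, f z - g z = κ := by
    have han : AnalyticOnNhd ℂ (fun z => f z - g z) B := DifferentiableOn.analyticOnNhd
      (fun z hz => ((hfd z hz).sub (hgd z hz)).differentiableWithinAt) hBo
    rcases han.is_constant_or_isOpen (convex_ball z₁ ρ).isPreconnected with h | h
    · exact h
    · exfalso
      have ho := h B subset_rfl hBo
      have hmem : f z₁ - g z₁ ∈ (fun z => f z - g z) '' B := ⟨z₁, hz₁B, rfl⟩
      have hc : Tendsto (fun t : ℝ => f z₁ - g z₁ + t) (𝓝[>] 0) (𝓝 (f z₁ - g z₁)) := by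
        have : Tendsto (fun t : ℝ => f z₁ - g z₁ + t) (𝓝 0) (𝓝 (f z₁ - g z₁ + (0 : ℝ))) :=
          Continuous.tendsto (by fun_prop) 0
        simpa using this.mono_left nhdsWithin_le_nhds
      obtain ⟨t, ⟨z, hz, ht1⟩, ht2⟩ :=
        ((hc.eventually (ho.mem_nhds hmem)).and self_mem_nhdsWithin).exists
      have h1 := congrArg re ht1
      simp only [hf, hg, sub_re, add_re, ofReal_re, hre z (hBU hz), hre z₁ (hBU hz₁B), sub_self,
        zero_add] at h1
      exact absurd h1.symm (ne_of_gt ht2)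
  by_cases hκ0 : κ = 0
  · refine hF.eqOn_of_preconnected_of_eventuallyEq hG hB (hBD hz₁B) ?_
    filter_upwards [hBo.mem_nhds hz₁B] with z hz
    have h1 : f z = g z := sub_eq_zero.1 ((hκ z hz).trans hκ0)
    rw [← rt_cpow hs (slitPlane_ne_zero (hBF z hz)), ← rt_cpow hs (slitPlane_ne_zero (hBG z hz))]
    exact congrArg (· ^ ((s + 1 : ℝ) : ℂ)) h1
  · exfalso
    set α : ℂ := ((1 / (s + 1) : ℝ) : ℂ) with hα
    have hα0 : α ≠ 0 := by
      have : (1 / (s + 1) : ℝ) ≠ 0 := by positivity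
      rw [hα]
      exact_mod_cast this
    -- From f' = g', f = g + κ and the logarithmic derivatives f'/f = αF'/F, g'/g = αG'/G one gets g
    -- M₂ = M₁. So the root g continues to the disc as the meromorphic function M₁/M₂, although G
    -- vanishes at 0.
    set M₁ : ℂ → ℂ := fun z => κ * (deriv F z * G z) with hM₁
    set M₂ : ℂ → ℂ := fun z => deriv G z * F z - deriv F z * G z with hM₂
    have aM₁ : AnalyticOnNhd ℂ M₁ (Metric.ball 0 1) := fun z hz =>
      analyticAt_const.mul ((hF z hz).deriv.mul (hG z hz))
    have aM₂ : AnalyticOnNhd ℂ M₂ (Metric.ball 0 1) := fun z hz =>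
      ((hG z hz).deriv.mul (hF z hz)).sub ((hF z hz).deriv.mul (hG z hz))
    have hfg : ∀ z ∈ B, f z = g z + κ := fun z hz => by rw [← hκ z hz]; ring
    have hderiv : ∀ z ∈ B, deriv f z = deriv g z := by
      intro z hz
      have : f =ᶠ[𝓝 z] fun z => g z + κ := by
        filter_upwards [hBo.mem_nhds hz] with y hy using hfg y hy
      rw [this.deriv_eq, deriv_add_const]
    have hgM : ∀ z ∈ B, g z * M₂ z = M₁ z := by
      intro z hz
      have e1 := deriv_rt_mul (s := s) (hF z (hBD hz)) (hBF z hz)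
      have e2 := deriv_rt_mul (s := s) (hG z (hBD hz)) (hBG z hz)
      have e3 : deriv f z * F z = α * f z * deriv F z := e1
      have e4 : deriv g z * G z = α * g z * deriv G z := e2
      rw [hderiv z hz, hfg z hz] at e3
      apply mul_left_cancel₀ hα0
      simp only [hM₁, hM₂]
      linear_combination G z * e3 - F z * e4
    have hM₁ne : ∃ z ∈ Metric.ball (0 : ℂ) 1, M₁ z ≠ 0 := by
      by_contra! hc
      have hF' : ∀ z ∈ B, deriv F z = 0 := by
        intro z hz
        have := hc z (hBD hz)
        simp only [hM₁] at this
        exact ((mul_eq_zero.1 this).resolve_left hκ0 |> mul_eq_zero.1).resolve_right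
          (slitPlane_ne_zero (hBG z hz))
      have hconst : ∀ z ∈ B, F z = F z₁ := by
        intro z hz
        refine (convex_ball z₁ ρ).is_const_of_fderivWithin_eq_zero (𝕜 := ℂ) (f := F)
          (fun y hy => (hF y (hBD hy)).differentiableAt.differentiableWithinAt) (fun y hy => ?_)
          hz hz₁B
        rw [fderivWithin_of_isOpen hBo hy]
        ext
        simpa using hF' y hy
      exact hFnc ⟨F z₁, hF.eqOn_of_preconnected_of_eventuallyEq analyticOnNhd_const hB
        (hBD hz₁B) (by filter_upwards [hBo.mem_nhds hz₁B] with z hz using hconst z hz)⟩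
    have hM₂ne : ∃ z ∈ Metric.ball (0 : ℂ) 1, M₂ z ≠ 0 := by
      by_contra! hc
      obtain ⟨z, hz, hz0⟩ := hM₁ne
      apply hz0
      refine aM₁.eqOn_zero_of_preconnected_of_eventuallyEq_zero hB (hBD hz₁B) ?_ hz
      filter_upwards [hBo.mem_nhds hz₁B] with y hy
      rw [← hgM y hy, hc y (hBD hy)]; simp
    -- The relation g'/g = αG'/G for g = M₁/M₂ with denominators cleared, extended from B to the
    -- disc. At 0 it gives ord M₁ - ord M₂ = α ord G > 0, hence M₁/M₂ → 0.
    have hident : EqOn (fun z => (deriv M₁ z * M₂ z - M₁ z * deriv M₂ z) * G z)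
        (fun z => α * (deriv G z * (M₁ z * M₂ z))) (Metric.ball 0 1) := by
      refine AnalyticOnNhd.eqOn_of_preconnected_of_eventuallyEq (𝕜 := ℂ)
        (fun z hz => (((aM₁ z hz).deriv.mul (aM₂ z hz)).sub ((aM₁ z hz).mul (aM₂ z hz).deriv)).mul
          (hG z hz))
        (fun z hz => analyticAt_const.mul ((hG z hz).deriv.mul ((aM₁ z hz).mul (aM₂ z hz)))) hB
        (hBD hz₁B) ?_
      filter_upwards [hBo.mem_nhds hz₁B] with z hz
      have e4 : deriv g z * G z = α * g z * deriv G z :=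
        deriv_rt_mul (s := s) (hG z (hBD hz)) (hBG z hz)
      have e5 : deriv M₁ z = deriv g z * M₂ z + g z * deriv M₂ z := by
        have : M₁ =ᶠ[𝓝 z] fun z => g z * M₂ z := by
          filter_upwards [hBo.mem_nhds hz] with y hy using (hgM y hy).symm
        rw [this.deriv_eq]
        exact ((hgd z hz).hasDerivAt.mul (aM₂ z (hBD hz)).differentiableAt.hasDerivAt).deriv
      rw [e5, ← hgM z hz]
      linear_combination (M₂ z) ^ 2 * e4
    have h0 : (0 : ℂ) ∈ Metric.ball (0 : ℂ) 1 := Metric.mem_ball_self one_pos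
    have nF := not_eventually_zero_of_mem hF ⟨z₀, hUB hz₀, hFz⟩
    have nG := not_eventually_zero_of_mem hG ⟨z₀, hUB hz₀, hGz⟩
    have n1 := not_eventually_zero_of_mem aM₁ hM₁ne
    have n2 := not_eventually_zero_of_mem aM₂ hM₂ne
    obtain ⟨nf, hnf, -, tF⟩ := tendsto_mul_deriv_div (hF 0 h0) nF
    obtain ⟨ng, hng, -, tG⟩ := tendsto_mul_deriv_div (hG 0 h0) nG
    obtain ⟨m1, -, ⟨u₁, cu₁, hu₁, eu₁⟩, t1⟩ := tendsto_mul_deriv_div (aM₁ 0 h0) n1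
    obtain ⟨m2, -, ⟨u₂, cu₂, hu₂, eu₂⟩, t2⟩ := tendsto_mul_deriv_div (aM₂ 0 h0) n2
    have hnz : ∀ᶠ z in 𝓝[≠] (0 : ℂ), F z ≠ 0 ∧ G z ≠ 0 ∧ M₁ z ≠ 0 ∧ M₂ z ≠ 0 :=
      ((hF 0 h0).eventually_eq_zero_or_eventually_ne_zero.resolve_left nF).and
        (((hG 0 h0).eventually_eq_zero_or_eventually_ne_zero.resolve_left nG).and
        (((aM₁ 0 h0).eventually_eq_zero_or_eventually_ne_zero.resolve_left n1).and
        ((aM₂ 0 h0).eventually_eq_zero_or_eventually_ne_zero.resolve_left n2)))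
    have hballev : ∀ᶠ z in 𝓝[≠] (0 : ℂ), z ∈ Metric.ball (0 : ℂ) 1 :=
      nhdsWithin_le_nhds (Metric.isOpen_ball.mem_nhds h0)
    have horder : (m1 : ℂ) - m2 = α * ng := by
      refine tendsto_nhds_unique ((t1.sub t2).congr' ?_) (tG.const_mul α)
      filter_upwards [hnz, hballev] with z ⟨_, g0, e1, e2⟩ hz
      have := hident hz
      simp only at this
      field_simp
      linear_combination z * this
    have hm : m2 < m1 := by
      have h1 : ((m1 : ℝ) - m2 : ℝ) = 1 / (s + 1) * ng := by
        have : (((m1 : ℝ) - m2 : ℝ) : ℂ) = ((1 / (s + 1) * ng : ℝ) : ℂ) := by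
          push_cast
          rw [horder, hα]
          push_cast
          ring
        exact_mod_cast this
      have h2 : (0 : ℝ) < 1 / (s + 1) * ng := by
        have : (0 : ℝ) < ng := by exact_mod_cast hng hG0
        positivity
      have : (m2 : ℝ) < m1 := by linarith
      exact_mod_cast this
    have hquot : Tendsto (fun z => M₁ z / M₂ z) (𝓝[≠] 0) (𝓝 0) := by
      have hc : ContinuousAt (fun z => z ^ (m1 - m2) * (u₁ z / u₂ z)) 0 :=
        (continuousAt_id.pow _).mul (cu₁.div cu₂ hu₂)
      have ht := hc.tendsto.mono_left (nhdsWithin_le_nhds (s := {0}ᶜ))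
      rw [zero_pow (by omega), zero_mul] at ht
      refine ht.congr' ?_
      filter_upwards [nhdsWithin_le_nhds eu₁, nhdsWithin_le_nhds eu₂, self_mem_nhdsWithin,
        nhdsWithin_le_nhds (cu₂.eventually_ne hu₂)] with z e1 e2 hz e4
      have hz' : z ≠ 0 := hz
      rw [e1, e2]
      have : z ^ m1 = z ^ (m1 - m2) * z ^ m2 := by rw [← pow_add]; congr 1; omega
      rw [this]
      field_simp
    -- As z → 0, κ zF'/F = (M₁/M₂)(zG'/G - zF'/F) tends to 0 on the right and to κ ord F on the
    -- left.
    have hcontr : κ * (nf : ℂ) = 0 := by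
      have hlim : Tendsto (fun z => M₁ z / M₂ z * (z * deriv G z / G z - z * deriv F z / F z))
          (𝓝[≠] 0) (𝓝 (0 * (ng - nf))) := hquot.mul (tG.sub tF)
      rw [zero_mul] at hlim
      refine tendsto_nhds_unique ((tF.const_mul κ).congr' ?_) hlim
      filter_upwards [hnz] with z ⟨f0, g0, e1, e2⟩
      have e3 : z * deriv G z / G z - z * deriv F z / F z = z * M₂ z / (F z * G z) := by
        simp only [hM₂]; field_simp
      rw [e3]
      simp only [hM₁]
      field_simp
    have : (nf : ℂ) ≠ 0 := by
      have := hnf hF0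
      exact_mod_cast this.ne'
    exact (mul_ne_zero hκ0 this) hcontr

end PolyMeinardus
end

noncomputable section
namespace PolyMeinardus
open MeasureTheory Complex Set

section
variable {a : ℕ → ℝ} {s₀ σ₀ c : ℝ} {D : ℕ → ℕ → ℂ → ℂ} {A : ℕ → ℕ → ℂ}

/-! ### Phases -/

theorem mem_phaseClass_self {U : Set ℂ} {p q : ℕ} (hpq : IsIndex p q) :
    (p, q) ∈ phaseClass s₀ A U p q := ⟨hpq, fun _ _ => rfl⟩

theorem finite_isIndex_lt (K : ℕ) : {x : ℕ × ℕ | IsIndex x.1 x.2 ∧ x.2 < K}.Finite := by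
  refine (Finset.finite_toSet (Finset.range K ×ˢ Finset.range K)).subset fun x hx => ?_
  have := hx.1.2.1
  simp only [Finset.coe_product, Finset.coe_range, mem_prod, mem_Iio]
  exact ⟨this.trans_lt hx.2, hx.2⟩

/-- At a single point of X all members of the class share a real part at least m, while the real
parts tend to 0 with k; so k is bounded. -/
theorem finite_phaseClass {U X : Set ℂ} {p q : ℕ} {m : ℝ} (hm : 0 < m) (hXne : X.Nonempty)
    (hXU : X ⊆ U) (h4 : ∀ z ∈ X, m ≤ (L s₀ A p q z).re)
    (h5 : ∀ ε : ℝ, 0 < ε → ∃ K : ℕ, ∀ h k : ℕ, IsIndex h k → K ≤ k →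
      ∀ z ∈ X, |(L s₀ A h k z).re| < ε) : (phaseClass s₀ A U p q).Finite := by
  obtain ⟨K, hK⟩ := h5 m hm
  obtain ⟨z, hz⟩ := hXne
  refine (finite_isIndex_lt K).subset fun x hx => ⟨hx.1, ?_⟩
  by_contra! hk
  have h1 := (le_abs_self _).trans_lt (hK x.1 x.2 hx.1 hk z hz)
  rw [hx.2 z (hXU hz)] at h1
  linarith [h4 z hz]

theorem Phi_ne_zero_of_re_pos (hs₀ : 0 < s₀) {h k : ℕ} {z : ℂ} (hz : 0 < (L s₀ A h k z).re) :
    Phi s₀ A h k z ≠ 0 := by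
  intro h0
  rw [L_eq_rt, h0, rt_zero hs₀] at hz
  simp at hz

theorem Phi_eq_of_isOpen (hs₀ : 0 < s₀) {U X : Set ℂ} {p q : ℕ} (hU : U ⊆ Metric.ball 0 1)
    (hUo : IsOpen U) (hXne : X.Nonempty) (hXU : X ⊆ U)
    (h4 : ∀ z ∈ X, 0 < (L s₀ A p q z).re) {x : ℕ × ℕ} (hx : x ∈ phaseClass s₀ A U p q) {z : ℂ}
    (hz : z ∈ U) : Phi s₀ A x.1 x.2 z = Phi s₀ A p q z := by
  obtain ⟨z₀, hz₀⟩ := hXne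
  refine eqOn_of_re_rt_eq hs₀ (analyticOnNhd_Phi hs₀ A x.1 x.2) (analyticOnNhd_Phi hs₀ A p q)
    (Phi_zero _ _ _ _) (Phi_zero _ _ _ _) hUo hU (hXU hz₀) (Phi_ne_zero_of_re_pos hs₀ ?_)
    (Phi_ne_zero_of_re_pos hs₀ (h4 z₀ hz₀)) hx.2 (hU hz)
  rw [hx.2 z₀ (hXU hz₀)]
  exact h4 z₀ hz₀

theorem continuousOn_re_L (hs₀ : 0 < s₀) {X : Set ℂ} (hX : X ⊆ Metric.ball 0 1) (h k : ℕ) :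
    ContinuousOn (fun z => (L s₀ A h k z).re) X :=
  (continuous_re_rt hs₀).comp_continuousOn ((continuousOn_Phi hs₀ A h k).mono hX)

/-- On a compact subset of a phase, all other roots are uniformly smaller in real part. -/
theorem exists_phase_gap (hs₀ : 0 < s₀) {U X : Set ℂ} {p q : ℕ} {m : ℝ} (hm : 0 < m)
    (hU : U ⊆ Metric.ball 0 1) (hXc : IsCompact X) (hXR : X ⊆ phase s₀ A U p q)
    (h4 : ∀ z ∈ X, m ≤ (L s₀ A p q z).re)
    (h5 : ∀ ε : ℝ, 0 < ε → ∃ K : ℕ, ∀ h k : ℕ, IsIndex h k → K ≤ k →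
      ∀ z ∈ X, |(L s₀ A h k z).re| < ε) :
    ∃ g : ℝ, 0 < g ∧ g ≤ m ∧ ∀ h k : ℕ, IsIndex h k → (h, k) ∉ phaseClass s₀ A U p q →
      ∀ z ∈ X, (L s₀ A h k z).re ≤ (L s₀ A p q z).re - g := by
  -- For k ≥ K the gap is at least m/2. For each of the finitely many smaller indices outside the
  -- class, the positive difference of real parts attains its minimum on X.
  obtain ⟨K, hK⟩ := h5 (m / 2) (by positivity)
  have hXB : X ⊆ Metric.ball 0 1 := fun z hz => hU (hXR hz).1
  have hfin : ∀ᶠ g in 𝓝[>] (0 : ℝ), ∀ x ∈ {x : ℕ × ℕ | IsIndex x.1 x.2 ∧ x.2 < K},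
      x ∉ phaseClass s₀ A U p q → ∀ z ∈ X, (L s₀ A x.1 x.2 z).re ≤ (L s₀ A p q z).re - g := by
    refine (Filter.eventually_all_finite (finite_isIndex_lt K)).2 fun x hx => ?_
    by_cases hxc : x ∈ phaseClass s₀ A U p q
    · exact Filter.Eventually.of_forall fun g h => absurd hxc h
    rcases X.eq_empty_or_nonempty with rfl | hne
    · simp
    obtain ⟨z₀, hz₀, hmin⟩ := hXc.exists_isMinOn hne
      ((continuousOn_re_L (A := A) hs₀ hXB p q).sub (continuousOn_re_L (A := A) hs₀ hXB x.1 x.2))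
    have hpos := (hXR hz₀).2 x.1 x.2 hx.1 hxc
    filter_upwards [Ioo_mem_nhdsGT (sub_pos.2 hpos)] with g hg _ z hz
    have := isMinOn_iff.1 hmin z hz
    simp only [Pi.sub_apply] at this
    have hg2 := hg.2
    linarith
  obtain ⟨g, h1, h2⟩ := (hfin.and (Ioo_mem_nhdsGT (half_pos hm))).exists
  refine ⟨g, h2.1, by linarith [h2.2], fun h k hi hc z hz => ?_⟩
  rcases lt_or_ge k K with hk | hk
  · exact h1 (h, k) ⟨hi, hk⟩ hc z hz
  · have := (le_abs_self _).trans_lt (hK h k hi hk z hz)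
    linarith [h4 z hz, h2.2]

/-! ### Cauchy's integral -/

/-- The integrand of Cauchy's integral for `Q_n(z)` over the circle of radius `exp (-x)`. -/
def cauchyIntegrand (a : ℕ → ℝ) (n : ℕ) (z : ℂ) (x ψ : ℝ) : ℂ :=
  P a z (exp (-(x - 2 * Real.pi * I * ψ))) * exp (n * (x - 2 * Real.pi * I * ψ))

theorem arcIntegral_eq (p q : ℕ) (δ : ℝ) (h k n : ℕ) (z : ℂ) :
    arcIntegral a s₀ A p q δ h k n z =
      ∫ ψ in fareyArc ⌊δ * (n : ℝ) ^ (1 / (s₀ + 1))⌋₊ ((h : ℚ) / (k : ℚ)),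
        cauchyIntegrand a n z ((L s₀ A p q z).re / (n : ℝ) ^ (1 / (s₀ + 1))) ψ := rfl

theorem differentiableOn_P (hadm : Admissible a s₀ σ₀ c D A) {z : ℂ} (hz : ‖z‖ < 1) :
    DifferentiableOn ℂ (P a z) (Metric.ball 0 1) := by
  intro q hq
  rw [mem_ball_zero_iff] at hq
  obtain ⟨ρ, hρ1, hρ2⟩ := exists_between hq
  have hρ0 : 0 ≤ ρ := (norm_nonneg q).trans hρ1.le
  have hd : DifferentiableOn ℂ (fun q => ∑' p : ℕ × ℕ,
      (a (p.1 + 1) : ℂ) * ((z * q ^ (p.1 + 1)) ^ (p.2 + 1) / ((p.2 : ℂ) + 1)))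
      (Metric.ball 0 ρ) := by
    have h1 := summable_abs_mul_pow hadm hρ0 hρ2
    have h2 : Summable fun l : ℕ => ‖z‖ ^ l := summable_geometric_of_lt_one (norm_nonneg z) hz
    refine differentiableOn_tsum_of_summable_norm (h1.mul_of_nonneg h2 (fun m => by positivity)
      (fun l => by positivity)) (fun p => by fun_prop) Metric.isOpen_ball fun p w hw => ?_
    rw [mem_ball_zero_iff] at hw
    have e1 : (1 : ℝ) ≤ ‖((p.2 : ℂ) + 1)‖ := by
      have : ((p.2 : ℂ) + 1) = ((p.2 + 1 : ℕ) : ℂ) := by push_cast; ring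
      rw [this, Complex.norm_natCast]
      exact_mod_cast Nat.le_add_left 1 p.2
    rw [norm_mul, norm_real, Real.norm_eq_abs, norm_div, norm_pow, norm_mul, norm_pow, mul_assoc]
    apply mul_le_mul_of_nonneg_left _ (abs_nonneg _)
    refine (div_le_self (by positivity) e1).trans ?_
    rw [mul_pow, mul_comm]
    have e2 : (‖w‖ ^ (p.1 + 1)) ^ (p.2 + 1) ≤ ρ ^ (p.1 + 1) :=
      (pow_le_of_le_one (by positivity) (pow_le_one₀ (norm_nonneg _) (hw.trans hρ2).le)
        p.2.succ_ne_zero).trans (pow_le_pow_left₀ (norm_nonneg _) hw.le _)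
    have e3 : ‖z‖ ^ (p.2 + 1) ≤ ‖z‖ ^ p.2 :=
      pow_le_pow_of_le_one (norm_nonneg _) hz.le (Nat.le_succ _)
    gcongr
  have hP : DifferentiableOn ℂ (P a z) (Metric.ball 0 ρ) := hd.cexp.congr fun w hw =>
    P_eq_exp hadm hz ((mem_ball_zero_iff.1 hw).trans hρ2)
  exact (hP.differentiableAt (Metric.isOpen_ball.mem_nhds
    (mem_ball_zero_iff.2 hρ1))).differentiableWithinAt

theorem norm_exp_neg_lt {x : ℝ} (hx : 0 < x) (ψ : ℝ) :
    ‖exp (-(x - 2 * Real.pi * I * ψ))‖ < 1 := by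
  rw [norm_exp]
  have : (-((x : ℂ) - 2 * Real.pi * I * ψ)).re = -x := by simp
  rw [this]
  exact Real.exp_zero ▸ Real.exp_lt_exp.2 (by linarith)

theorem continuous_cauchyIntegrand (hadm : Admissible a s₀ σ₀ c D A) {z : ℂ} (hz : ‖z‖ < 1)
    (n : ℕ) {x : ℝ} (hx : 0 < x) : Continuous (cauchyIntegrand a n z x) := by
  unfold cauchyIntegrand
  refine Continuous.mul ((differentiableOn_P hadm hz).continuousOn.comp_continuous (by fun_prop)
    fun ψ => mem_ball_zero_iff.2 (norm_exp_neg_lt hx ψ)) (by fun_prop)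

theorem periodic_cauchyIntegrand (n : ℕ) (z : ℂ) (x : ℝ) :
    Function.Periodic (cauchyIntegrand a n z x) 1 := by
  intro ψ
  unfold cauchyIntegrand
  congr 1
  · congr 1
    rw [exp_eq_exp_iff_exists_int]
    exact ⟨1, by push_cast; ring⟩
  · rw [exp_eq_exp_iff_exists_int]
    exact ⟨-n, by push_cast; ring⟩

/-- Cauchy's integral for `Q_n(z)`, over any period. -/
theorem Q_eq_integral (hadm : Admissible a s₀ σ₀ c D A) {z : ℂ} (hz : ‖z‖ < 1)
    (n : ℕ) {x : ℝ} (hx : 0 < x) (t : ℝ) :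
    Q a n z = ∫ ψ in Ioc t (t + 1), cauchyIntegrand a n z x ψ := by
  rw [← intervalIntegral.integral_of_le (by linarith),
    (periodic_cauchyIntegrand n z x).intervalIntegral_add_eq t 0, zero_add]
  have hR : 0 < Real.exp (-x) := Real.exp_pos _
  have hR1 : Real.exp (-x) < 1 := Real.exp_zero ▸ Real.exp_lt_exp.2 (by linarith)
  have hdc : DiffContOnCl ℂ (P a z) (Metric.ball 0 (Real.exp (-x))) :=
    (differentiableOn_P hadm hz).diffContOnCl_ball (Metric.closedBall_subset_ball hR1)
  have hC := hdc.circleIntegral_one_div_sub_center_pow_smul hR n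
  have hfac : (n.factorial : ℂ) ≠ 0 := by exact_mod_cast n.factorial_ne_zero
  have hpi : (2 * Real.pi * I : ℂ) ≠ 0 := two_pi_I_ne_zero
  have hQ : Q a n z = (2 * Real.pi * I)⁻¹ *
      ∮ w in C(0, Real.exp (-x)), (1 / (w - 0) ^ (n + 1)) • P a z w := by
    rw [hC, Q, smul_eq_mul]
    field_simp
  rw [hQ, circleIntegral]
  have hsub := intervalIntegral.integral_comp_mul_left (a := 0) (b := 1)
    (fun θ : ℝ => deriv (circleMap 0 (Real.exp (-x))) θ •
      ((1 / (circleMap 0 (Real.exp (-x)) θ - 0) ^ (n + 1)) •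
        P a z (circleMap 0 (Real.exp (-x)) θ))) (c := 2 * Real.pi) (by positivity)
  rw [mul_zero, mul_one] at hsub
  have hsub' := congrArg (fun w : ℂ => ((2 * Real.pi : ℝ) : ℂ) * w) hsub
  simp only [real_smul] at hsub'
  rw [ofReal_inv, mul_inv_cancel_left₀ (by exact_mod_cast (by positivity : (2 * Real.pi : ℝ) ≠ 0))]
    at hsub'
  rw [← hsub', ← mul_assoc, ← intervalIntegral.integral_const_mul]
  refine intervalIntegral.integral_congr fun ψ _ => ?_
  have hcm : circleMap 0 (Real.exp (-x)) (2 * Real.pi * ψ) =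
      exp (-(x - 2 * Real.pi * I * ψ)) := by
    rw [circleMap, zero_add, ofReal_exp, ← Complex.exp_add]
    congr 1; push_cast; ring
  have hinv : exp (n * (x - 2 * Real.pi * I * ψ)) =
      (exp (-(x - 2 * Real.pi * I * ψ)) ^ n)⁻¹ := by
    rw [← Complex.exp_nat_mul, ← Complex.exp_neg]
    congr 1; ring
  simp only [deriv_circleMap, hcm, sub_zero, smul_eq_mul, cauchyIntegrand, hinv]
  have := exp_ne_zero (-(x - 2 * Real.pi * I * ψ))
  push_cast
  have hp : (Real.pi : ℂ) ≠ 0 := by exact_mod_cast Real.pi_ne_zero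
  have hI := I_ne_zero
  field_simp
  ring
end
end PolyMeinardus
end

noncomputable section
namespace PolyMeinardus
open MeasureTheory Complex Set

section
variable {a : ℕ → ℝ} {s₀ σ₀ c : ℝ} {D : ℕ → ℕ → ℂ → ℂ} {A : ℕ → ℕ → ℂ}

/-! ### The integrand on a Farey arc -/

theorem rpow_scale {s₀ : ℝ} (hs₀ : 0 < s₀) {n : ℕ} (hn : 0 < n) :
    0 < (n : ℝ) ^ (1 / (s₀ + 1)) ∧
    (n : ℝ) ^ (s₀ / (s₀ + 1)) = ((n : ℝ) ^ (1 / (s₀ + 1))) ^ s₀ ∧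
    (n : ℝ) = (n : ℝ) ^ (s₀ / (s₀ + 1)) * (n : ℝ) ^ (1 / (s₀ + 1)) := by
  have hn' : (0 : ℝ) < n := by exact_mod_cast hn
  refine ⟨by positivity, ?_, ?_⟩
  · rw [← Real.rpow_mul hn'.le]
    congr 1; ring
  · rw [← Real.rpow_add hn', ← add_div, div_self (by linarith), Real.rpow_one]

theorem abs_arg_le_arctan {v : ℂ} {T : ℝ} (hv : 0 < v.re) (hT : |v.im| ≤ T * v.re) :
    |arg v| ≤ Real.arctan T := by
  have h1 := abs_lt.1 (abs_arg_lt_pi_div_two_iff.2 (Or.inl hv))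
  have h2 : arg v = Real.arctan (v.im / v.re) := by
    rw [← tan_arg, Real.arctan_tan h1.1 h1.2]
  obtain ⟨h3, h4⟩ := abs_le.1 hT
  rw [h2, abs_le, ← Real.arctan_neg]
  constructor
  · apply Real.arctan_mono
    rw [le_div_iff₀ hv]; linarith
  · apply Real.arctan_mono
    rw [div_le_iff₀ hv]; exact h4

theorem norm_omega (h k n : ℕ) (z : ℂ) : ‖omega D h k n z‖ = ‖omega D h k 0 z‖ := by
  rw [omega_eq, norm_mul, norm_e, one_mul]

/-- The variable `n^{1/(s₀+1)} (x - 2πi(ψ - h/k))`, where `x = n^{-1/(s₀+1)} ℓ`. -/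
def arcPoint (s₀ : ℝ) (h k n : ℕ) (ℓ ψ : ℝ) : ℂ :=
  (ℓ : ℂ) + ((-(2 * Real.pi * (n : ℝ) ^ (1 / (s₀ + 1))) * (ψ - (h : ℝ) / k) : ℝ) : ℂ) * I

theorem arcPoint_re (h k n : ℕ) (ℓ ψ : ℝ) : (arcPoint s₀ h k n ℓ ψ).re = ℓ := by
  simp [arcPoint]

theorem arcPoint_im (h k n : ℕ) (ℓ ψ : ℝ) : (arcPoint s₀ h k n ℓ ψ).im =
    -(2 * Real.pi * (n : ℝ) ^ (1 / (s₀ + 1))) * (ψ - (h : ℝ) / k) := by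
  simp only [arcPoint, add_im, ofReal_im, im_ofReal_mul, I_im, mul_one, zero_add]

/-- `exists_P_expansion` at w = v/ν with v = `arcPoint`: both nw = λv and Φ/(s₀w^{s₀}) =
λΦ/(s₀v^{s₀}) carry the large parameter λ, so the exponent is λ times `phaseFun`. The character
e(-hn/k) is absorbed by ω_{h,k,n}. -/
theorem exists_cauchyIntegrand_eq (hadm : Admissible a s₀ σ₀ c D A) (hs₀ : 0 < s₀)
    (hs₀c : s₀ < c) (hσ₀ : -1 < σ₀) (hσ₀' : σ₀ < 0) {r θ₀ : ℝ} (hr : r < 1) (hθ0 : 0 ≤ θ₀)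
    (hθ₀ : θ₀ < Real.pi / 2) :
    ∃ C : ℝ, 0 < C ∧ ∀ h k : ℕ, 0 < k → ∀ z : ℂ, ‖z‖ ≤ r → ∀ n : ℕ, 0 < n → ∀ ℓ ψ : ℝ, 0 < ℓ →
      |arg (arcPoint s₀ h k n ℓ ψ)| ≤ θ₀ →
      ∃ E : ℂ, cauchyIntegrand a n z (ℓ / (n : ℝ) ^ (1 / (s₀ + 1))) ψ =
        omega D h k n z * (exp (((n : ℝ) ^ (s₀ / (s₀ + 1)) : ℝ) *
          phaseFun s₀ (Phi s₀ A h k z) (arcPoint s₀ h k n ℓ ψ)) * exp E) ∧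
        ‖E‖ ≤ C * (k : ℝ) ^ (s₀ - σ₀) *
          (‖arcPoint s₀ h k n ℓ ψ‖ / (n : ℝ) ^ (1 / (s₀ + 1))) ^ (-σ₀) := by
  obtain ⟨C, hC, hP⟩ := exists_P_expansion hadm hs₀ hs₀c hσ₀ hσ₀' hr hθ0 hθ₀
  refine ⟨C, hC, fun h k hk z hz n hn ℓ ψ hℓ harg => ?_⟩
  obtain ⟨hν, hlam, hnn⟩ := rpow_scale hs₀ hn
  set ν : ℝ := (n : ℝ) ^ (1 / (s₀ + 1)) with hνd
  set lam : ℝ := (n : ℝ) ^ (s₀ / (s₀ + 1)) with hlamd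
  set v := arcPoint s₀ h k n ℓ ψ with hv
  have hvre : v.re = ℓ := arcPoint_re h k n ℓ ψ
  have hv0 : v ≠ 0 := by
    intro h0
    rw [h0, zero_re] at hvre
    linarith
  have hνC : (ν : ℂ) ≠ 0 := by exact_mod_cast hν.ne'
  have hkC : (k : ℂ) ≠ 0 := by exact_mod_cast hk.ne'
  set w : ℂ := ((ν⁻¹ : ℝ) : ℂ) * v with hw
  have hwre : w.re = ℓ / ν := by rw [hw, re_ofReal_mul, hvre]; ring
  have hwarg : arg w = arg v := arg_real_mul v (inv_pos.2 hν)
  have hwexp : (((ℓ / ν : ℝ) : ℂ) - 2 * Real.pi * I * ψ) = w - 2 * Real.pi * I * ((h : ℝ) / k : ℝ) := by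
    rw [hw, hv, arcPoint]
    push_cast
    field_simp
    ring
  have hwn : ‖w‖ = ‖v‖ / ν := by
    rw [hw, norm_mul, norm_real, Real.norm_of_nonneg (by positivity)]; ring
  obtain ⟨E, hE1, hE2⟩ := hP h k hk z hz w (by rw [hwre]; positivity) (by rw [hwarg]; exact harg)
  refine ⟨E, ?_, by rwa [hwn] at hE2⟩
  have hwpow : w ^ (s₀ : ℂ) = v ^ (s₀ : ℂ) / (lam : ℂ) := by
    rw [hw, ofReal_mul_cpow (inv_pos.2 hν) hv0, hlam]
    rw [← ofReal_cpow (inv_pos.2 hν).le, Real.inv_rpow hν.le]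
    push_cast
    field_simp
  have hlam0 : (lam : ℂ) ≠ 0 := by
    rw [hlam]
    have : ν ^ s₀ ≠ 0 := by positivity
    exact_mod_cast this
  have hvs : v ^ (s₀ : ℂ) ≠ 0 := by
    rw [Ne, cpow_eq_zero_iff]; exact fun h => hv0 h.1
  have hs₀C : (s₀ : ℂ) ≠ 0 := by exact_mod_cast hs₀.ne'
  rw [cauchyIntegrand, hwexp]
  have e1 : exp (-(w - 2 * Real.pi * I * ((h : ℝ) / k : ℝ))) = exp (-w) * e ((h : ℝ) / k) := by
    rw [e, ← Complex.exp_add]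
    congr 1; ring
  have hnC : (n : ℂ) = (lam : ℂ) * ν := by exact_mod_cast hnn
  have e2 : exp (n * (w - 2 * Real.pi * I * ((h : ℝ) / k : ℝ))) =
      exp (lam * v) * e (-((h : ℝ) * n / k)) := by
    rw [e, ← Complex.exp_add, mul_sub]
    congr 1
    have : (n : ℂ) * w = lam * v := by
      rw [hw, hnC]; push_cast; field_simp
    rw [this]
    push_cast
    ring
  have e3 : exp (lam * phaseFun s₀ (Phi s₀ A h k z) v) =
      exp (lam * v) * exp (Phi s₀ A h k z / (s₀ * w ^ (s₀ : ℂ))) := by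
    rw [← Complex.exp_add, hwpow, phaseFun]
    congr 1
    field_simp
  rw [e1, hE1, e2, e3, omega_eq D h k n z]
  ring

/-- A gap g between Re v and the real part of the root becomes a gap g/s in the exponent, since
max(Re L, 0)^{s+1} ≤ (Re v)^s (Re v - g). -/
theorem re_phaseFun_le {s : ℝ} (hs : 0 < s) {v Φ : ℂ} {g : ℝ} (hg : 0 ≤ g) (hv : 0 < v.re)
    (hgv : g ≤ v.re) (hΦ : (rt s Φ).re ≤ v.re - g) :
    (phaseFun s Φ v).re ≤ (s + 1) / s * v.re - g / s := by
  have h1 := re_div_cpow_le hs hv Φ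
  have h2 : max (rt s Φ).re 0 ≤ v.re - g := max_le hΦ (by linarith)
  have h3 : max (rt s Φ).re 0 ^ (s + 1) ≤ v.re ^ s * (v.re - g) := by
    rw [Real.rpow_add' (le_max_right _ _) (by linarith), Real.rpow_one]
    have : max (rt s Φ).re 0 ^ s ≤ v.re ^ s :=
      Real.rpow_le_rpow (le_max_right _ _) (by linarith) hs.le
    exact mul_le_mul this h2 (le_max_right _ _) (by positivity)
  have h4 : (Φ / v ^ (s : ℂ)).re ≤ v.re - g := by
    refine h1.trans ?_
    rw [div_le_iff₀ (by positivity)]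
    linarith
  have h5 : phaseFun s Φ v = v + ((s⁻¹ : ℝ) : ℂ) * (Φ / v ^ (s : ℂ)) := by
    rw [phaseFun, div_mul_eq_div_div]; push_cast; ring
  rw [h5, add_re, re_ofReal_mul]
  have h6 : s⁻¹ * (Φ / v ^ (s : ℂ)).re ≤ s⁻¹ * (v.re - g) := by gcongr
  have h7 : (s + 1) / s * v.re - g / s = v.re + s⁻¹ * (v.re - g) := by field_simp; ring
  linarith

theorem abs_arcPoint_im_le {δ : ℝ} (hδ : 0 < δ) {h k n : ℕ} (hi : IsIndex h k) (hn : 0 < n)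
    (hk : k ≤ ⌊δ * (n : ℝ) ^ (1 / (s₀ + 1))⌋₊) {ψ : ℝ}
    (hψ : ψ ∈ fareyArc ⌊δ * (n : ℝ) ^ (1 / (s₀ + 1))⌋₊ ((h : ℚ) / (k : ℚ))) (ℓ : ℝ) :
    |(arcPoint s₀ h k n ℓ ψ).im| ≤ 2 * Real.pi / (k * δ) := by
  have hn' : (0 : ℝ) < n := by exact_mod_cast hn
  have hk0 : (0 : ℝ) < k := by exact_mod_cast hi.1.trans_le hi.2.1
  set ν : ℝ := (n : ℝ) ^ (1 / (s₀ + 1)) with hν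
  have hν0 : 0 < ν := by positivity
  have hden := den_div_of_isIndex hi
  obtain ⟨u, v, harc, -, hu, -, hv⟩ := exists_fareyArc_eq (hden.trans_le hk)
  rw [harc] at hψ
  rw [hden] at hu hv
  push_cast at hψ
  have hN : δ * ν < (⌊δ * ν⌋₊ : ℝ) + 1 := Nat.lt_floor_add_one _
  have hb : 1 / ((k : ℝ) * ((⌊δ * ν⌋₊ : ℝ) + 1)) ≤ 1 / (k * (δ * ν)) := by gcongr
  have hφ : |ψ - (h : ℝ) / k| ≤ 1 / (k * (δ * ν)) := by
    rw [abs_le]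
    constructor <;> linarith [hψ.1, hψ.2]
  rw [arcPoint_im, ← hν, abs_mul, abs_neg, abs_of_pos (by positivity)]
  calc 2 * Real.pi * ν * |ψ - (h : ℝ) / k| ≤ 2 * Real.pi * ν * (1 / (k * (δ * ν))) := by gcongr
    _ = 2 * Real.pi / (k * δ) := by field_simp

theorem norm_arcPoint_le {h k n : ℕ} {ℓ ψ Y : ℝ} (hℓ : 0 < ℓ)
    (hY : |(arcPoint s₀ h k n ℓ ψ).im| ≤ Y) : ‖arcPoint s₀ h k n ℓ ψ‖ ≤ ℓ + Y := by
  refine (norm_le_abs_re_add_abs_im _).trans ?_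
  rw [arcPoint_re, abs_of_pos hℓ]
  linarith

theorem norm_integrand_le {s : ℝ} {Φ v ω E W : ℂ} {lam g ℓ : ℝ} (hlam : 0 ≤ lam)
    (hω : ω = exp W) (hre : (phaseFun s Φ v).re ≤ (s + 1) / s * ℓ - g / s)
    (hE : ‖E‖ ≤ g / (4 * s) * lam) (hW : ‖W‖ ≤ g / (4 * s) * lam) :
    ‖ω‖ * ‖exp (lam * phaseFun s Φ v) * exp E‖ ≤
      Real.exp (lam * ((s + 1) / s * ℓ - g / (2 * s))) := by
  rw [hω, norm_mul, norm_exp, norm_exp, norm_exp, ← Real.exp_add, ← Real.exp_add, re_ofReal_mul]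
  apply Real.exp_le_exp.2
  have h1 := mul_le_mul_of_nonneg_left hre hlam
  have h2 := (re_le_norm E).trans hE
  have h3 := (re_le_norm W).trans hW
  have h4 : lam * ((s + 1) / s * ℓ - g / (2 * s)) =
    lam * ((s + 1) / s * ℓ - g / s) + g / (4 * s) * lam + g / (4 * s) * lam := by ring
  linarith

/-- The integrand is exponentially small on the arcs about `h/k` when `Re L_{h,k}` is smaller
than `ℓ` by a fixed amount. -/
theorem exists_minor_arc_bound (hadm : Admissible a s₀ σ₀ c D A) (hs₀ : 0 < s₀)
    (hs₀c : s₀ < c) (hσ₀ : -1 < σ₀) (hσ₀' : σ₀ < 0) {r m M g : ℝ} (hr : r < 1)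
    (hm : 0 < m) (hmM : m ≤ M) (hg : 0 < g) (hgm : g ≤ m) :
    ∃ δ₀ : ℝ, 0 < δ₀ ∧ ∀ δ : ℝ, 0 < δ → δ < δ₀ → ∀ᶠ n : ℕ in atTop, ∀ h k : ℕ, IsIndex h k →
      k ≤ ⌊δ * (n : ℝ) ^ (1 / (s₀ + 1))⌋₊ → ∀ z : ℂ, ‖z‖ ≤ r → ∀ ℓ : ℝ, m ≤ ℓ → ℓ ≤ M →
      (L s₀ A h k z).re ≤ ℓ - g →
      ∀ ψ ∈ fareyArc ⌊δ * (n : ℝ) ^ (1 / (s₀ + 1))⌋₊ ((h : ℚ) / (k : ℚ)),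
      ‖cauchyIntegrand a n z (ℓ / (n : ℝ) ^ (1 / (s₀ + 1))) ψ‖ ≤
        Real.exp ((n : ℝ) ^ (s₀ / (s₀ + 1)) * ((s₀ + 1) / s₀ * ℓ - g / (2 * s₀))) := by
  have hM : 0 < M := hm.trans_le hmM
  obtain ⟨C₁, hC₁, hP₁⟩ := exists_cauchyIntegrand_eq hadm hs₀ hs₀c hσ₀ hσ₀' hr
    (θ₀ := Real.arctan 1) (Real.arctan_nonneg.2 zero_le_one) (Real.arctan_lt_pi_div_two _)
  obtain ⟨C₂, hC₂, hω⟩ := exists_norm_log_omega_le hadm hs₀ hs₀c hσ₀' hr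
  have hsmall : ∀ (K x : ℝ), 0 < x → ∀ᶠ δ in 𝓝[>] (0 : ℝ), K * δ ^ x ≤ g / (4 * s₀) := by
    intro K x hx
    have : Tendsto (fun δ : ℝ => K * δ ^ x) (𝓝[>] 0) (𝓝 (K * 0 ^ x)) :=
      (((Real.continuousAt_rpow_const 0 x (Or.inr hx.le)).tendsto).mono_left
        nhdsWithin_le_nhds).const_mul K
    rw [Real.zero_rpow hx.ne', mul_zero] at this
    exact (this.eventually (gt_mem_nhds (by positivity : (0 : ℝ) < g / (4 * s₀)))).mono
      fun _ h => le_of_lt h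
  -- Each of log ω and E may use a quarter of the gap g/s₀. With k ≤ δν they are at most λ times a
  -- constant times δ^{s₀} and δ^{s₀-σ₀}, respectively; for this the constant C₁ must not depend on
  -- δ.
  obtain ⟨δ₀, hδ₀, hsub⟩ := mem_nhdsGT_iff_exists_Ioo_subset.1
    ((hsmall (C₁ * (2 * M) ^ (-σ₀)) (s₀ - σ₀) (by linarith)).and (hsmall C₂ s₀ hs₀))
  refine ⟨δ₀, hδ₀, fun δ hδ hδ1 => ?_⟩
  obtain ⟨hδE, hδW⟩ := hsub ⟨hδ, hδ1⟩
  -- For k ≥ T the arc has |Im v| ≤ Re v, a sector independent of δ. For k ≤ T the sector depends on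
  -- δ, but k is bounded, so log ω and E are O(1) and large n suffices.
  set T : ℝ := 2 * Real.pi / (δ * m) with hT
  have hT0 : 0 < T := by positivity
  obtain ⟨C₃, hC₃, hP₃⟩ := exists_cauchyIntegrand_eq hadm hs₀ hs₀c hσ₀ hσ₀' hr
    (θ₀ := Real.arctan T) (Real.arctan_nonneg.2 hT0.le) (Real.arctan_lt_pi_div_two _)
  set V : ℝ := M + 2 * Real.pi / δ with hV
  have hV0 : 0 < V := by positivity
  have hlamtop : Tendsto (fun n : ℕ => g / (4 * s₀) * (n : ℝ) ^ (s₀ / (s₀ + 1))) atTop atTop :=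
    ((tendsto_rpow_atTop (by positivity)).comp tendsto_natCast_atTop_atTop).const_mul_atTop
      (by positivity)
  filter_upwards [eventually_gt_atTop 0, hlamtop.eventually_ge_atTop (C₃ * T ^ (s₀ - σ₀) * V ^ (-σ₀)),
    hlamtop.eventually_ge_atTop (C₂ * T ^ s₀)] with n hn hnE hnW
  intro h k hi hk z hz ℓ hmℓ hℓM hL ψ hψ
  have hℓ0 : 0 < ℓ := hm.trans_le hmℓ
  have hk0 : 0 < k := hi.1.trans_le hi.2.1
  have hkR : (0 : ℝ) < k := by exact_mod_cast hk0
  have hk1 : (1 : ℝ) ≤ k := by exact_mod_cast hk0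
  obtain ⟨hν, hlam, hnn⟩ := rpow_scale hs₀ hn
  have him := abs_arcPoint_im_le hδ hi hn hk hψ ℓ
  have hn1 : (1 : ℝ) ≤ n := by exact_mod_cast hn
  have hν1 : (1 : ℝ) ≤ (n : ℝ) ^ (1 / (s₀ + 1)) := Real.one_le_rpow hn1 (by positivity)
  have hkν : (k : ℝ) ≤ δ * (n : ℝ) ^ (1 / (s₀ + 1)) :=
    (by exact_mod_cast hk : (k : ℝ) ≤ (⌊δ * (n : ℝ) ^ (1 / (s₀ + 1))⌋₊ : ℝ)).trans
      (Nat.floor_le (by positivity))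
  set ν : ℝ := (n : ℝ) ^ (1 / (s₀ + 1)) with hνd
  set lam : ℝ := (n : ℝ) ^ (s₀ / (s₀ + 1)) with hlamd
  have hlam0 : 0 ≤ lam := by rw [hlam]; positivity
  set v := arcPoint s₀ h k n ℓ ψ with hv
  have hvre : v.re = ℓ := arcPoint_re h k n ℓ ψ
  obtain ⟨W, hW1, hW2⟩ := hω h k hk0 z hz
  have hre : (phaseFun s₀ (Phi s₀ A h k z) v).re ≤ (s₀ + 1) / s₀ * ℓ - g / s₀ := by
    have := re_phaseFun_le hs₀ hg.le (by rw [hvre]; exact hℓ0) (by rw [hvre]; linarith)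
      (by rw [hvre, ← L_eq_rt]; exact hL)
    rwa [hvre] at this
  have hvn := norm_arcPoint_le hℓ0 him
  rw [← hv] at hvn
  rcases le_total T k with hTk | hkT
  · have him' : |v.im| ≤ ℓ := by
      refine him.trans (le_trans ?_ hmℓ)
      rw [div_le_iff₀ (by positivity)]
      rw [hT, div_le_iff₀ (by positivity)] at hTk
      linarith
    obtain ⟨E, hE1, hE2⟩ := hP₁ h k hk0 z hz n hn ℓ ψ hℓ0
      (abs_arg_le_arctan (by rw [arcPoint_re]; exact hℓ0) (by rw [arcPoint_re, one_mul]; exact him'))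
    rw [hE1, norm_mul, norm_omega]
    refine norm_integrand_le hlam0 hW1 hre (hE2.trans ?_) (hW2.trans ?_)
    · have hvn' : ‖v‖ ≤ 2 * M := by
        have := norm_arcPoint_le hℓ0 him'
        rw [← hv] at this
        linarith
      calc C₁ * (k : ℝ) ^ (s₀ - σ₀) * (‖v‖ / ν) ^ (-σ₀)
          ≤ C₁ * (δ * ν) ^ (s₀ - σ₀) * ((2 * M) / ν) ^ (-σ₀) := by
            gcongr
            · linarith
            · linarith
        _ = (C₁ * (2 * M) ^ (-σ₀) * δ ^ (s₀ - σ₀)) * lam := by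
            rw [hlam, Real.mul_rpow hδ.le hν.le, Real.div_rpow (by positivity) hν.le,
              sub_eq_add_neg s₀, Real.rpow_add hν]
            have : ν ^ (-σ₀) ≠ 0 := by positivity
            field_simp
        _ ≤ _ := by gcongr
    · calc C₂ * (k : ℝ) ^ s₀ ≤ C₂ * (δ * ν) ^ s₀ := by gcongr
        _ = C₂ * δ ^ s₀ * lam := by rw [hlam, Real.mul_rpow hδ.le hν.le]; ring
        _ ≤ _ := by gcongr
  · have hkδ : 2 * Real.pi / (k * δ) ≤ 2 * Real.pi / δ := by
      gcongr
      nlinarith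
    have him' : |v.im| ≤ T * ℓ := by
      refine (him.trans hkδ).trans ?_
      have : 2 * Real.pi / δ = T * m := by rw [hT]; field_simp
      rw [this]
      gcongr
    obtain ⟨E, hE1, hE2⟩ := hP₃ h k hk0 z hz n hn ℓ ψ hℓ0
      (abs_arg_le_arctan (by rw [arcPoint_re]; exact hℓ0) (by rw [arcPoint_re]; exact him'))
    rw [hE1, norm_mul, norm_omega]
    refine norm_integrand_le hlam0 hW1 hre ((hE2.trans ?_).trans hnE) ((hW2.trans ?_).trans hnW)
    · have hvV : ‖v‖ / ν ≤ V := (div_le_self (norm_nonneg _) hν1).trans (by linarith)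
      gcongr
      · linarith
      · linarith
    · gcongr
end
end PolyMeinardus
end

noncomputable section
namespace PolyMeinardus
open MeasureTheory Complex Set

section
variable {a : ℕ → ℝ} {s₀ σ₀ c : ℝ} {D : ℕ → ℕ → ℂ → ℂ} {A : ℕ → ℕ → ℂ}

/-! ### Reduction to the major arcs -/

theorem measurableSet_fareyArc {N : ℕ} {r : ℚ} (hr : r.den ≤ N) : MeasurableSet (fareyArc N r) := by
  obtain ⟨u, v, h, -⟩ := exists_fareyArc_eq hr
  rw [h]
  exact measurableSet_Ioc

/-- The integral of a function over a period differs from the sum of its integrals over some Farey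
arcs at most by a bound of the function on the other arcs. -/
theorem norm_integral_sub_sum_fareyArc_le {N : ℕ} (hN : 0 < N) {G : ℝ → ℂ} (hG : Continuous G)
    {S : Finset (ℕ × ℕ)} (hS : ∀ x ∈ S, IsIndex x.1 x.2 ∧ x.2 ≤ N) {B : ℝ}
    (hB : ∀ h k : ℕ, IsIndex h k → k ≤ N → (h, k) ∉ S →
      ∀ ψ ∈ fareyArc N ((h : ℚ) / (k : ℚ)), ‖G ψ‖ ≤ B) (hB0 : 0 ≤ B) :
    ‖(∫ ψ in Ioc (1 / ((N : ℝ) + 1)) (1 / ((N : ℝ) + 1) + 1), G ψ) -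
      ∑ x ∈ S, ∫ ψ in fareyArc N ((x.1 : ℚ) / (x.2 : ℚ)), G ψ‖ ≤ B := by
  set T := Ioc (1 / ((N : ℝ) + 1)) (1 / ((N : ℝ) + 1) + 1) with hT
  have hTe : T = Ioc (1 / ((N : ℝ) + 1)) (1 + 1 / ((N : ℝ) + 1)) := by rw [hT, add_comm (1 : ℝ)]
  set arc : ℕ × ℕ → Set ℝ := fun x => fareyArc N ((x.1 : ℚ) / (x.2 : ℚ)) with harc
  have hden : ∀ x ∈ S, ((x.1 : ℚ) / (x.2 : ℚ)).den ≤ N := fun x hx => by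
    rw [den_div_of_isIndex (hS x hx).1]; exact (hS x hx).2
  have hsub : ∀ x ∈ S, arc x ⊆ T := fun x hx => by
    rw [hTe]; exact fareyArc_subset_period (hS x hx).1 (hS x hx).2
  have hGT : IntegrableOn G T := (hG.integrableOn_Icc).mono_set Ioc_subset_Icc_self
  have hmeas : ∀ x ∈ S, MeasurableSet (arc x) := fun x hx => measurableSet_fareyArc (hden x hx)
  have hUm : MeasurableSet (⋃ x ∈ S, arc x) := S.measurableSet_biUnion hmeas
  have hUT : (⋃ x ∈ S, arc x) ⊆ T := iUnion₂_subset hsub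
  have hsum : ∫ ψ in ⋃ x ∈ S, arc x, G ψ = ∑ x ∈ S, ∫ ψ in arc x, G ψ := by
    refine integral_biUnion_finset S hmeas (fun x hx y hy hxy => ?_)
      (fun x hx => hGT.mono_set (hsub x hx))
    exact disjoint_fareyArc (hden x hx) (hden y hy) fun he =>
      hxy (div_injective_of_isIndex (hS x hx).1 (hS y hy).1 he)
  have hsplit := integral_inter_add_sdiff hUm hGT
  rw [inter_eq_self_of_subset_right hUT, hsum] at hsplit
  rw [← hsplit, add_sub_cancel_left]
  have hvolT : volume T = 1 := by rw [hT, Real.volume_Ioc]; simp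
  have hvol : volume (T \ ⋃ x ∈ S, arc x) ≤ 1 := hvolT ▸ measure_mono sdiff_subset
  have hbd : ∀ ψ ∈ T \ ⋃ x ∈ S, arc x, ‖G ψ‖ ≤ B := by
    rintro ψ ⟨hψ, hψU⟩
    rw [hTe] at hψ
    obtain ⟨h, k, hi, hk, hmem⟩ := exists_isIndex_mem_fareyArc hN hψ
    refine hB h k hi hk (fun hS' => hψU ?_) ψ hmem
    exact mem_iUnion₂.2 ⟨(h, k), hS', hmem⟩
  refine (norm_setIntegral_le_of_norm_le_const (hvol.trans_lt ENNReal.one_lt_top) hbd).trans ?_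
  have : volume.real (T \ ⋃ x ∈ S, arc x) ≤ 1 := ENNReal.toReal_mono ENNReal.one_ne_top hvol
  exact mul_le_of_le_one_right hB0 this

theorem tendsto_floor_mul_rpow {δ : ℝ} (hδ : 0 < δ) (hs₀ : 0 < s₀) :
    Tendsto (fun n : ℕ => ⌊δ * (n : ℝ) ^ (1 / (s₀ + 1))⌋₊) atTop atTop :=
  tendsto_nat_floor_atTop.comp
    (((tendsto_rpow_atTop (by positivity)).comp tendsto_natCast_atTop_atTop).const_mul_atTop hδ)

/-- A period has length 1, so a pointwise bound on the remaining arcs bounds their total. For large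
n the Farey order exceeds all denominators in S. -/
theorem exists_norm_Q_sub_sum_le (hadm : Admissible a s₀ σ₀ c D A) (hs₀ : 0 < s₀)
    (hs₀c : s₀ < c) (hσ₀ : -1 < σ₀) (hσ₀' : σ₀ < 0) {r m M g : ℝ} (hr : r < 1)
    (hm : 0 < m) (hmM : m ≤ M) (hg : 0 < g) (hgm : g ≤ m) {p q : ℕ} {X : Set ℂ}
    (hX : ∀ z ∈ X, ‖z‖ ≤ r) (h4 : ∀ z ∈ X, m ≤ (L s₀ A p q z).re ∧ (L s₀ A p q z).re ≤ M)
    {S : Finset (ℕ × ℕ)} (hS : ∀ x ∈ S, IsIndex x.1 x.2)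
    (hgap : ∀ h k : ℕ, IsIndex h k → (h, k) ∉ S →
      ∀ z ∈ X, (L s₀ A h k z).re ≤ (L s₀ A p q z).re - g) :
    ∃ δ₀ : ℝ, 0 < δ₀ ∧ ∀ δ : ℝ, 0 < δ → δ < δ₀ → ∀ᶠ n : ℕ in atTop, ∀ z ∈ X,
      ‖Q a n z - ∑ x ∈ S, arcIntegral a s₀ A p q δ x.1 x.2 n z‖ ≤
        Real.exp ((n : ℝ) ^ (s₀ / (s₀ + 1)) *
          ((s₀ + 1) / s₀ * (L s₀ A p q z).re - g / (2 * s₀))) := by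
  obtain ⟨δ₀, hδ₀, hmin⟩ := exists_minor_arc_bound hadm hs₀ hs₀c hσ₀ hσ₀' hr hm hmM hg hgm
  refine ⟨δ₀, hδ₀, fun δ hδ hδ1 => ?_⟩
  have hN := tendsto_floor_mul_rpow hδ hs₀
  filter_upwards [hmin δ hδ hδ1, eventually_gt_atTop 0, hN.eventually_gt_atTop 0,
    hN.eventually_ge_atTop (S.sup Prod.snd)] with n h1 hn hN0 hNS z hz
  have hℓ : 0 < (L s₀ A p q z).re := hm.trans_le (h4 z hz).1
  have hx : 0 < (L s₀ A p q z).re / (n : ℝ) ^ (1 / (s₀ + 1)) := div_pos hℓ (rpow_scale hs₀ hn).1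
  have hz1 : ‖z‖ < 1 := (hX z hz).trans_lt hr
  rw [Q_eq_integral hadm hz1 n hx (1 / ((⌊δ * (n : ℝ) ^ (1 / (s₀ + 1))⌋₊ : ℝ) + 1))]
  refine norm_integral_sub_sum_fareyArc_le hN0 (continuous_cauchyIntegrand hadm hz1 n hx)
    (fun x hx => ⟨hS x hx, (Finset.le_sup (f := Prod.snd) hx).trans hNS⟩)
    (fun h k hi hk hnS ψ hψ => ?_) (Real.exp_pos _).le
  exact h1 h k hi hk z (hX z hz) _ (h4 z hz).1 (h4 z hz).2 (hgap h k hi hnS z hz) ψ hψ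

end
end PolyMeinardus
end

noncomputable section
namespace PolyMeinardus
open MeasureTheory Complex Set

/-! ### The contribution of a saddle point -/

/-- The contribution of the saddle point `S` to the coefficient of index `n`. -/
def saddleTerm (s : ℝ) (n : ℕ) (S : ℂ) : ℂ :=
  (S / ((2 * Real.pi * (s + 1) * (n : ℝ) ^ ((s + 2) / (s + 1)) : ℝ) : ℂ)) ^ (1 / 2 : ℂ) *
    exp ((((s + 1) / s * (n : ℝ) ^ (s / (s + 1)) : ℝ) : ℂ) * S)

theorem mainTerm_eq_saddleTerm (s₀ : ℝ) (A : ℕ → ℕ → ℂ) (h k n : ℕ) (z : ℂ) :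
    mainTerm s₀ A h k n z = saddleTerm s₀ n (L s₀ A h k z) := rfl

theorem arg_ne_pi_of_re_pos {v : ℂ} (hv : 0 < v.re) : arg v ≠ Real.pi := by
  intro h
  exact hv.not_gt (arg_eq_pi_iff.1 h).1

theorem conj_cpow_ofReal {v : ℂ} (hv : 0 < v.re) (x : ℝ) :
    (starRingEnd ℂ) v ^ (x : ℂ) = (starRingEnd ℂ) (v ^ (x : ℂ)) := by
  rw [conj_cpow _ _ (arg_ne_pi_of_re_pos hv), conj_ofReal]

theorem saddleTerm_conj {s : ℝ} (hs : 0 < s) {n : ℕ} (hn : 0 < n) {S : ℂ} (hS : 0 < S.re) :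
    saddleTerm s n ((starRingEnd ℂ) S) = (starRingEnd ℂ) (saddleTerm s n S) := by
  have hn' : (0 : ℝ) < n := by exact_mod_cast hn
  have hK : 0 < 2 * Real.pi * (s + 1) * (n : ℝ) ^ ((s + 2) / (s + 1)) := by positivity
  have h1 : (1 / 2 : ℂ) = ((1 / 2 : ℝ) : ℂ) := by push_cast; rfl
  rw [saddleTerm, saddleTerm, map_mul, ← exp_conj, map_mul, conj_ofReal, h1, ← conj_cpow_ofReal,
    map_div₀, conj_ofReal]
  rw [div_ofReal_re]
  positivity

/-- The saddle term is the Gaussian integral with curvature (s+1)/S at height λ · `phaseFun`, times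
the Jacobian 1/(2πν) of the substitution from ψ to v. -/
theorem saddleTerm_eq {s : ℝ} (hs : 0 < s) {n : ℕ} (hn : 0 < n) {S Φ : ℂ} (hS : S ≠ 0)
    (hΦ : S ^ ((s + 1 : ℝ) : ℂ) = Φ) :
    saddleTerm s n S = ((2 * Real.pi * (n : ℝ) ^ (1 / (s + 1)) : ℝ) : ℂ)⁻¹ *
      (exp (((n : ℝ) ^ (s / (s + 1)) : ℝ) * phaseFun s Φ S) *
        (Real.pi / (((n : ℝ) ^ (s / (s + 1)) : ℝ) * ((s + 1) / S) / 2)) ^ (1 / 2 : ℂ)) := by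
  obtain ⟨hν, hlam, hnn⟩ := rpow_scale hs hn
  have hn' : (0 : ℝ) < n := by exact_mod_cast hn
  have hpow : (n : ℝ) ^ ((s + 2) / (s + 1)) =
      ((n : ℝ) ^ (1 / (s + 1))) ^ 2 * (n : ℝ) ^ (s / (s + 1)) := by
    rw [← Real.rpow_natCast, ← Real.rpow_mul hn'.le, ← Real.rpow_add hn']
    congr 1; push_cast; ring
  have hlam0 : 0 < (n : ℝ) ^ (s / (s + 1)) := by positivity
  rw [saddleTerm, phaseFun_saddle hs hS hΦ, hpow]
  generalize (n : ℝ) ^ (s / (s + 1)) = lam at hlam0 ⊢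
  generalize (n : ℝ) ^ (1 / (s + 1)) = ν at hν ⊢
  have hlamC : (lam : ℂ) ≠ 0 := by exact_mod_cast hlam0.ne'
  have hνC : (ν : ℂ) ≠ 0 := by exact_mod_cast hν.ne'
  have hpi : (Real.pi : ℂ) ≠ 0 := by exact_mod_cast Real.pi_ne_zero
  have hs1 : (s : ℂ) + 1 ≠ 0 := by
    have : s + 1 ≠ 0 := by linarith
    exact_mod_cast this
  have hx : 0 < (2 * Real.pi * ν)⁻¹ := by positivity
  have e1 : S / ((2 * Real.pi * (s + 1) * (ν ^ 2 * lam) : ℝ) : ℂ) =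
      ((((2 * Real.pi * ν)⁻¹ ^ 2 : ℝ)) : ℂ) * (Real.pi / (lam * ((s + 1) / S) / 2)) := by
    push_cast
    field_simp
  have e2 : ((((2 * Real.pi * ν)⁻¹ ^ 2 : ℝ)) : ℂ) ^ (1 / 2 : ℂ) = ((2 * Real.pi * ν : ℝ) : ℂ)⁻¹ := by
    have : (1 / 2 : ℂ) = ((1 / 2 : ℝ) : ℂ) := by push_cast; rfl
    rw [this, ← ofReal_cpow (by positivity), ← Real.sqrt_eq_rpow, Real.sqrt_sq hx.le]
    push_cast; rfl
  have e3 : (Real.pi / (lam * ((s + 1) / S) / 2) : ℂ) ≠ 0 := by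
    refine div_ne_zero hpi (div_ne_zero (mul_ne_zero hlamC (div_ne_zero hs1 hS)) two_ne_zero)
  rw [e1, ofReal_mul_cpow (by positivity) e3, e2]
  push_cast
  have e4 : ((s : ℂ) + 1) / s * lam * S = lam * ((s + 1) / s * S) := by ring
  rw [e4]
  ring

theorem norm_saddleTerm {s : ℝ} (hs : 0 < s) {n : ℕ} (hn : 0 < n) {S : ℂ} (hS : S ≠ 0) :
    ‖saddleTerm s n S‖ = (‖S‖ / (2 * Real.pi * (s + 1) * (n : ℝ) ^ ((s + 2) / (s + 1)))) ^
      (1 / 2 : ℝ) * Real.exp ((s + 1) / s * (n : ℝ) ^ (s / (s + 1)) * S.re) := by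
  have hn' : (0 : ℝ) < n := by exact_mod_cast hn
  have h1 : (1 / 2 : ℂ) = ((1 / 2 : ℝ) : ℂ) := by push_cast; rfl
  have h2 : 0 < 2 * Real.pi * (s + 1) * (n : ℝ) ^ ((s + 2) / (s + 1)) := by positivity
  rw [saddleTerm, norm_mul, h1, norm_cpow_ofReal, norm_div, norm_real, Real.norm_of_nonneg h2.le,
    norm_exp, re_ofReal_mul]
  exact div_ne_zero hS (by exact_mod_cast h2.ne')

/-- Lower bound for the modulus of a saddle term. -/
theorem le_norm_saddleTerm {s m : ℝ} (hs : 0 < s) (hm : 0 < m) {n : ℕ} (hn : 0 < n) {S : ℂ}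
    (hS : m ≤ S.re) :
    (m / (2 * Real.pi * (s + 1))) ^ (1 / 2 : ℝ) * (n : ℝ) ^ (-((s + 2) / (2 * (s + 1)))) *
      Real.exp ((s + 1) / s * (n : ℝ) ^ (s / (s + 1)) * S.re) ≤ ‖saddleTerm s n S‖ := by
  have hn' : (0 : ℝ) < n := by exact_mod_cast hn
  have hS0 : S ≠ 0 := by rintro rfl; simp at hS; linarith
  have hmS : m ≤ ‖S‖ := hS.trans (re_le_norm S)
  rw [norm_saddleTerm hs hn hS0]
  apply mul_le_mul_of_nonneg_right _ (Real.exp_pos _).le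
  rw [← div_div ‖S‖, Real.div_rpow (div_nonneg (norm_nonneg S) (by positivity)) (by positivity),
    ← Real.rpow_mul hn'.le,
    Real.rpow_neg hn'.le, ← div_eq_mul_inv]
  have : (s + 2) / (s + 1) * (1 / 2) = (s + 2) / (2 * (s + 1)) := by field_simp
  rw [this]
  gcongr

/-- Exponentially smaller quantities are negligible compared with a saddle term. -/
theorem eventually_exp_le_saddleTerm {s m η κ : ℝ} (hs : 0 < s) (hm : 0 < m) (hη : 0 < η) :
    ∀ᶠ n : ℕ in atTop, ∀ S : ℂ, m ≤ S.re →
      Real.exp ((n : ℝ) ^ (s / (s + 1)) * ((s + 1) / s * S.re - η)) ≤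
        (n : ℝ) ^ (-κ) * ‖saddleTerm s n S‖ := by
  set c : ℝ := (m / (2 * Real.pi * (s + 1))) ^ (1 / 2 : ℝ) with hc
  have hc0 : 0 < c := by positivity
  set β : ℝ := κ + (s + 2) / (2 * (s + 1)) with hβ
  have hα : 0 < s / (s + 1) := by positivity
  have h1 := ((tendsto_rpow_mul_exp_neg_mul_atTop_nhds_zero (β / (s / (s + 1))) η hη).comp
    (tendsto_rpow_atTop hα)).comp tendsto_natCast_atTop_atTop
  filter_upwards [h1.eventually (gt_mem_nhds hc0), eventually_gt_atTop 0] with n hn hn0 S hS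
  have hn' : (0 : ℝ) < n := by exact_mod_cast hn0
  simp only [Function.comp_apply] at hn
  rw [← Real.rpow_mul hn'.le, mul_div_cancel₀ _ hα.ne'] at hn
  have h2 := le_norm_saddleTerm hs hm hn0 hS
  rw [← hc] at h2
  have h3 : Real.exp (-η * (n : ℝ) ^ (s / (s + 1))) ≤ c * (n : ℝ) ^ (-β) := by
    rw [Real.rpow_neg hn'.le, ← div_eq_mul_inv, le_div_iff₀ (by positivity), mul_comm]
    exact hn.le
  have h4 : (n : ℝ) ^ (-β) = (n : ℝ) ^ (-κ) * (n : ℝ) ^ (-((s + 2) / (2 * (s + 1)))) := by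
    rw [← Real.rpow_add hn']; congr 1; rw [hβ]; ring
  calc Real.exp ((n : ℝ) ^ (s / (s + 1)) * ((s + 1) / s * S.re - η))
      = Real.exp (-η * (n : ℝ) ^ (s / (s + 1))) *
          Real.exp ((s + 1) / s * (n : ℝ) ^ (s / (s + 1)) * S.re) := by
        rw [← Real.exp_add]; congr 1; ring
    _ ≤ c * (n : ℝ) ^ (-β) * Real.exp ((s + 1) / s * (n : ℝ) ^ (s / (s + 1)) * S.re) := by gcongr
    _ = (n : ℝ) ^ (-κ) * (c * (n : ℝ) ^ (-((s + 2) / (2 * (s + 1)))) *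
          Real.exp ((s + 1) / s * (n : ℝ) ^ (s / (s + 1)) * S.re)) := by rw [h4]; ring
    _ ≤ _ := by gcongr

/-- Laplace's method at a saddle point on the line `Re v = Re S`. -/
theorem exists_saddle_bound {s m R : ℝ} (hs : 0 < s) (hm : 0 < m) (hR : 0 < R) :
    ∃ r₁ : ℝ, 0 < r₁ ∧ ∀ r : ℝ, 0 < r → r ≤ r₁ → ∃ C : ℝ, 0 < C ∧ ∀ n : ℕ, 0 < n →
      ∀ S Φ : ℂ, m ≤ S.re → ‖S‖ ≤ R → S ^ ((s + 1 : ℝ) : ℂ) = Φ →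
      ∀ (H : ℝ → ℂ) (ε : ℝ), ε ≤ 1 → (∀ y, |y - S.im| ≤ r → ‖H y - 1‖ ≤ ε) →
      Continuous (fun y : ℝ => exp (((n : ℝ) ^ (s / (s + 1)) : ℝ) *
        phaseFun s Φ ((S.re : ℂ) + (y : ℂ) * I)) * H y) →
      ‖((2 * Real.pi * (n : ℝ) ^ (1 / (s + 1)) : ℝ) : ℂ)⁻¹ *
          (∫ y in (S.im - r)..(S.im + r), exp (((n : ℝ) ^ (s / (s + 1)) : ℝ) *
            phaseFun s Φ ((S.re : ℂ) + (y : ℂ) * I)) * H y) - saddleTerm s n S‖ ≤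
        C * (((n : ℝ) ^ (s / (s + 1))) ^ (-(1 / 2) : ℝ) + ε) * ‖saddleTerm s n S‖ := by
  -- Lower bound for Re((s+1)/S) = (s+1) Re S / |S|². The constant M bounds the Taylor coefficient
  -- by means of |Φ| = |S|^{s+1} ≤ R^{s+1}.
  set κ₀ : ℝ := (s + 1) * m / R ^ 2 with hκ₀
  have hκ₀0 : 0 < κ₀ := by positivity
  set M : ℝ := (s + 1) * (s + 2) * R ^ (s + 1) * m ^ (-(s + 3)) with hM
  have hM0 : 0 < M := by positivity
  refine ⟨κ₀ / 8 / M, by positivity, fun r hr hr1 => ?_⟩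
  obtain ⟨C, hC, hlap⟩ := exists_laplace_bound hκ₀0 hM0.le hr (by
    rwa [le_div_iff₀ hM0, mul_comm] at hr1)
  -- The Gaussian value has modulus at least b λ^{-1/2}; this turns the absolute error of Laplace's
  -- method into a relative one.
  set b : ℝ := (2 * Real.pi * m / (s + 1)) ^ (1 / 2 : ℝ) with hb
  have hb0 : 0 < b := by positivity
  refine ⟨C / b, by positivity, fun n hn S Φ hS hSR hΦ H ε hε hH hcont => ?_⟩
  obtain ⟨hν, hlam, hnn⟩ := rpow_scale hs hn
  have hSre : 0 < S.re := hm.trans_le hS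
  have hS0 : S ≠ 0 := by rintro rfl; simp at hSre
  have hlam0 : 0 < (n : ℝ) ^ (s / (s + 1)) := by rw [hlam]; positivity
  rw [saddleTerm_eq hs hn hS0 hΦ]
  generalize (n : ℝ) ^ (s / (s + 1)) = lam at *
  generalize (n : ℝ) ^ (1 / (s + 1)) = ν at *
  have hshift : ∀ t : ℝ, ((S.re : ℂ) + ((t + S.im : ℝ) : ℂ) * I) = S + t * I := by
    intro t
    nth_rewrite 3 [← re_add_im S]
    push_cast; ring
  have hfac : ∀ t : ℝ, exp (lam * phaseFun s Φ (S + t * I)) * H (t + S.im) =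
      exp (lam * phaseFun s Φ S) *
        (exp (lam * (phaseFun s Φ (S + t * I) - phaseFun s Φ S)) * H (t + S.im)) := by
    intro t
    rw [← mul_assoc, ← Complex.exp_add]
    congr 2; ring
  have hint : (∫ y in (S.im - r)..(S.im + r), exp (lam * phaseFun s Φ ((S.re : ℂ) + (y : ℂ) * I)) *
      H y) = exp (lam * phaseFun s Φ S) * ∫ t in Icc (-r) r,
        exp (lam * (phaseFun s Φ (S + t * I) - phaseFun s Φ S)) * H (t + S.im) := by
    have h1 := intervalIntegral.integral_comp_add_right (a := -r) (b := r)
      (fun y : ℝ => exp (lam * phaseFun s Φ ((S.re : ℂ) + (y : ℂ) * I)) * H y) S.im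
    have e1 : -r + S.im = S.im - r := by ring
    have e2 : r + S.im = S.im + r := by ring
    rw [e1, e2] at h1
    rw [← h1, integral_Icc_eq_integral_Ioc, ← intervalIntegral.integral_of_le (by linarith),
      ← intervalIntegral.integral_const_mul]
    refine intervalIntegral.integral_congr fun t _ => ?_
    simp only [hshift, hfac]
  have hinteg : IntegrableOn (fun t : ℝ =>
      exp (lam * (phaseFun s Φ (S + t * I) - phaseFun s Φ S)) * H (t + S.im)) (Icc (-r) r) := by
    have h1 : Continuous (fun t : ℝ => exp (-(lam * phaseFun s Φ S)) *
        (exp (lam * phaseFun s Φ ((S.re : ℂ) + ((t + S.im : ℝ) : ℂ) * I)) * H (t + S.im))) :=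
      continuous_const.mul (hcont.comp (continuous_id.add continuous_const))
    refine (h1.integrableOn_Icc).congr_fun (fun t _ => ?_) measurableSet_Icc
    simp only [hshift]
    rw [← mul_assoc, ← Complex.exp_add]
    congr 2; ring
  have hκ : κ₀ ≤ (((s : ℂ) + 1) / S).re := by
    have h1 : (((s : ℂ) + 1) / S).re = (s + 1) * (S.re / normSq S) := by
      have : ((s : ℂ) + 1) / S = ((s + 1 : ℝ) : ℂ) * S⁻¹ := by push_cast; ring
      rw [this, re_ofReal_mul, inv_re]
    have h2 : normSq S ≤ R ^ 2 := by
      rw [normSq_eq_norm_sq]; gcongr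
    have h3 : 0 < normSq S := normSq_pos.2 hS0
    rw [h1, hκ₀, mul_div_assoc]
    gcongr
  have hΦn : ‖Φ‖ ≤ R ^ (s + 1) := by
    rw [← hΦ, norm_cpow_ofReal hS0]
    gcongr
  have hmain := hlap (((s : ℂ) + 1) / S) (fun t => phaseFun s Φ (S + t * I) - phaseFun s Φ S)
    (fun t => H (t + S.im)) lam ε hκ hlam0 hε (fun t _ => (norm_phaseFun_taylor_le hs hSre hΦ t).trans (by
      rw [hM]
      have : S.re ^ (-(s + 3)) ≤ m ^ (-(s + 3)) :=
        Real.rpow_le_rpow_of_nonpos hm hS (by linarith)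
      gcongr)) (fun t ht => hH _ (by simpa using ht)) hinteg
  have hfrac : (Real.pi / (lam * (((s : ℂ) + 1) / S) / 2) : ℂ) =
      ((2 * Real.pi / (lam * (s + 1)) : ℝ) : ℂ) * S := by
    have hlamC : (lam : ℂ) ≠ 0 := by exact_mod_cast hlam0.ne'
    have hs1 : (s : ℂ) + 1 ≠ 0 := by
      have : s + 1 ≠ 0 := by linarith
      exact_mod_cast this
    push_cast
    field_simp
  have hlow : b * lam ^ (-(1 / 2) : ℝ) ≤
      ‖(Real.pi / (lam * (((s : ℂ) + 1) / S) / 2) : ℂ) ^ (1 / 2 : ℂ)‖ := by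
    have h1 : (1 / 2 : ℂ) = ((1 / 2 : ℝ) : ℂ) := by push_cast; rfl
    have hp : 0 < 2 * Real.pi / (lam * (s + 1)) := by positivity
    rw [hfrac, h1, norm_cpow_ofReal (mul_ne_zero (by exact_mod_cast hp.ne') hS0), norm_mul, norm_real,
      Real.norm_of_nonneg hp.le, hb, Real.rpow_neg hlam0.le, ← Real.inv_rpow hlam0.le,
      ← Real.mul_rpow (by positivity) (by positivity)]
    have h2 : 2 * Real.pi * m / (s + 1) * lam⁻¹ = 2 * Real.pi / (lam * (s + 1)) * m := by
      field_simp
    rw [h2]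
    have := hS.trans (re_le_norm S)
    gcongr
  rw [hint, ← mul_sub, ← mul_sub, norm_mul, norm_mul, norm_mul, norm_mul]
  set B := ‖(Real.pi / (lam * (((s : ℂ) + 1) / S) / 2) : ℂ) ^ (1 / 2 : ℂ)‖ with hB
  have hε0 : 0 ≤ ε := (norm_nonneg _).trans (hH S.im (by simpa using hr.le))
  have hfin : C * ((lam ^ (-(1 / 2) : ℝ) + ε) * lam ^ (-(1 / 2) : ℝ)) ≤
      C / b * (lam ^ (-(1 / 2) : ℝ) + ε) * B := by
    calc C * ((lam ^ (-(1 / 2) : ℝ) + ε) * lam ^ (-(1 / 2) : ℝ))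
        = C / b * (lam ^ (-(1 / 2) : ℝ) + ε) * (b * lam ^ (-(1 / 2) : ℝ)) := by field_simp
      _ ≤ _ := by gcongr
  calc _ ≤ ‖((2 * Real.pi * ν : ℝ) : ℂ)⁻¹‖ * (‖exp (lam * phaseFun s Φ S)‖ *
        (C / b * (lam ^ (-(1 / 2) : ℝ) + ε) * B)) := by gcongr; exact hmain.trans hfin
    _ = _ := by ring
end PolyMeinardus
end

noncomputable section
namespace PolyMeinardus
open MeasureTheory Complex Set

section
variable {a : ℕ → ℝ} {s₀ σ₀ c : ℝ} {D : ℕ → ℕ → ℂ → ℂ} {A : ℕ → ℕ → ℂ}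

/-! ### Major arcs -/

theorem re_phaseFun {s : ℝ} (Φ v : ℂ) :
    (phaseFun s Φ v).re = v.re + s⁻¹ * (Φ / v ^ (s : ℂ)).re := by
  have : phaseFun s Φ v = v + ((s⁻¹ : ℝ) : ℂ) * (Φ / v ^ (s : ℂ)) := by
    rw [phaseFun, div_mul_eq_div_div]; push_cast; ring
  rw [this, add_re, re_ofReal_mul]

/-- Away from the saddle points the phase is uniformly smaller. -/
theorem exists_tail_gap {s : ℝ} (hs : 0 < s) {K : Set (ℂ × ℝ)} (hK : IsCompact K) {Φ : ℂ → ℂ}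
    (hΦ : ContinuousOn (fun p : ℂ × ℝ => Φ p.1) K) (hpos : ∀ p ∈ K, 0 < (rt s (Φ p.1)).re)
    (hne : ∀ p ∈ K, (((rt s (Φ p.1)).re : ℂ) + (p.2 : ℂ) * I ≠ rt s (Φ p.1)) ∧
      (((rt s (Φ p.1)).re : ℂ) + (p.2 : ℂ) * I ≠ (starRingEnd ℂ) (rt s (Φ p.1)) ∨
        Φ p.1 ∈ slitPlane)) :
    ∃ η : ℝ, 0 < η ∧ ∀ p ∈ K, (phaseFun s (Φ p.1) (((rt s (Φ p.1)).re : ℂ) + (p.2 : ℂ) * I)).re ≤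
      (s + 1) / s * (rt s (Φ p.1)).re - η := by
  rcases K.eq_empty_or_nonempty with rfl | hKne
  · exact ⟨1, one_pos, by simp⟩
  have hre : ∀ p : ℂ × ℝ, (((rt s (Φ p.1)).re : ℂ) + (p.2 : ℂ) * I).re = (rt s (Φ p.1)).re := by
    intro p; simp
  have hℓ : ContinuousOn (fun p : ℂ × ℝ => (rt s (Φ p.1)).re) K :=
    (continuous_re_rt hs).comp_continuousOn hΦ
  have hv : ContinuousOn (fun p : ℂ × ℝ => ((rt s (Φ p.1)).re : ℂ) + (p.2 : ℂ) * I) K :=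
    (continuous_ofReal.comp_continuousOn hℓ).add
      (((continuous_ofReal.comp continuous_snd).continuousOn).mul continuousOn_const)
  have hvs : ∀ p ∈ K, ((rt s (Φ p.1)).re : ℂ) + (p.2 : ℂ) * I ∈ slitPlane := fun p hp =>
    Or.inl (by rw [hre]; exact hpos p hp)
  have hcont : ContinuousOn (fun p : ℂ × ℝ => (s + 1) / s * (rt s (Φ p.1)).re -
      (phaseFun s (Φ p.1) (((rt s (Φ p.1)).re : ℂ) + (p.2 : ℂ) * I)).re) K := by
    simp only [re_phaseFun, hre]
    refine (continuousOn_const.mul hℓ).sub (hℓ.add (continuousOn_const.mul ?_))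
    refine continuous_re.comp_continuousOn (hΦ.div (hv.cpow continuousOn_const hvs) ?_)
    intro p hp h0
    exact slitPlane_ne_zero (hvs p hp) ((cpow_eq_zero_iff _ _).1 h0).1
  obtain ⟨p₀, hp₀, hmin⟩ := hK.exists_isMinOn hKne hcont
  refine ⟨(s + 1) / s * (rt s (Φ p₀.1)).re -
    (phaseFun s (Φ p₀.1) (((rt s (Φ p₀.1)).re : ℂ) + (p₀.2 : ℂ) * I)).re, ?_, fun p hp => ?_⟩
  rotate_left
  · have h2 := isMinOn_iff.1 hmin p hp
    rw [le_sub_comm]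
    exact h2
  · have h1 := re_div_cpow_lt hs (hpos p₀ hp₀) (hre p₀) (hne p₀ hp₀).1 (hne p₀ hp₀).2
    simp only [re_phaseFun, hre]
    have h2 : (s + 1) / s * (rt s (Φ p₀.1)).re =
        (rt s (Φ p₀.1)).re + s⁻¹ * (rt s (Φ p₀.1)).re := by field_simp
    rw [h2]
    have := mul_lt_mul_of_pos_left h1 (inv_pos.2 hs)
    linarith

/-- The domain for `exists_tail_gap`: heights at distance at least r from the height f(z) of a
saddle point. -/
theorem isCompact_dist_le {X : Set ℂ} (hX : IsCompact X) {f : ℂ → ℝ} (hf : ContinuousOn f X)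
    (Y r : ℝ) : IsCompact {p : ℂ × ℝ | p ∈ X ×ˢ Icc (-Y) Y ∧ r ≤ |p.2 - f p.1|} := by
  have hc : IsCompact (X ×ˢ Icc (-Y) Y) := hX.prod isCompact_Icc
  refine hc.of_isClosed_subset ?_ fun p hp => hp.1
  have h1 : ContinuousOn (fun p : ℂ × ℝ => |p.2 - f p.1|) (X ×ˢ Icc (-Y) Y) :=
    (continuousOn_snd.sub (hf.comp continuousOn_fst fun p hp => hp.1)).abs
  exact h1.preimage_isClosed_of_isClosed hc.isClosed isClosed_Ici

theorem omega_ne_zero (hadm : Admissible a s₀ σ₀ c D A) (hs₀ : 0 < s₀) (hs₀c : s₀ < c)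
    (hσ₀' : σ₀ < 0) {h k : ℕ} (hk : 0 < k) (n : ℕ) {z : ℂ} (hz : ‖z‖ < 1) :
    omega D h k n z ≠ 0 := by
  obtain ⟨C, hC, hω⟩ := exists_norm_log_omega_le hadm hs₀ hs₀c hσ₀' hz
  obtain ⟨W, hW, -⟩ := hω h k hk z le_rfl
  rw [omega_eq, hW, e]
  exact mul_ne_zero (exp_ne_zero _) (exp_ne_zero _)

theorem arcPoint_sub_div {h k n : ℕ} (hn : 0 < n) (ℓ y : ℝ) :
    arcPoint s₀ h k n ℓ ((h : ℝ) / k - y / (2 * Real.pi * (n : ℝ) ^ (1 / (s₀ + 1)))) =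
      (ℓ : ℂ) + (y : ℂ) * I := by
  have hν : 0 < (n : ℝ) ^ (1 / (s₀ + 1)) := by
    have : (0 : ℝ) < n := by exact_mod_cast hn
    positivity
  rw [arcPoint]
  congr 3
  have := Real.pi_pos
  field_simp
  ring

/-- The integral over an arc in terms of the phase function. -/
theorem exists_arcIntegral_eq (hadm : Admissible a s₀ σ₀ c D A) (hs₀ : 0 < s₀)
    (hs₀c : s₀ < c) (hσ₀ : -1 < σ₀) (hσ₀' : σ₀ < 0) {r m M δ : ℝ} (hr : r < 1)
    (hm : 0 < m) (hmM : m ≤ M) (hδ : 0 < δ) {p q h k : ℕ} (hi : IsIndex h k) {X : Set ℂ}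
    (hX : ∀ z ∈ X, ‖z‖ ≤ r) (h4 : ∀ z ∈ X, m ≤ (L s₀ A p q z).re ∧ (L s₀ A p q z).re ≤ M) :
    ∃ C : ℝ, 0 < C ∧ ∀ᶠ n : ℕ in atTop, C * (n : ℝ) ^ (σ₀ / (s₀ + 1)) ≤ 1 ∧
      ∀ z ∈ X, ∃ (H : ℝ → ℂ) (Y₁ Y₂ : ℝ),
      Real.pi / (k * δ) ≤ Y₁ ∧ Y₁ ≤ 2 * (Real.pi / (k * δ)) ∧
      Real.pi / (k * δ) ≤ Y₂ ∧ Y₂ ≤ 2 * (Real.pi / (k * δ)) ∧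
      (∀ y, |y| ≤ 2 * (Real.pi / (k * δ)) → ‖H y - 1‖ ≤ C * (n : ℝ) ^ (σ₀ / (s₀ + 1))) ∧
      Continuous (fun y : ℝ => exp (((n : ℝ) ^ (s₀ / (s₀ + 1)) : ℝ) *
        phaseFun s₀ (Phi s₀ A h k z) (((L s₀ A p q z).re : ℂ) + (y : ℂ) * I)) * H y) ∧
      arcIntegral a s₀ A p q δ h k n z = omega D h k n z *
        (((2 * Real.pi * (n : ℝ) ^ (1 / (s₀ + 1)) : ℝ) : ℂ)⁻¹ *
          ∫ y in (-Y₁)..Y₂, exp (((n : ℝ) ^ (s₀ / (s₀ + 1)) : ℝ) *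
            phaseFun s₀ (Phi s₀ A h k z) (((L s₀ A p q z).re : ℂ) + (y : ℂ) * I)) * H y) := by
  have hk0 : 0 < k := hi.1.trans_le hi.2.1
  have hkR : (0 : ℝ) < k := by exact_mod_cast hk0
  -- The half-arcs have length between 1/(2kN) and 1/(k(N+1)) with N ≤ δν < N + 1. Multiplied by
  -- 2πν, these bounds lie between Y and 2Y.
  set Y : ℝ := Real.pi / (k * δ) with hY
  have hY0 : 0 < Y := by positivity
  have hM : 0 < M := hm.trans_le hmM
  obtain ⟨C, hC, hint⟩ := exists_cauchyIntegrand_eq hadm hs₀ hs₀c hσ₀ hσ₀' hr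
    (θ₀ := Real.arctan (2 * Y / m)) (Real.arctan_nonneg.2 (by positivity))
    (Real.arctan_lt_pi_div_two _)
  set K : ℝ := C * (k : ℝ) ^ (s₀ - σ₀) * (M + 2 * Y) ^ (-σ₀) with hK
  have hK0 : 0 < K := by positivity
  have hsmall : Tendsto (fun n : ℕ => 2 * K * (n : ℝ) ^ (σ₀ / (s₀ + 1))) atTop (𝓝 0) := by
    have h1 := ((tendsto_rpow_neg_atTop (y := -σ₀ / (s₀ + 1)) (div_pos (by linarith)
      (by linarith))).comp tendsto_natCast_atTop_atTop).const_mul (2 * K)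
    rw [mul_zero] at h1
    refine h1.congr fun n => ?_
    simp only [Function.comp_apply]
    congr 2
    ring
  refine ⟨2 * K, by positivity, ?_⟩
  filter_upwards [hsmall.eventually (gt_mem_nhds one_pos), eventually_gt_atTop 0,
    (tendsto_floor_mul_rpow hδ hs₀).eventually_ge_atTop k] with n hn1 hn hkN
  refine ⟨hn1.le, fun z hz => ?_⟩
  have hn' : (0 : ℝ) < n := by exact_mod_cast hn
  have hz1 : ‖z‖ < 1 := (hX z hz).trans_lt hr
  have hω0 := omega_ne_zero hadm hs₀ hs₀c hσ₀' (h := h) hk0 n hz1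
  set ℓ : ℝ := (L s₀ A p q z).re with hℓ
  have hℓ0 : 0 < ℓ := hm.trans_le (h4 z hz).1
  obtain ⟨hν, hlam, hnn⟩ := rpow_scale hs₀ hn
  have hνσ : ((n : ℝ) ^ (1 / (s₀ + 1))) ^ (-σ₀) = ((n : ℝ) ^ (σ₀ / (s₀ + 1)))⁻¹ := by
    rw [← Real.rpow_mul hn'.le, ← Real.rpow_neg hn'.le]; congr 1; ring
  have hcont := continuous_cauchyIntegrand hadm hz1 n (div_pos hℓ0 hν)
  have hden := den_div_of_isIndex hi
  obtain ⟨u, v, harc, hu1, hu2, hv1, hv2⟩ := exists_fareyArc_eq (hden.trans_le hkN)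
  rw [hden] at hu1 hu2 hv1 hv2
  push_cast at harc
  rw [arcIntegral_eq, harc]
  have hfl : (⌊δ * (n : ℝ) ^ (1 / (s₀ + 1))⌋₊ : ℝ) ≤ δ * (n : ℝ) ^ (1 / (s₀ + 1)) :=
    Nat.floor_le (by positivity)
  have hfl' : δ * (n : ℝ) ^ (1 / (s₀ + 1)) < (⌊δ * (n : ℝ) ^ (1 / (s₀ + 1))⌋₊ : ℝ) + 1 :=
    Nat.lt_floor_add_one _
  have hNpos : (0 : ℝ) < (⌊δ * (n : ℝ) ^ (1 / (s₀ + 1))⌋₊ : ℝ) := by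
    exact_mod_cast hk0.trans_le hkN
  have hdef := arcPoint_sub_div (s₀ := s₀) (h := h) (k := k) hn ℓ
  have hE := fun y => hint h k hk0 z (hX z hz) n hn ℓ
    ((h : ℝ) / k - y / (2 * Real.pi * (n : ℝ) ^ (1 / (s₀ + 1)))) hℓ0
  simp only [hdef] at hE
  set N : ℝ := (⌊δ * (n : ℝ) ^ (1 / (s₀ + 1))⌋₊ : ℝ) with hN
  set ν : ℝ := (n : ℝ) ^ (1 / (s₀ + 1)) with hνd
  set lam : ℝ := (n : ℝ) ^ (s₀ / (s₀ + 1)) with hlamd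
  set f : ℝ → ℂ := fun y => phaseFun s₀ (Phi s₀ A h k z) ((ℓ : ℂ) + (y : ℂ) * I) with hf
  set G := cauchyIntegrand a n z (ℓ / ν) with hG
  have hc : 0 < 2 * Real.pi * ν := by positivity
  -- Defined as a quotient on all of ℝ, so that its product with the exponential is continuous
  -- everywhere; on |y| ≤ 2Y it equals e^E.
  set H : ℝ → ℂ := fun y => (omega D h k n z)⁻¹ * G ((h : ℝ) / k - y / (2 * Real.pi * ν)) *
    exp (-(lam * f y)) with hH
  have hfH : ∀ y, exp (lam * f y) * H y =
      (omega D h k n z)⁻¹ * G ((h : ℝ) / k - y / (2 * Real.pi * ν)) := by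
    intro y
    rw [hH]
    simp only
    rw [mul_comm (exp (lam * f y)), mul_assoc, ← Complex.exp_add, neg_add_cancel, Complex.exp_zero,
      mul_one]
  have hlow : ∀ x, 1 / (2 * k * N) ≤ x → Y ≤ 2 * Real.pi * ν * x := by
    intro x hx
    calc Y = 2 * Real.pi * ν * (1 / (2 * k * (δ * ν))) := by rw [hY]; field_simp
      _ ≤ 2 * Real.pi * ν * (1 / (2 * k * N)) := by gcongr
      _ ≤ _ := by gcongr
  have hupp : ∀ x, x ≤ 1 / (k * (N + 1)) → 2 * Real.pi * ν * x ≤ 2 * Y := by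
    intro x hx
    calc 2 * Real.pi * ν * x ≤ 2 * Real.pi * ν * (1 / (k * (N + 1))) := by gcongr
      _ ≤ 2 * Real.pi * ν * (1 / (k * (δ * ν))) := by gcongr
      _ = 2 * Y := by rw [hY]; field_simp
  -- The substitution ψ = h/k - y/(2πν) reverses orientation, so the right half-arc v gives the
  -- lower limit and the left half-arc u the upper one.
  refine ⟨H, 2 * Real.pi * ν * v, 2 * Real.pi * ν * u, hlow v hv1, hupp v hv2, hlow u hu1,
    hupp u hu2, fun y hy => ?_, ?_, ?_⟩
  · have hvre : ((ℓ : ℂ) + (y : ℂ) * I).re = ℓ := by simp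
    have hvim : ((ℓ : ℂ) + (y : ℂ) * I).im = y := by simp
    obtain ⟨E, hE1, hE2⟩ := hE y (abs_arg_le_arctan (by rw [hvre]; exact hℓ0) (by
      rw [hvre, hvim]
      calc |y| ≤ 2 * Y := hy
        _ = 2 * Y / m * m := by field_simp
        _ ≤ 2 * Y / m * ℓ := by gcongr; exact (h4 z hz).1))
    have hHy : H y = exp E := by
      have h1 := hfH y
      rw [hE1, inv_mul_cancel_left₀ hω0] at h1
      exact mul_left_cancel₀ (exp_ne_zero _) h1
    have hnorm : ‖(ℓ : ℂ) + (y : ℂ) * I‖ ≤ M + 2 * Y := by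
      refine (norm_le_abs_re_add_abs_im _).trans ?_
      rw [hvre, hvim, abs_of_pos hℓ0]
      linarith [(h4 z hz).2]
    have hEb : ‖E‖ ≤ K * (n : ℝ) ^ (σ₀ / (s₀ + 1)) := by
      refine hE2.trans ?_
      calc C * (k : ℝ) ^ (s₀ - σ₀) * (‖(ℓ : ℂ) + (y : ℂ) * I‖ / ν) ^ (-σ₀)
          ≤ C * (k : ℝ) ^ (s₀ - σ₀) * ((M + 2 * Y) / ν) ^ (-σ₀) := by
            gcongr
            linarith
        _ = K * (n : ℝ) ^ (σ₀ / (s₀ + 1)) := by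
            rw [Real.div_rpow (by positivity) hν.le, hνσ, hK, div_inv_eq_mul]; ring
    have hE1' : ‖E‖ ≤ 1 := by linarith [norm_nonneg E]
    rw [hHy]
    refine (Complex.norm_exp_sub_one_le hE1').trans ?_
    linarith
  · refine Continuous.congr (f := fun y => (omega D h k n z)⁻¹ *
      G ((h : ℝ) / k - y / (2 * Real.pi * ν))) ?_ fun y => (hfH y).symm
    exact continuous_const.mul (hcont.comp (by fun_prop))
  · have huv : (h : ℝ) / k - u ≤ (h : ℝ) / k + v := by
      have h1 : 0 < 1 / (2 * (k : ℝ) * N) := by positivity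
      linarith
    have h1 := intervalIntegral.integral_comp_sub_div (a := -(2 * Real.pi * ν * v))
      (b := 2 * Real.pi * ν * u) G hc.ne' ((h : ℝ) / k)
    rw [neg_div, mul_div_cancel_left₀ _ hc.ne', mul_div_cancel_left₀ _ hc.ne', sub_neg_eq_add,
      real_smul] at h1
    have h2 : (∫ y in (-(2 * Real.pi * ν * v))..(2 * Real.pi * ν * u), exp (lam * f y) * H y) =
        (omega D h k n z)⁻¹ * ∫ y in (-(2 * Real.pi * ν * v))..(2 * Real.pi * ν * u),
          G ((h : ℝ) / k - y / (2 * Real.pi * ν)) := by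
      rw [← intervalIntegral.integral_const_mul]
      exact intervalIntegral.integral_congr fun y _ => hfH y
    have hcC : ((2 * Real.pi * ν : ℝ) : ℂ) ≠ 0 := by exact_mod_cast hc.ne'
    rw [← intervalIntegral.integral_of_le huv, h2, h1]
    field_simp

/-- A piece of an arc on which the phase is small is negligible. -/
theorem norm_tail_le {s m η κ : ℝ} {n : ℕ} (hn : 0 < n) (hs : 0 < s)
    (hexp : ∀ S : ℂ, m ≤ S.re →
      Real.exp ((n : ℝ) ^ (s / (s + 1)) * ((s + 1) / s * S.re - η)) ≤
        (n : ℝ) ^ (-κ) * ‖saddleTerm s n S‖) {S Φ : ℂ} (hS : m ≤ S.re) {H : ℝ → ℂ} {u v Y : ℝ}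
    (huv : u ≤ v) (hu : -Y ≤ u) (hv : v ≤ Y)
    (hH : ∀ y, |y| ≤ Y → ‖H y - 1‖ ≤ 1)
    (hphase : ∀ y ∈ Icc u v, (phaseFun s Φ ((S.re : ℂ) + (y : ℂ) * I)).re ≤
      (s + 1) / s * S.re - η) :
    ‖((2 * Real.pi * (n : ℝ) ^ (1 / (s + 1)) : ℝ) : ℂ)⁻¹ *
        ∫ y in u..v, exp (((n : ℝ) ^ (s / (s + 1)) : ℝ) *
          phaseFun s Φ ((S.re : ℂ) + (y : ℂ) * I)) * H y‖ ≤
      4 * Y * (n : ℝ) ^ (-κ) * ‖saddleTerm s n S‖ := by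
  have hn1 : (1 : ℝ) ≤ n := by exact_mod_cast hn
  have hν : (1 : ℝ) ≤ (n : ℝ) ^ (1 / (s + 1)) := Real.one_le_rpow hn1 (by positivity)
  have hc : 1 ≤ 2 * Real.pi * (n : ℝ) ^ (1 / (s + 1)) := by
    nlinarith [Real.pi_gt_three]
  have hbd : ∀ y ∈ uIoc u v, ‖exp (((n : ℝ) ^ (s / (s + 1)) : ℝ) *
      phaseFun s Φ ((S.re : ℂ) + (y : ℂ) * I)) * H y‖ ≤
      2 * ((n : ℝ) ^ (-κ) * ‖saddleTerm s n S‖) := by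
    intro y hy
    rw [uIoc_of_le huv] at hy
    have hy' : y ∈ Icc u v := Ioc_subset_Icc_self hy
    have h1 : ‖H y‖ ≤ 2 := by
      have h2 := hH y (abs_le.2 ⟨hu.trans hy'.1, hy'.2.trans hv⟩)
      have h3 : ‖H y‖ ≤ ‖H y - 1‖ + ‖(1 : ℂ)‖ := by simpa using norm_add_le (H y - 1) 1
      rw [norm_one] at h3
      linarith
    rw [norm_mul, norm_exp, re_ofReal_mul, mul_comm]
    refine mul_le_mul h1 (le_trans (Real.exp_le_exp.2 ?_) (hexp S hS)) (Real.exp_pos _).le two_pos.le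
    exact mul_le_mul_of_nonneg_left (hphase y hy') (by positivity)
  have hint := intervalIntegral.norm_integral_le_of_norm_le_const hbd
  rw [abs_of_nonneg (by linarith)] at hint
  rw [norm_mul, norm_inv, norm_real, Real.norm_of_nonneg (by linarith)]
  have hB : 0 ≤ (n : ℝ) ^ (-κ) * ‖saddleTerm s n S‖ := by positivity
  calc _ ≤ 1 * (2 * ((n : ℝ) ^ (-κ) * ‖saddleTerm s n S‖) * (v - u)) := by
        gcongr
        exact inv_le_one_of_one_le₀ hc
    _ ≤ 1 * (2 * ((n : ℝ) ^ (-κ) * ‖saddleTerm s n S‖) * (2 * Y)) := by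
        gcongr
        linarith
    _ = _ := by ring
end
end PolyMeinardus
end

noncomputable section
namespace PolyMeinardus
open MeasureTheory Complex Set

section
variable {a : ℕ → ℝ} {s₀ σ₀ c : ℝ} {D : ℕ → ℕ → ℂ → ℂ} {A : ℕ → ℕ → ℂ}

theorem L_cpow (hs₀ : 0 < s₀) {h k : ℕ} {z : ℂ} (hz : 0 < (L s₀ A h k z).re) :
    L s₀ A h k z ^ ((s₀ + 1 : ℝ) : ℂ) = Phi s₀ A h k z :=
  rt_cpow hs₀ (Phi_ne_zero_of_re_pos hs₀ hz)

/-- The two entries of the minimum `mu` are the two sources of error: λ^{-1/2} from Laplace's method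
and n^{σ₀/(s₀+1)} from the expansion of P. -/
theorem rpow_error_le {s σ : ℝ} (hs : 0 < s) {n : ℕ} (hn : 0 < n) :
    ((n : ℝ) ^ (s / (s + 1))) ^ (-(1 / 2) : ℝ) ≤ (n : ℝ) ^ (-mu s σ) ∧
      (n : ℝ) ^ (σ / (s + 1)) ≤ (n : ℝ) ^ (-mu s σ) := by
  have hn1 : (1 : ℝ) ≤ n := by exact_mod_cast hn
  constructor
  · rw [← Real.rpow_mul (by linarith)]
    apply Real.rpow_le_rpow_of_exponent_le hn1
    have h1 : mu s σ ≤ s / (2 * s + 2) := min_le_right _ _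
    have h2 : s / (s + 1) * (-(1 / 2)) = -(s / (2 * s + 2)) := by field_simp
    linarith
  · apply Real.rpow_le_rpow_of_exponent_le hn1
    have h1 : mu s σ ≤ -σ / (s + 1) := min_le_left _ _
    have h2 : σ / (s + 1) = -(-σ / (s + 1)) := by ring
    linarith

/-- Asymptotics of a major arc with a single saddle point. -/
theorem exists_arcIntegral_bound_slitPlane (hadm : Admissible a s₀ σ₀ c D A) (hs₀ : 0 < s₀)
    (hs₀c : s₀ < c) (hσ₀ : -1 < σ₀) (hσ₀' : σ₀ < 0) {r m M R δ : ℝ} (hr : r < 1)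
    (hm : 0 < m) (hmM : m ≤ M) (hδ : 0 < δ) {p q h k : ℕ} (hi : IsIndex h k) {X : Set ℂ}
    (hXc : IsCompact X) (hX : ∀ z ∈ X, ‖z‖ ≤ r)
    (h4 : ∀ z ∈ X, m ≤ (L s₀ A p q z).re ∧ (L s₀ A p q z).re ≤ M)
    (hre : ∀ z ∈ X, (L s₀ A h k z).re = (L s₀ A p q z).re) (hR : 0 < R)
    (hLR : ∀ z ∈ X, ‖L s₀ A h k z‖ ≤ R) (hδR : R + 1 ≤ Real.pi / (k * δ))
    (hslit : ∀ z ∈ X, Phi s₀ A h k z ∈ slitPlane) :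
    ∃ C : ℝ, 0 < C ∧ ∀ᶠ n : ℕ in atTop, ∀ z ∈ X,
      ‖(omega D h k n z)⁻¹ * arcIntegral a s₀ A p q δ h k n z - mainTerm s₀ A h k n z‖ ≤
        C * (n : ℝ) ^ (-mu s₀ σ₀) * ‖mainTerm s₀ A h k n z‖ := by
  have hk0 : 0 < k := hi.1.trans_le hi.2.1
  set Y : ℝ := Real.pi / (k * δ) with hY
  have hXB : X ⊆ Metric.ball 0 1 := fun z hz => mem_ball_zero_iff.2 ((hX z hz).trans_lt hr)
  have hΦc := (continuousOn_Phi hs₀ A h k).mono hXB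
  have hLc : ContinuousOn (L s₀ A h k) X := hΦc.cpow continuousOn_const hslit
  have hpos : ∀ z ∈ X, 0 < (L s₀ A h k z).re := fun z hz => by
    rw [hre z hz]; exact hm.trans_le (h4 z hz).1
  obtain ⟨r₁, hr₁, hsad⟩ := exists_saddle_bound (R := R) hs₀ hm hR
  -- With ρ ≤ 1 and |Im L| ≤ R, the hypothesis R + 1 ≤ Y keeps the window about the saddle inside
  -- the arc.
  set ρ : ℝ := min r₁ 1 with hρ
  have hρ0 : 0 < ρ := lt_min hr₁ one_pos
  have hρ1 : ρ ≤ 1 := min_le_right _ _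
  obtain ⟨C₁, hC₁, hsad⟩ := hsad ρ hρ0 (min_le_left _ _)
  obtain ⟨η, hη, hgap⟩ := exists_tail_gap hs₀
    (isCompact_dist_le hXc (continuous_im.comp_continuousOn hLc) (2 * Y) ρ)
    (Φ := Phi s₀ A h k) (hΦc.comp continuousOn_fst fun p hp => hp.1.1)
    (fun p hp => hpos p.1 hp.1.1) (fun p hp => ⟨fun he => by
      have h1 := congrArg im he
      simp only [add_im, ofReal_im, im_ofReal_mul, I_im, mul_one, zero_add] at h1
      have h2 := hp.2
      simp only [Function.comp_apply] at h2
      rw [h1, L_eq_rt, sub_self, abs_zero] at h2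
      linarith, Or.inr (hslit p.1 hp.1.1)⟩)
  obtain ⟨C₂, hC₂, harc⟩ := exists_arcIntegral_eq hadm hs₀ hs₀c hσ₀ hσ₀' hr hm hmM hδ hi
    (p := p) (q := q) hX h4
  have hY0 : 0 < Y := by linarith
  -- One saddle window and two tails, each tail costing 4 · 2Y.
  refine ⟨C₁ * (1 + C₂) + 16 * Y, by positivity, ?_⟩
  filter_upwards [harc, eventually_exp_le_saddleTerm (κ := mu s₀ σ₀) hs₀ hm hη,
    eventually_gt_atTop 0] with n hn hexp hn0 z hz
  obtain ⟨hε, hn⟩ := hn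
  obtain ⟨H, Y₁, Y₂, hY₁, hY₁', hY₂, hY₂', hH, hcont, heq⟩ := hn z hz
  rw [← hY] at hY₁ hY₁' hY₂ hY₂' hH
  have hω0 := omega_ne_zero hadm hs₀ hs₀c hσ₀' (h := h) hk0 n ((hX z hz).trans_lt hr)
  rw [heq, inv_mul_cancel_left₀ hω0, mainTerm_eq_saddleTerm]
  obtain ⟨e1, e2⟩ := rpow_error_le (s := s₀) (σ := σ₀) hs₀ hn0
  have hcub := L_cpow hs₀ (hpos z hz)
  have hgapz : ∀ y, |y| ≤ 2 * Y → ρ ≤ |y - (L s₀ A h k z).im| →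
      (phaseFun s₀ (Phi s₀ A h k z) (((L s₀ A h k z).re : ℂ) + (y : ℂ) * I)).re ≤
      (s₀ + 1) / s₀ * (L s₀ A h k z).re - η := fun y h1 h2 =>
    hgap (z, y) ⟨⟨hz, abs_le.1 h1⟩, h2⟩
  have hSm : m ≤ (L s₀ A h k z).re := by rw [hre z hz]; exact (h4 z hz).1
  have him : |(L s₀ A h k z).im| ≤ R := (abs_im_le_norm _).trans (hLR z hz)
  rw [← hre z hz] at hcont ⊢
  have hLRz := hLR z hz
  generalize L s₀ A h k z = S at *
  generalize Phi s₀ A h k z = Φ at *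
  obtain ⟨him1, him2⟩ := abs_le.1 him
  have hHS := hsad n hn0 S Φ hSm hLRz hcub H _ hε (fun y hy => hH y (by
    obtain ⟨h1, h2⟩ := abs_le.1 hy
    exact abs_le.2 ⟨by linarith, by linarith⟩)) hcont
  have hint := fun u v => hcont.intervalIntegrable (μ := volume) u v
  rw [← intervalIntegral.integral_add_adjacent_intervals (hint (-Y₁) (S.im - ρ)) (hint _ _),
    ← intervalIntegral.integral_add_adjacent_intervals (hint (S.im - ρ) (S.im + ρ)) (hint _ _),
    mul_add, mul_add]
  have hH1 : ∀ y, |y| ≤ 2 * Y → ‖H y - 1‖ ≤ 1 := fun y hy => (hH y hy).trans hε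
  have hT₁ := norm_tail_le (u := -Y₁) (v := S.im - ρ) hn0 hs₀ hexp hSm (Φ := Φ) (by linarith)
    (by linarith) (by linarith) hH1 (fun y hy => hgapz y
      (abs_le.2 ⟨by linarith [hy.1], by linarith [hy.2]⟩)
      (le_abs.2 (Or.inr (by linarith [hy.2]))))
  have hT₂ := norm_tail_le (u := S.im + ρ) (v := Y₂) hn0 hs₀ hexp hSm (Φ := Φ) (by linarith)
    (by linarith) (by linarith) hH1 (fun y hy => hgapz y
      (abs_le.2 ⟨by linarith [hy.1], by linarith [hy.2]⟩)
      (le_abs.2 (Or.inl (by linarith [hy.1]))))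
  have hmainerr : C₁ * (((n : ℝ) ^ (s₀ / (s₀ + 1))) ^ (-(1 / 2) : ℝ) +
      C₂ * (n : ℝ) ^ (σ₀ / (s₀ + 1))) * ‖saddleTerm s₀ n S‖ ≤
      C₁ * (1 + C₂) * (n : ℝ) ^ (-mu s₀ σ₀) * ‖saddleTerm s₀ n S‖ := by
    have : C₁ * (((n : ℝ) ^ (s₀ / (s₀ + 1))) ^ (-(1 / 2) : ℝ) + C₂ * (n : ℝ) ^ (σ₀ / (s₀ + 1))) ≤
        C₁ * ((n : ℝ) ^ (-mu s₀ σ₀) + C₂ * (n : ℝ) ^ (-mu s₀ σ₀)) := by gcongr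
    refine mul_le_mul_of_nonneg_right (this.trans (le_of_eq (by ring))) (norm_nonneg _)
  rw [add_sub_assoc, add_sub_right_comm]
  refine (norm_add_le _ _).trans ?_
  refine (add_le_add hT₁ ((norm_add_le _ _).trans (add_le_add (hHS.trans hmainerr) hT₂))).trans ?_
  apply le_of_eq
  ring

/-- Off the slit plane and nonzero means Φ < 0, so arg Φ = π and the root is strictly in the upper
half plane. The formula for its imaginary part gives continuity in z, which `L` itself need not have
across the cut. -/
theorem conj_and_im_rt_of_notMem_slitPlane (hs₀ : 0 < s₀) {Φ : ℂ} (hpos : 0 < (rt s₀ Φ).re)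
    (hns : Φ ∉ slitPlane) : (starRingEnd ℂ) Φ = Φ ∧
      (rt s₀ Φ).im = ‖Φ‖ ^ (1 / (s₀ + 1)) * Real.sin (Real.pi / (s₀ + 1)) ∧ 0 < (rt s₀ Φ).im := by
  have hΦ0 : Φ ≠ 0 := by
    rintro rfl
    rw [rt_zero hs₀] at hpos
    simp at hpos
  rw [mem_slitPlane_iff, not_or, not_lt, not_not] at hns
  have harg : arg Φ = Real.pi := by
    rw [arg_eq_pi_iff]
    refine ⟨lt_of_le_of_ne hns.1 fun h0 => hΦ0 (Complex.ext h0 hns.2), hns.2⟩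
  have him := im_rt hs₀ Φ
  rw [harg] at him
  refine ⟨conj_eq_iff_im.2 hns.2, him, ?_⟩
  rw [him]
  have h1 : 0 < Real.sin (Real.pi / (s₀ + 1)) := by
    apply Real.sin_pos_of_pos_of_lt_pi (by positivity)
    exact div_lt_self Real.pi_pos (by linarith)
  have h2 : 0 < ‖Φ‖ := norm_pos_iff.2 hΦ0
  positivity

/-- Asymptotics of a major arc with two conjugate saddle points. -/
theorem exists_arcIntegral_bound_not_slitPlane (hadm : Admissible a s₀ σ₀ c D A) (hs₀ : 0 < s₀)
    (hs₀c : s₀ < c) (hσ₀ : -1 < σ₀) (hσ₀' : σ₀ < 0) {r m M R δ : ℝ} (hr : r < 1)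
    (hm : 0 < m) (hmM : m ≤ M) (hδ : 0 < δ) {p q h k : ℕ} (hi : IsIndex h k) {X : Set ℂ}
    (hXc : IsCompact X) (hX : ∀ z ∈ X, ‖z‖ ≤ r)
    (h4 : ∀ z ∈ X, m ≤ (L s₀ A p q z).re ∧ (L s₀ A p q z).re ≤ M)
    (hre : ∀ z ∈ X, (L s₀ A h k z).re = (L s₀ A p q z).re) (hR : 0 < R)
    (hLR : ∀ z ∈ X, ‖L s₀ A h k z‖ ≤ R) (hδR : R + 1 ≤ Real.pi / (k * δ))
    (hslit : ∀ z ∈ X, Phi s₀ A h k z ∉ slitPlane) :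
    ∃ C : ℝ, 0 < C ∧ ∀ᶠ n : ℕ in atTop, ∀ z ∈ X,
      ‖(omega D h k n z)⁻¹ * arcIntegral a s₀ A p q δ h k n z -
          ((2 * (mainTerm s₀ A h k n z).re : ℝ) : ℂ)‖ ≤
        C * (n : ℝ) ^ (-mu s₀ σ₀) * ‖mainTerm s₀ A h k n z‖ := by
  rcases X.eq_empty_or_nonempty with rfl | hXne
  · exact ⟨1, one_pos, by simp⟩
  have hk0 : 0 < k := hi.1.trans_le hi.2.1
  set Y : ℝ := Real.pi / (k * δ) with hY
  have hXB : X ⊆ Metric.ball 0 1 := fun z hz => mem_ball_zero_iff.2 ((hX z hz).trans_lt hr)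
  have hΦc := (continuousOn_Phi hs₀ A h k).mono hXB
  have hpos : ∀ z ∈ X, 0 < (L s₀ A h k z).re := fun z hz => by
    rw [hre z hz]; exact hm.trans_le (h4 z hz).1
  have hfacts := fun z hz => conj_and_im_rt_of_notMem_slitPlane (Φ := Phi s₀ A h k z) hs₀ (hpos z hz) (hslit z hz)
  have hLc : ContinuousOn (fun z => (L s₀ A h k z).im) X := by
    refine ContinuousOn.congr (f := fun z => ‖Phi s₀ A h k z‖ ^ (1 / (s₀ + 1)) *
      Real.sin (Real.pi / (s₀ + 1))) ?_ fun z hz => (hfacts z hz).2.1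
    exact (hΦc.norm.rpow_const fun _ _ => Or.inr (by positivity)).mul continuousOn_const
  obtain ⟨z₀, hz₀, hmin⟩ := hXc.exists_isMinOn hXne hLc
  have himpos : ∀ z ∈ X, 0 < (L s₀ A h k z).im := fun z hz => (hfacts z hz).2.2
  obtain ⟨r₁, hr₁, hsad⟩ := exists_saddle_bound (R := R) hs₀ hm hR
  -- Bounded by the minimum of Im L on X, so that the windows about L and its conjugate do not
  -- overlap.
  set ρ : ℝ := min r₁ (min 1 (L s₀ A h k z₀).im) with hρ
  have hρ0 : 0 < ρ := lt_min hr₁ (lt_min one_pos (himpos z₀ hz₀))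
  have hρ1 : ρ ≤ 1 := (min_le_right _ _).trans (min_le_left _ _)
  have hρim : ∀ z ∈ X, ρ ≤ (L s₀ A h k z).im := fun z hz =>
    ((min_le_right _ _).trans (min_le_right _ _)).trans (isMinOn_iff.1 hmin z hz)
  obtain ⟨C₁, hC₁, hsad⟩ := hsad ρ hρ0 (min_le_left _ _)
  obtain ⟨η, hη, hgap⟩ := exists_tail_gap hs₀
    ((isCompact_dist_le hXc hLc (2 * Y) ρ).inter (isCompact_dist_le hXc hLc.neg (2 * Y) ρ))
    (Φ := Phi s₀ A h k) (hΦc.comp continuousOn_fst fun p hp => hp.1.1.1)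
    (fun p hp => hpos p.1 hp.1.1.1) (fun p hp => ⟨fun he => by
      have h1 := congrArg im he
      simp only [add_im, ofReal_im, im_ofReal_mul, I_im, mul_one, zero_add] at h1
      have h2 := hp.1.2
      rw [h1, L_eq_rt, sub_self, abs_zero] at h2
      linarith, Or.inl fun he => by
      have h1 := congrArg im he
      simp only [add_im, ofReal_im, im_ofReal_mul, I_im, mul_one, zero_add, conj_im] at h1
      have h2 := hp.2.2
      simp only [Pi.neg_apply] at h2
      rw [h1, L_eq_rt, sub_self, abs_zero] at h2
      linarith⟩)
  obtain ⟨C₂, hC₂, harc⟩ := exists_arcIntegral_eq hadm hs₀ hs₀c hσ₀ hσ₀' hr hm hmM hδ hi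
    (p := p) (q := q) hX h4
  have hY0 : 0 < Y := by linarith
  refine ⟨2 * (C₁ * (1 + C₂)) + 24 * Y, by positivity, ?_⟩
  filter_upwards [harc, eventually_exp_le_saddleTerm (κ := mu s₀ σ₀) hs₀ hm hη,
    eventually_gt_atTop 0] with n hn hexp hn0 z hz
  obtain ⟨hε, hn⟩ := hn
  obtain ⟨H, Y₁, Y₂, hY₁, hY₁', hY₂, hY₂', hH, hcont, heq⟩ := hn z hz
  rw [← hY] at hY₁ hY₁' hY₂ hY₂' hH
  have hω0 := omega_ne_zero hadm hs₀ hs₀c hσ₀' (h := h) hk0 n ((hX z hz).trans_lt hr)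
  rw [heq, inv_mul_cancel_left₀ hω0, mainTerm_eq_saddleTerm]
  obtain ⟨e1, e2⟩ := rpow_error_le (s := s₀) (σ := σ₀) hs₀ hn0
  have hcub := L_cpow hs₀ (hpos z hz)
  have hgapz : ∀ y, |y| ≤ 2 * Y → ρ ≤ |y - (L s₀ A h k z).im| → ρ ≤ |y - -(L s₀ A h k z).im| →
      (phaseFun s₀ (Phi s₀ A h k z) (((L s₀ A h k z).re : ℂ) + (y : ℂ) * I)).re ≤
      (s₀ + 1) / s₀ * (L s₀ A h k z).re - η := fun y h1 h2 h3 =>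
    hgap (z, y) ⟨⟨⟨hz, abs_le.1 h1⟩, h2⟩, ⟨⟨hz, abs_le.1 h1⟩, h3⟩⟩
  have hSm : m ≤ (L s₀ A h k z).re := by rw [hre z hz]; exact (h4 z hz).1
  have him : |(L s₀ A h k z).im| ≤ R := (abs_im_le_norm _).trans (hLR z hz)
  rw [← hre z hz] at hcont ⊢
  have hLRz := hLR z hz
  have hconjΦ := (hfacts z hz).1
  have hρS := hρim z hz
  have hSpos := hpos z hz
  generalize L s₀ A h k z = S at *
  generalize Phi s₀ A h k z = Φ at *
  obtain ⟨him1, him2⟩ := abs_le.1 him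
  have hHS := hsad n hn0 S Φ hSm hLRz hcub H _ hε (fun y hy => hH y (by
    obtain ⟨h1, h2⟩ := abs_le.1 hy
    exact abs_le.2 ⟨by linarith, by linarith⟩)) hcont
  -- The conjugate is a saddle point for the same Φ because Φ is real; its contribution is the
  -- conjugate one, and the two add up to twice the real part.
  have hHS' := hsad n hn0 ((starRingEnd ℂ) S) Φ (by rwa [conj_re]) (by rwa [norm_conj])
    (by rw [conj_cpow_ofReal hSpos, hcub, hconjΦ]) H _ hε (fun y hy => hH y (by
    rw [conj_im] at hy
    obtain ⟨h1, h2⟩ := abs_le.1 hy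
    exact abs_le.2 ⟨by linarith, by linarith⟩)) (by rwa [conj_re])
  rw [conj_re, conj_im, saddleTerm_conj hs₀ hn0 hSpos, norm_conj] at hHS'
  have hint := fun u v => hcont.intervalIntegrable (μ := volume) u v
  rw [← intervalIntegral.integral_add_adjacent_intervals (hint (-Y₁) (-S.im - ρ)) (hint _ _),
    ← intervalIntegral.integral_add_adjacent_intervals (hint (-S.im - ρ) (-S.im + ρ)) (hint _ _),
    ← intervalIntegral.integral_add_adjacent_intervals (hint (-S.im + ρ) (S.im - ρ)) (hint _ _),
    ← intervalIntegral.integral_add_adjacent_intervals (hint (S.im - ρ) (S.im + ρ)) (hint _ _),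
    mul_add, mul_add, mul_add, mul_add]
  have hH1 : ∀ y, |y| ≤ 2 * Y → ‖H y - 1‖ ≤ 1 := fun y hy => (hH y hy).trans hε
  have hT₁ := norm_tail_le (u := -Y₁) (v := -S.im - ρ) hn0 hs₀ hexp hSm (Φ := Φ) (by linarith)
    (by linarith) (by linarith) hH1 (fun y hy => hgapz y
      (abs_le.2 ⟨by linarith [hy.1], by linarith [hy.2]⟩)
      (le_abs.2 (Or.inr (by linarith [hy.2]))) (le_abs.2 (Or.inr (by linarith [hy.2]))))
  have hT₂ := norm_tail_le (u := -S.im + ρ) (v := S.im - ρ) hn0 hs₀ hexp hSm (Φ := Φ)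
    (by linarith) (by linarith) (by linarith) hH1 (fun y hy => hgapz y
      (abs_le.2 ⟨by linarith [hy.1], by linarith [hy.2]⟩)
      (le_abs.2 (Or.inr (by linarith [hy.2]))) (le_abs.2 (Or.inl (by linarith [hy.1]))))
  have hT₃ := norm_tail_le (u := S.im + ρ) (v := Y₂) hn0 hs₀ hexp hSm (Φ := Φ) (by linarith)
    (by linarith) (by linarith) hH1 (fun y hy => hgapz y
      (abs_le.2 ⟨by linarith [hy.1], by linarith [hy.2]⟩)
      (le_abs.2 (Or.inl (by linarith [hy.1]))) (le_abs.2 (Or.inl (by linarith [hy.1]))))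
  have hmainerr : C₁ * (((n : ℝ) ^ (s₀ / (s₀ + 1))) ^ (-(1 / 2) : ℝ) +
      C₂ * (n : ℝ) ^ (σ₀ / (s₀ + 1))) * ‖saddleTerm s₀ n S‖ ≤
      C₁ * (1 + C₂) * (n : ℝ) ^ (-mu s₀ σ₀) * ‖saddleTerm s₀ n S‖ := by
    have : C₁ * (((n : ℝ) ^ (s₀ / (s₀ + 1))) ^ (-(1 / 2) : ℝ) + C₂ * (n : ℝ) ^ (σ₀ / (s₀ + 1))) ≤
        C₁ * ((n : ℝ) ^ (-mu s₀ σ₀) + C₂ * (n : ℝ) ^ (-mu s₀ σ₀)) := by gcongr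
    refine mul_le_mul_of_nonneg_right (this.trans (le_of_eq (by ring))) (norm_nonneg _)
  have h2re : ((2 * (saddleTerm s₀ n S).re : ℝ) : ℂ) =
      saddleTerm s₀ n S + (starRingEnd ℂ) (saddleTerm s₀ n S) := by
    rw [add_conj]
  rw [h2re]
  have hHS₂ := hHS.trans hmainerr
  have hHS₂' := hHS'.trans hmainerr
  generalize (starRingEnd ℂ) (saddleTerm s₀ n S) = B' at *
  have hrearr : ∀ t₁ t₂ t₃ t₄ t₅ B : ℂ, t₁ + (t₂ + (t₃ + (t₄ + t₅))) - (B + B') =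
      t₁ + ((t₂ - B') + (t₃ + ((t₄ - B) + t₅))) := by intros; ring
  rw [hrearr]
  refine (norm_add_le_of_le hT₁ (norm_add_le_of_le hHS₂' (norm_add_le_of_le hT₂
    (norm_add_le_of_le hHS₂ hT₃)))).trans (le_of_eq ?_)
  ring
end
end PolyMeinardus
end

noncomputable section
namespace PolyMeinardus
open MeasureTheory Complex Set

section
variable {a : ℕ → ℝ} {s₀ σ₀ c : ℝ} {D : ℕ → ℕ → ℂ → ℂ} {A : ℕ → ℕ → ℂ}

/-! ### The expansion over the major arcs -/

theorem exists_norm_le_of_isCompact {X : Set ℂ} (hXc : IsCompact X) (hXB : X ⊆ Metric.ball 0 1) :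
    ∃ r : ℝ, r < 1 ∧ ∀ z ∈ X, ‖z‖ ≤ r := by
  rcases X.eq_empty_or_nonempty with rfl | hne
  · exact ⟨0, one_pos, by simp⟩
  obtain ⟨z₀, hz₀, hmax⟩ := hXc.exists_isMaxOn hne continuous_norm.continuousOn
  exact ⟨‖z₀‖, mem_ball_zero_iff.1 (hXB hz₀), fun z hz => isMaxOn_iff.1 hmax z hz⟩

/-- The modulus |Φ|^{1/(s₀+1)} is continuous even where the principal root is not. -/
theorem exists_norm_L_le (hs₀ : 0 < s₀) {X : Set ℂ} (hXc : IsCompact X)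
    (hXB : X ⊆ Metric.ball 0 1) (h k : ℕ) : ∃ R : ℝ, 0 < R ∧ ∀ z ∈ X, ‖L s₀ A h k z‖ ≤ R := by
  have hc : ContinuousOn (fun z => ‖Phi s₀ A h k z‖ ^ (1 / (s₀ + 1))) X :=
    ((continuousOn_Phi hs₀ A h k).mono hXB).norm.rpow_const fun _ _ => Or.inr (by positivity)
  obtain ⟨R, hR⟩ := hXc.exists_bound_of_continuousOn hc
  refine ⟨max R 1, by positivity, fun z hz => le_max_of_le_left ?_⟩
  rw [L_eq_rt, norm_rt hs₀]
  exact (le_abs_self _).trans (hR z hz)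

theorem inv_norm_omega_le (hadm : Admissible a s₀ σ₀ c D A) (hs₀ : 0 < s₀) (hs₀c : s₀ < c)
    (hσ₀' : σ₀ < 0) {r : ℝ} (hr : r < 1) {h k : ℕ} (hk : 0 < k) :
    ∃ C : ℝ, 0 < C ∧ ∀ n : ℕ, ∀ z : ℂ, ‖z‖ ≤ r → ‖omega D h k n z‖⁻¹ ≤ C := by
  obtain ⟨C, hC, hω⟩ := exists_norm_log_omega_le hadm hs₀ hs₀c hσ₀' hr
  refine ⟨Real.exp (C * (k : ℝ) ^ s₀), Real.exp_pos _, fun n z hz => ?_⟩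
  obtain ⟨W, hW, hWn⟩ := hω h k hk z hz
  rw [norm_omega, hW, norm_exp, ← Real.exp_neg]
  exact Real.exp_le_exp.2 ((neg_le_abs _).trans ((abs_re_le_norm W).trans hWn))

/-- The major arc integrals divided by their root of unity factors, where the contribution of the
minor arcs has been added to the term of index `(p, q)`. -/
def majorArcTerm (a : ℕ → ℝ) (s₀ : ℝ) (D : ℕ → ℕ → ℂ → ℂ) (A : ℕ → ℕ → ℂ) (p q : ℕ) (δ : ℝ)
    (S : Finset (ℕ × ℕ)) (h k n : ℕ) (z : ℂ) : ℂ :=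
  (omega D h k n z)⁻¹ * (arcIntegral a s₀ A p q δ h k n z +
    if (h, k) = (p, q) then Q a n z - ∑ x ∈ S, arcIntegral a s₀ A p q δ x.1 x.2 n z else 0)

theorem sum_omega_mul_majorArcTerm {p q : ℕ} {δ : ℝ} {S : Finset (ℕ × ℕ)} (hpq : (p, q) ∈ S)
    {n : ℕ} {z : ℂ} (hω : ∀ x ∈ S, omega D x.1 x.2 n z ≠ 0) :
    ∑ x ∈ S, omega D x.1 x.2 n z * majorArcTerm a s₀ D A p q δ S x.1 x.2 n z = Q a n z := by
  have h1 : ∀ x ∈ S, omega D x.1 x.2 n z * majorArcTerm a s₀ D A p q δ S x.1 x.2 n z =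
      arcIntegral a s₀ A p q δ x.1 x.2 n z +
        if x = (p, q) then Q a n z - ∑ x ∈ S, arcIntegral a s₀ A p q δ x.1 x.2 n z else 0 :=
    fun x hx => by rw [majorArcTerm, mul_inv_cancel_left₀ (hω x hx)]
  rw [Finset.sum_congr rfl h1, Finset.sum_add_distrib, Finset.sum_ite_eq' S, if_pos hpq,
    add_sub_cancel]

theorem norm_ite_le {p q : ℕ} {x : ℕ × ℕ} {w : ℂ} {B : ℝ} (hw : ‖w‖ ≤ B) :
    ‖(if x = (p, q) then w else 0 : ℂ)‖ ≤ B := by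
  split_ifs
  · exact hw
  · rw [norm_zero]; exact (norm_nonneg _).trans hw

/-- With `majorArcTerm` as Ĩ the expansion of Q_n is an identity; what needs proof is that the
remainder attached to (p,q) is negligible. The threshold for δ combines two demands: minor arcs
exponentially small, and saddle points well inside their arcs. -/
theorem exists_majorArc_expansion (hs₀ : 0 < s₀) (hs₀c : s₀ < c) (hσ₀ : -1 < σ₀) (hσ₀' : σ₀ < 0)
    (hadm : Admissible a s₀ σ₀ c D A) {U : Set ℂ} (hU : U ⊆ Metric.ball (0 : ℂ) 1) {p q : ℕ}
    (hpq : IsIndex p q) {X : Set ℂ} (hXc : IsCompact X) (hXne : X.Nonempty)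
    (hXR : X ⊆ phase s₀ A U p q) {m M : ℝ} (hm : 0 < m)
    (h4 : ∀ z ∈ X, m ≤ (L s₀ A p q z).re ∧ (L s₀ A p q z).re ≤ M)
    (h5 : ∀ ε : ℝ, 0 < ε → ∃ K : ℕ, ∀ h k : ℕ, IsIndex h k → K ≤ k →
      ∀ z ∈ X, |(L s₀ A h k z).re| < ε) (hfin : (phaseClass s₀ A U p q).Finite) :
    ∃ δ₀ : ℝ, 0 < δ₀ ∧ ∀ δ : ℝ, 0 < δ → δ < δ₀ →
    ∃ I : ℕ → ℕ → ℕ → ℂ → ℂ,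
      (∀ᶠ n : ℕ in atTop, ∀ z ∈ X,
        Q a n z = ∑ᶠ x ∈ phaseClass s₀ A U p q, omega D x.1 x.2 n z * I x.1 x.2 n z) ∧
      (∃ η : ℝ, 0 < η ∧ ∀ᶠ n : ℕ in atTop, ∀ z ∈ X, ∀ x ∈ phaseClass s₀ A U p q,
        ‖omega D x.1 x.2 n z * I x.1 x.2 n z - arcIntegral a s₀ A p q δ x.1 x.2 n z‖ ≤
          Real.exp (-η * (n : ℝ) ^ (s₀ / (s₀ + 1))) *
            Real.exp ((s₀ + 1) / s₀ * (n : ℝ) ^ (s₀ / (s₀ + 1)) * (L s₀ A p q z).re)) ∧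
      ∀ h k : ℕ, (h, k) ∈ phaseClass s₀ A U p q →
        ((∀ z ∈ X, Phi s₀ A h k z ∈ slitPlane) →
          ∃ C : ℝ, ∀ᶠ n : ℕ in atTop, ∀ z ∈ X,
            ‖I h k n z - mainTerm s₀ A h k n z‖ ≤
              C * (n : ℝ) ^ (-mu s₀ σ₀) * ‖mainTerm s₀ A h k n z‖) ∧
        ((∀ z ∈ X, Phi s₀ A h k z ∉ slitPlane) →
          ∃ C : ℝ, ∀ᶠ n : ℕ in atTop, ∀ z ∈ X,
            ‖I h k n z - ((2 * (mainTerm s₀ A h k n z).re : ℝ) : ℂ)‖ ≤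
              C * (n : ℝ) ^ (-mu s₀ σ₀) * ‖mainTerm s₀ A h k n z‖) := by
  have hXU : X ⊆ U := fun z hz => (hXR hz).1
  have hXB : X ⊆ Metric.ball 0 1 := hXU.trans hU
  obtain ⟨r, hr, hX⟩ := exists_norm_le_of_isCompact hXc hXB
  have hmM : m ≤ M := by
    obtain ⟨z, hz⟩ := hXne
    exact (h4 z hz).1.trans (h4 z hz).2
  obtain ⟨g, hg, hgm, hgap⟩ := exists_phase_gap hs₀ hm hU hXc hXR (fun z hz => (h4 z hz).1) h5
  set S : Finset (ℕ × ℕ) := hfin.toFinset with hS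
  have hmemS : ∀ x, x ∈ S ↔ x ∈ phaseClass s₀ A U p q := fun x => hfin.mem_toFinset
  obtain ⟨δ₁, hδ₁, hQ⟩ := exists_norm_Q_sub_sum_le hadm hs₀ hs₀c hσ₀ hσ₀' hr hm hmM hg hgm hX h4
    (S := S) (fun x hx => ((hmemS x).1 hx).1)
    (fun h k hi hnS => hgap h k hi fun hc => hnS ((hmemS _).2 hc))
  choose R hR hLR using fun h k => exists_norm_L_le (A := A) hs₀ hXc hXB h k
  have hsmall : ∀ᶠ δ in 𝓝[>] (0 : ℝ), ∀ x ∈ phaseClass s₀ A U p q,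
      R x.1 x.2 + 1 ≤ Real.pi / (x.2 * δ) := by
    refine (Filter.eventually_all_finite hfin).2 fun x hx => ?_
    have hk : (0 : ℝ) < x.2 := by exact_mod_cast hx.1.1.trans_le hx.1.2.1
    have hR1 : 0 < R x.1 x.2 + 1 := by linarith [hR x.1 x.2]
    have hpos : 0 < Real.pi / (x.2 * (R x.1 x.2 + 1)) := by positivity
    filter_upwards [Ioo_mem_nhdsGT hpos] with δ hδ
    have h1 := hδ.2.le
    have h0 : 0 < δ := hδ.1
    rw [le_div_iff₀ (by positivity)] at h1 ⊢
    linarith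
  obtain ⟨δ₂, hδ₂, hsub⟩ := mem_nhdsGT_iff_exists_Ioo_subset.1 hsmall
  refine ⟨min δ₁ δ₂, lt_min hδ₁ hδ₂, fun δ hδ hδlt => ?_⟩
  have hδR := hsub ⟨hδ, hδlt.trans_le (min_le_right _ _)⟩
  have hQ := hQ δ hδ (hδlt.trans_le (min_le_left _ _))
  have hω0 : ∀ x ∈ phaseClass s₀ A U p q, ∀ n, ∀ z ∈ X, omega D x.1 x.2 n z ≠ 0 :=
    fun x hx n z hz => omega_ne_zero hadm hs₀ hs₀c hσ₀' (hx.1.1.trans_le hx.1.2.1) n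
      ((hX z hz).trans_lt hr)
  refine ⟨majorArcTerm a s₀ D A p q δ S, ?_, ⟨g / (2 * s₀), by positivity, ?_⟩, ?_⟩
  · refine Filter.Eventually.of_forall fun n z hz => ?_
    rw [finsum_mem_eq_finite_toFinset_sum _ hfin, ← hS]
    exact (sum_omega_mul_majorArcTerm ((hmemS _).2 (mem_phaseClass_self hpq))
      fun x hx => hω0 x ((hmemS x).1 hx) n z hz).symm
  · filter_upwards [hQ] with n hn z hz x hx
    rw [majorArcTerm, mul_inv_cancel_left₀ (hω0 x hx n z hz), add_sub_cancel_left]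
    refine (norm_ite_le (hn z hz)).trans (le_of_eq ?_)
    rw [← Real.exp_add]
    congr 1
    ring
  · intro h k hx
    have hk : 0 < k := hx.1.1.trans_le hx.1.2.1
    have hre : ∀ z ∈ X, (L s₀ A h k z).re = (L s₀ A p q z).re := fun z hz => hx.2 z (hXU hz)
    obtain ⟨C₁, hC₁, hωinv⟩ := inv_norm_omega_le hadm hs₀ hs₀c hσ₀' hr (h := h) hk
    -- Passing from the arc integral to `majorArcTerm` preserves either asymptotic form: the added
    -- remainder is exponentially smaller than the main term, and 1/ω is bounded for fixed k.
    have hpert : ∀ T : ℕ → ℂ → ℂ, (∃ C : ℝ, 0 < C ∧ ∀ᶠ n : ℕ in atTop, ∀ z ∈ X,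
        ‖(omega D h k n z)⁻¹ * arcIntegral a s₀ A p q δ h k n z - T n z‖ ≤
          C * (n : ℝ) ^ (-mu s₀ σ₀) * ‖mainTerm s₀ A h k n z‖) →
        ∃ C : ℝ, ∀ᶠ n : ℕ in atTop, ∀ z ∈ X,
          ‖majorArcTerm a s₀ D A p q δ S h k n z - T n z‖ ≤
            C * (n : ℝ) ^ (-mu s₀ σ₀) * ‖mainTerm s₀ A h k n z‖ := by
      rintro T ⟨C, -, hT⟩
      refine ⟨C + C₁, ?_⟩
      filter_upwards [hT, hQ, eventually_exp_le_saddleTerm (κ := mu s₀ σ₀) hs₀ hm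
        (by positivity : 0 < g / (2 * s₀))] with n hn hQn hexp z hz
      have h1 := hexp (L s₀ A h k z) (by rw [hre z hz]; exact (h4 z hz).1)
      rw [hre z hz, ← mainTerm_eq_saddleTerm] at h1
      have h2 := norm_ite_le (p := p) (q := q) (x := (h, k)) ((hQn z hz).trans h1)
      rw [majorArcTerm, mul_add, add_sub_right_comm, add_mul, add_mul]
      refine norm_add_le_of_le (hn z hz) ?_
      rw [norm_mul, norm_inv, mul_assoc]
      exact mul_le_mul (hωinv n z (hX z hz)) h2 (norm_nonneg _) hC₁.le
    exact ⟨fun hslit => hpert _ (exists_arcIntegral_bound_slitPlane hadm hs₀ hs₀c hσ₀ hσ₀' hr hm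
        hmM hδ hx.1 hXc hX h4 hre (hR h k) (hLR h k) (hδR (h, k) hx) hslit),
      fun hslit => hpert _ (exists_arcIntegral_bound_not_slitPlane hadm hs₀ hs₀c hσ₀ hσ₀' hr hm
        hmM hδ hx.1 hXc hX h4 hre (hR h k) (hLR h k) (hδR (h, k) hx) hslit)⟩
end
end PolyMeinardus
end

theorem mainTheorem1
    (a : ℕ → ℝ) (s₀ σ₀ c : ℝ) (D : ℕ → ℕ → ℂ → ℂ) (A : ℕ → ℕ → ℂ)
    (hs₀ : 0 < s₀) (hs₀c : s₀ < c) (hσ₀ : -1 < σ₀) (hσ₀' : σ₀ < 0)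
    (hadm : PolyMeinardus.Admissible a s₀ σ₀ c D A)
    (U : Set ℂ) (hU : U ⊆ Metric.ball (0 : ℂ) 1)
    (p q : ℕ) (hpq : PolyMeinardus.IsIndex p q)
    (X : Set ℂ) (hXc : IsCompact X) (hXne : X.Nonempty)
    (hXR : X ⊆ PolyMeinardus.phase s₀ A U p q)
    (h4 : ∃ m M : ℝ, 0 < m ∧ ∀ z ∈ X,
      m ≤ (PolyMeinardus.L s₀ A p q z).re ∧ (PolyMeinardus.L s₀ A p q z).re ≤ M)
    (h5 : ∀ ε : ℝ, 0 < ε → ∃ K : ℕ, ∀ h k : ℕ, PolyMeinardus.IsIndex h k → K ≤ k →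
      ∀ z ∈ X, |(PolyMeinardus.L s₀ A h k z).re| < ε) :
    -- there are finitely many major arcs
    (PolyMeinardus.phaseClass s₀ A U p q).Finite ∧
    -- for open `U` the two sign conditions below are the same for all major arcs
    (IsOpen U → ∀ x ∈ PolyMeinardus.phaseClass s₀ A U p q, ∀ z ∈ U,
      PolyMeinardus.Phi s₀ A x.1 x.2 z = PolyMeinardus.Phi s₀ A p q z) ∧
    ∃ δ₀ : ℝ, 0 < δ₀ ∧ ∀ δ : ℝ, 0 < δ → δ < δ₀ →
    ∃ I : ℕ → ℕ → ℕ → ℂ → ℂ,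
      -- the expansion of `Q_n(z)` over the major arcs
      (∀ᶠ n : ℕ in Filter.atTop, ∀ z ∈ X,
        PolyMeinardus.Q a n z = ∑ᶠ x ∈ PolyMeinardus.phaseClass s₀ A U p q,
          PolyMeinardus.omega D x.1 x.2 n z * I x.1 x.2 n z) ∧
      -- its terms are the major arc integrals, up to an exponentially smaller quantity
      (∃ η : ℝ, 0 < η ∧ ∀ᶠ n : ℕ in Filter.atTop, ∀ z ∈ X,
        ∀ x ∈ PolyMeinardus.phaseClass s₀ A U p q,
        ‖PolyMeinardus.omega D x.1 x.2 n z * I x.1 x.2 n z -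
            PolyMeinardus.arcIntegral a s₀ A p q δ x.1 x.2 n z‖ ≤
          Real.exp (-η * (n : ℝ) ^ (s₀ / (s₀ + 1))) *
            Real.exp ((s₀ + 1) / s₀ * (n : ℝ) ^ (s₀ / (s₀ + 1)) *
              (PolyMeinardus.L s₀ A p q z).re)) ∧
      ∀ h k : ℕ, (h, k) ∈ PolyMeinardus.phaseClass s₀ A U p q →
        -- `Φ_{h,k}` takes no value in `(-∞, 0]` on `X`
        ((∀ z ∈ X, PolyMeinardus.Phi s₀ A h k z ∈ Complex.slitPlane) →
          ∃ C : ℝ, ∀ᶠ n : ℕ in Filter.atTop, ∀ z ∈ X,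
            ‖I h k n z - PolyMeinardus.mainTerm s₀ A h k n z‖ ≤
              C * (n : ℝ) ^ (-PolyMeinardus.mu s₀ σ₀) *
                ‖PolyMeinardus.mainTerm s₀ A h k n z‖) ∧
        -- all values of `Φ_{h,k}` on `X` lie in `(-∞, 0]`
        ((∀ z ∈ X, PolyMeinardus.Phi s₀ A h k z ∉ Complex.slitPlane) →
          ∃ C : ℝ, ∀ᶠ n : ℕ in Filter.atTop, ∀ z ∈ X,
            ‖I h k n z - ((2 * (PolyMeinardus.mainTerm s₀ A h k n z).re : ℝ) : ℂ)‖ ≤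
              C * (n : ℝ) ^ (-PolyMeinardus.mu s₀ σ₀) *
                ‖PolyMeinardus.mainTerm s₀ A h k n z‖) := by
  obtain ⟨m, M, hm, h4⟩ := h4
  have hXU : X ⊆ U := fun z hz => (hXR hz).1
  have hfin := PolyMeinardus.finite_phaseClass hm hXne hXU (fun z hz => (h4 z hz).1) h5
  exact ⟨hfin, fun hUo x hx z hz => PolyMeinardus.Phi_eq_of_isOpen hs₀ hU hUo hXne hXU
      (fun z hz => hm.trans_le (h4 z hz).1) hx hz,
    PolyMeinardus.exists_majorArc_expansion hs₀ hs₀c hσ₀ hσ₀' hadm hU hpq hXc hXne hXR hm h4 h5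
      hfin⟩
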